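/- **Lemma (Correspondence).** Fix sets of strings $s$, numbers, addresses $a$, variables $x$, labels $\ell$ and primitive operations $\mathit{op}$. *Constants* are strings, numbers, addresses, $\mathtt{true},\mathtt{false},\mathtt{undef},\mathtt{null}$. *Expressions* are $$e ::= x \mid k \mid \mathtt{func}(\vec x)\{e\} \mid \{\overrightarrow{s{:}e}\} \mid \mathtt{let}\,(x=e)\,e \mid e(\vec e) \mid e[e] \mid e[e]=e \mid \mathtt{delete}\,e[e] \mid e=e \mid \mathtt{ref}\,e \mid \mathtt{deref}\,e \mid \mathtt{if}(e)\{e\}\{e\} \mid e;e \mid \mathtt{while}(e)\{e\} \mid \ell{:}\{e\} \mid \mathtt{break}\,\ell\,e \mid \mathtt{try}\{e\}\mathtt{catch}(x)\{e\} \mid \mathtt{try}\{e\}\mathtt{finally}\{e\} \mid \mathtt{throw}\,e \mid \mathit{op}(\vec e)$$ with $k$ a constant; a *program* is an expression without free variables. *Syntactic values* are constants, functions and records of syntactic values. *Closures* $c$ are generated by pairs $(e,\rho)$, constants, and all the forms above other than variables and functions with closures in place of expressions, where an *environment* $\rho$ is a finite map from variables to values; *values* $v$ are constants, pairs $(\mathtt{func}(\vec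 x)\{e\},\rho)$ and records of values. A *store* $\sigma$ is a finite map from addresses to values; an *answer* is $\langle\sigma,v\rangle$ or $\langle\sigma,\mathtt{err}\,v\rangle$ (over syntactic values for $\lambda_{JS}$, over values for $\lambda\rho_{JS}$). *Contexts* (the same for expressions and closures): $\mathcal C ::= [\,] \mid \mathtt{let}(x=\mathcal C)c \mid \mathcal C(\vec c) \mid v(\vec v,\mathcal C,\vec c) \mid \{\overrightarrow{s{:}v},s{:}\mathcal C,\overrightarrow{s{:}c}\} \mid \mathit{op}(\vec v,\mathcal C,\vec c) \mid \mathcal C[c] \mid v[\mathcal C] \mid \mathcal C[c]=c \mid v[\mathcal C]=c \mid v[v]=\mathcal C \mid \mathtt{delete}\,\mathcal C[c] \mid \mathtt{delete}\,v[\mathcal C] \mid \mathtt{ref}\,\mathcal C \mid \mathtt{deref}\,\mathcal C \mid \mathcal C=c \mid v=\mathcal C \mid \mathtt{if}(\mathcal C)\{c\}\{c\} \mid \mathcal C;c \mid \mathtt{throw}\,\mathcal C \mid \mathtt{break}\,\ell\,\mathcal C$; $\mathcal D ::= [\,] \mid \mathtt{try}\{\mathcal C[\mathcal D]\}\mathtt{finally}\{c\}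 \mid \ell{:}\{\mathcal C[\mathcal D]\} \mid \mathtt{try}\{\mathcal C[\mathcal D]\}\mathtt{catch}(x)\{c\}$; $\mathcal E ::= \mathcal C[\mathcal D]$; $\mathcal F ::= \mathcal C \mid \mathcal C[\ell{:}\{\mathcal F\}]$; $\mathcal G ::= \mathcal C \mid \mathcal C[\mathtt{try}\{\mathcal G\}\mathtt{catch}(x)\{c\}]$. *Rules common to both calculi*, applied inside any $\mathcal E$ (with $c$ an expression in $\lambda_{JS}$, a closure in $\lambda\rho_{JS}$): $\{\ldots,s{:}v,\ldots\}[s]\to v$; $\{\overrightarrow{s{:}v}\}[s']\to\mathtt{undef}$ if $s'\notin\vec s$; $(\{\ldots,s{:}u,\ldots\}[s]=v)\to\{\ldots,s{:}v,\ldots\}$; $(\{\overrightarrow{s{:}v}\}[s']=v)\to\{s'{:}v,\overrightarrow{s{:}v}\}$ if $s'\notin\vec s$; $\mathtt{delete}\,\{\ldots,s{:}u,\ldots\}[s]$ removes that field, and leaves the record unchanged if $s$ is not a key; $\mathtt{if}(\mathtt{true})\{c_1\}\{c_2\}\to c_1$, $\mathtt{if}(\mathtt{false})\{c_1\}\{c_2\}\to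 c_2$; $v;c\to c$; $\mathtt{while}(c_1)\{c_2\}\to\mathtt{if}(c_1)\{c_2;\mathtt{while}(c_1)\{c_2\}\}\{\mathtt{undef}\}$; $\mathtt{try}\{v\}\mathtt{catch}(x)\{c\}\to v$; $\mathtt{try}\{v\}\mathtt{finally}\{c\}\to c;v$; $\ell{:}\{v\}\to v$; $\mathit{op}(\vec v)\to\delta(\mathit{op},\vec v)$ where defined; $\langle\sigma,\mathcal E[\mathtt{ref}\,v]\rangle\to\langle\sigma[a\mapsto v],\mathcal E[a]\rangle$ for any $a\notin\mathrm{dom}\,\sigma$; $\langle\sigma,\mathcal E[\mathtt{deref}\,a]\rangle\to\langle\sigma,\mathcal E[\sigma(a)]\rangle$; $\langle\sigma,\mathcal E[a=v]\rangle\to\langle\sigma[a\mapsto v],\mathcal E[v]\rangle$. Moreover, run-time errors (calling a non-function or with the wrong number of arguments; indexing, updating or deleting in a non-record or with a non-string key; branching on a non-boolean; dereferencing a non-address or an unallocated address; assigning to a non-address; an undefined primitive application) reduce in place to $\mathtt{throw}\,k$ with a fixed constant $k$ for each kind of error. *$\lambda_{JS}$* (on expressions) adds, inside any $\mathcal E$: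 $\mathtt{let}(x=v)e\to[v/x]e$; $(\mathtt{func}(\vec x)\{e\})(\vec v)\to[\vec v/\vec x]e$ if $|\vec x|=|\vec v|$; $\mathtt{try}\{\mathcal F[\mathtt{throw}\,v]\}\mathtt{catch}(x)\{e\}\to[v/x]e$; $\mathtt{try}\{\mathcal F[\mathtt{throw}\,v]\}\mathtt{finally}\{e\}\to e;\mathtt{throw}\,v$; $\mathtt{try}\{\mathcal G[\mathtt{break}\,\ell\,v]\}\mathtt{finally}\{e\}\to e;\mathtt{break}\,\ell\,v$; $\ell'{:}\{\mathcal G[\mathtt{break}\,\ell\,v]\}\to v$ if $\ell'=\ell$, and $\to\mathtt{break}\,\ell\,v$ otherwise; and at top level $\langle\sigma,\mathcal F[\mathtt{throw}\,v]\rangle\to\langle\sigma,\mathtt{err}\,v\rangle$ and $\langle\sigma,\mathcal G[\mathtt{break}\,\ell\,v]\rangle\to\langle\sigma,\mathtt{throw}\,k\rangle$ (run-time error: unbound label). *$\lambda\rho_{JS}$* (on closures) adds, inside any $\mathcal E$: $(x,\rho)\to\rho(x)$; $\mathtt{let}(x=v)(e,\rho)\to(e,\rho[x\mapsto v])$; $(\mathtt{func}(\vec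 x)\{e\},\rho)(\vec v)\to(e,\rho[\vec x\mapsto\vec v])$ if $|\vec x|=|\vec v|$; the propagation of $\rho$ from $(e,\rho)$ to the immediate subexpressions of $e$ when $e$ is neither a variable nor a function (in particular $(k,\rho)\to k$); $\mathtt{try}\{\mathcal C[\mathtt{throw}\,v]\}\mathtt{catch}(x)\{(e,\rho)\}\to(e,\rho[x\mapsto v])$; $\mathtt{try}\{\mathcal C[\mathtt{throw}\,v]\}\mathtt{finally}\{c\}\to c;\mathtt{throw}\,v$; $\ell{:}\{\mathcal C[\mathtt{throw}\,v]\}\to\mathtt{throw}\,v$; $\mathtt{try}\{\mathcal C[\mathtt{break}\,\ell\,v]\}\mathtt{catch}(x)\{c\}\to\mathtt{break}\,\ell\,v$; $\mathtt{try}\{\mathcal C[\mathtt{break}\,\ell\,v]\}\mathtt{finally}\{c\}\to c;\mathtt{break}\,\ell\,v$; $\ell'{:}\{\mathcal C[\mathtt{break}\,\ell\,v]\}\to v$ if $\ell'=\ell$, and $\to\mathtt{break}\,\ell\,v$ otherwise; and at top level $\langle\sigma,\mathcal C[\mathtt{throw}\,v]\rangle\to\langle\sigma,\mathtt{err}\,v\rangle$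 and $\langle\sigma,\mathcal C[\mathtt{break}\,\ell\,v]\rangle\to\langle\sigma,\mathtt{throw}\,k\rangle$. Let $\mathcal U$ map values to syntactic values by $\mathcal U(k)=k$, $\mathcal U(\mathtt{func}(\vec x)\{e\},\{(x_0,v_0),\dots,(x_n,v_n)\})=[\mathcal U(v_0)/x_0,\dots,\mathcal U(v_n)/x_n](\mathtt{func}(\vec x)\{e\})$ and fieldwise on records, and answers to answers by applying it to the result (the value $v$, or the $v$ of $\mathtt{err}\,v$) and to every value in the store. The partial functions $\delta$ of the two calculi are arbitrary, subject to: on closed values they agree up to $\mathcal U$ (including where they are undefined), and their results on closed values are closed values. Then for every program $e$ and every $\lambda_{JS}$ answer $A$, $$\langle\emptyset,e\rangle\longrightarrow^*_{\lambda_{JS}}A\iff\text{there is an answer }A'\text{ with }\langle\emptyset,(e,\emptyset)\rangle\longrightarrow^*_{\lambda\rho_{JS}}A'\text{ and }A=\mathcal U(A').$$ -/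

import Mathlib

/-! # The substitution calculus `λ_JS` and the explicit-substitution calculus `λρ_JS` -/

namespace LambdaJS

/-- The run-time errors for which the calculi raise an exception. -/
inductive RuntimeError : Type
  | badCall
  | badIndex
  | badUpdate
  | badDelete
  | badCondition
  | badDeref
  | badAssign
  | badPrim
  | unboundLabel

/-- Syntactic constants over given sets of strings, numbers and addresses. -/
inductive ConstOf (Str Num Addr : Type) : Type
  | str (s : Str)
  | num (n : Num)
  | addr (a : Addr)
  | bool (b : Bool)
  | undef
  | null

/-- The basic sets over which the syntax is built, together with the constant that is thrown
for each kind of run-time error. -/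
structure Domains where
  Str : Type
  Num : Type
  Addr : Type
  Var : Type
  Label : Type
  Op : Type
  decVar : DecidableEq Var
  decAddr : DecidableEq Addr
  errConst : RuntimeError → ConstOf Str Num Addr

attribute [instance] Domains.decVar Domains.decAddr

variable (S : Domains)

abbrev Domains.Const : Type := ConstOf S.Str S.Num S.Addr

/-! ## Expressions -/

/-- Expressions `e`. -/
inductive Expr : Type
  | var (x : S.Var)
  | const (k : S.Const)
  | func (xs : List S.Var) (body : Expr)
  | record (fs : List (S.Str × Expr))
  | letin (x : S.Var) (e body : Expr)
  | app (f : Expr) (args : List Expr)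
  | get (o key : Expr)
  | put (o key e : Expr)
  | del (o key : Expr)
  | assign (l e : Expr)
  | alloc (e : Expr)
  | deref (e : Expr)
  | ite (c t f : Expr)
  | seq (a b : Expr)
  | whl (c body : Expr)
  | label (l : S.Label) (e : Expr)
  | brk (l : S.Label) (e : Expr)
  | tryc (e : Expr) (x : S.Var) (h : Expr)
  | tryf (e f : Expr)
  | throw (e : Expr)
  | prim (op : S.Op) (args : List Expr)

/-- Closures `c`. Bare constants are closures as well, since every value is a closure; a function
value is the closure `clos (func xs e) ρ`, a record value is a `record` of values.
An environment is a finite map given as an association list, in which the first entry for a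
variable counts. -/
inductive Clo : Type
  | const (k : S.Const)
  | clos (e : Expr S) (ρ : List (S.Var × Clo))
  | record (fs : List (S.Str × Clo))
  | letin (x : S.Var) (c body : Clo)
  | app (f : Clo) (args : List Clo)
  | get (o key : Clo)
  | put (o key c : Clo)
  | del (o key : Clo)
  | assign (l c : Clo)
  | alloc (c : Clo)
  | deref (c : Clo)
  | ite (c t f : Clo)
  | seq (a b : Clo)
  | whl (c body : Clo)
  | label (l : S.Label) (c : Clo)
  | brk (l : S.Label) (c : Clo)
  | tryc (c : Clo) (x : S.Var) (h : Clo)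
  | tryf (c f : Clo)
  | throw (c : Clo)
  | prim (op : S.Op) (args : List Clo)

abbrev Env : Type := List (S.Var × Clo S)

variable {S}

/-- Syntactic values. -/
inductive Expr.IsValue : Expr S → Prop
  | const (k : S.Const) : Expr.IsValue (.const k)
  | func (xs : List S.Var) (e : Expr S) : Expr.IsValue (.func xs e)
  | record (fs : List (S.Str × Expr S)) (h : ∀ p ∈ fs, Expr.IsValue p.2) :
      Expr.IsValue (.record fs)

/-- Values `v` of the calculus of explicit substitutions. -/
inductive Clo.IsValue : Clo S → Prop
  | const (k : S.Const) : Clo.IsValue (.const k)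
  | func (xs : List S.Var) (e : Expr S) (ρ : Env S) (h : ∀ p ∈ ρ, Clo.IsValue p.2) :
      Clo.IsValue (.clos (.func xs e) ρ)
  | record (fs : List (S.Str × Clo S)) (h : ∀ p ∈ fs, Clo.IsValue p.2) :
      Clo.IsValue (.record fs)

mutual
/-- Free variables. -/
def Expr.fv : Expr S → Set S.Var
  | .var x => {x}
  | .const _ => ∅
  | .func xs e => e.fv \ {x | x ∈ xs}
  | .record fs => Expr.fvFields fs
  | .letin x e b => e.fv ∪ (b.fv \ {x})
  | .app f as => f.fv ∪ Expr.fvList as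
  | .get o k => o.fv ∪ k.fv
  | .put o k e => o.fv ∪ k.fv ∪ e.fv
  | .del o k => o.fv ∪ k.fv
  | .assign l e => l.fv ∪ e.fv
  | .alloc e => e.fv
  | .deref e => e.fv
  | .ite c t f => c.fv ∪ t.fv ∪ f.fv
  | .seq a b => a.fv ∪ b.fv
  | .whl c b => c.fv ∪ b.fv
  | .label _ e => e.fv
  | .brk _ e => e.fv
  | .tryc e x h => e.fv ∪ (h.fv \ {x})
  | .tryf e f => e.fv ∪ f.fv
  | .throw e => e.fv
  | .prim _ as => Expr.fvList as
def Expr.fvList : List (Expr S) → Set S.Var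
  | [] => ∅
  | e :: es => e.fv ∪ Expr.fvList es
def Expr.fvFields : List (S.Str × Expr S) → Set S.Var
  | [] => ∅
  | (_, e) :: fs => e.fv ∪ Expr.fvFields fs
end

/-- A program is a closed expression. -/
def Expr.Closed (e : Expr S) : Prop := e.fv = ∅

/-- Closed values: every free variable of a function is bound by its environment, whose values
are closed in turn. -/
inductive Clo.IsClosedValue : Clo S → Prop
  | const (k : S.Const) : Clo.IsClosedValue (.const k)
  | func (xs : List S.Var) (e : Expr S) (ρ : Env S)
      (hdom : ∀ x ∈ (Expr.func xs e).fv, ∃ p ∈ ρ, p.1 = x)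
      (h : ∀ p ∈ ρ, Clo.IsClosedValue p.2) : Clo.IsClosedValue (.clos (.func xs e) ρ)
  | record (fs : List (S.Str × Clo S)) (h : ∀ p ∈ fs, Clo.IsClosedValue p.2) :
      Clo.IsClosedValue (.record fs)

/-! ## Substitution -/

/-- The substitution `θ` with the variables `xs` removed from its domain. -/
def hide (θ : S.Var → Option (Expr S)) (xs : List S.Var) : S.Var → Option (Expr S) :=
  fun y => if y ∈ xs then none else θ y

mutual
/-- Simultaneous replacement of the free occurrences of variables. No bound variable is renamed:
in the reduction of programs only closed values are substituted. -/
def Expr.subst (θ : S.Var → Option (Expr S)) : Expr S → Expr S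
  | .var x => (θ x).getD (.var x)
  | .const k => .const k
  | .func xs e => .func xs (e.subst (hide θ xs))
  | .record fs => .record (Expr.substFields θ fs)
  | .letin x e b => .letin x (e.subst θ) (b.subst (hide θ [x]))
  | .app f as => .app (f.subst θ) (Expr.substList θ as)
  | .get o k => .get (o.subst θ) (k.subst θ)
  | .put o k e => .put (o.subst θ) (k.subst θ) (e.subst θ)
  | .del o k => .del (o.subst θ) (k.subst θ)
  | .assign l e => .assign (l.subst θ) (e.subst θ)
  | .alloc e => .alloc (e.subst θ)
  | .deref e => .deref (e.subst θ)
  | .ite c t f => .ite (c.subst θ) (t.subst θ) (f.subst θ)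
  | .seq a b => .seq (a.subst θ) (b.subst θ)
  | .whl c b => .whl (c.subst θ) (b.subst θ)
  | .label l e => .label l (e.subst θ)
  | .brk l e => .brk l (e.subst θ)
  | .tryc e x h => .tryc (e.subst θ) x (h.subst (hide θ [x]))
  | .tryf e f => .tryf (e.subst θ) (f.subst θ)
  | .throw e => .throw (e.subst θ)
  | .prim op as => .prim op (Expr.substList θ as)
def Expr.substList (θ : S.Var → Option (Expr S)) : List (Expr S) → List (Expr S)
  | [] => []
  | e :: es => e.subst θ :: Expr.substList θ es
def Expr.substFields (θ : S.Var → Option (Expr S)) :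
    List (S.Str × Expr S) → List (S.Str × Expr S)
  | [] => []
  | (s, e) :: fs => (s, e.subst θ) :: Expr.substFields θ fs
end

/-- The simultaneous substitution `[v₀/x₀, …, vₙ/xₙ]` given by an association list. -/
def assoc (l : List (S.Var × Expr S)) : S.Var → Option (Expr S) := fun y => l.lookup y

/-! ## States and answers -/

/-- The second component of a state: a term under evaluation, or an uncaught exception `err v`. -/
inductive Outcome (T : Type) : Type
  | run (t : T)
  | err (v : T)

/-- Stores: partial maps from addresses to terms. -/
abbrev Store (S : Domains) (T : Type) : Type := S.Addr → Option T

abbrev State (S : Domains) (T : Type) : Type := Store S T × Outcome T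

def emptyStore {T : Type} : Store S T := fun _ => none

/-- Answers `⟨σ, v⟩` and `⟨σ, err v⟩`, where `σ` is a finite map from addresses to values and
`IsVal` says what the values are. -/
def IsAnswer {T : Type} (IsVal : T → Prop) (A : State S T) : Prop :=
  {a | A.1 a ≠ none}.Finite ∧ (∀ a v, A.1 a = some v → IsVal v) ∧
    ∃ v, IsVal v ∧ (A.2 = .run v ∨ A.2 = .err v)

/-! ## The substitution calculus `λ_JS` -/

namespace JS

/-- Local evaluation contexts `C`, with break contexts. -/
inductive LocalCtx : (Expr S → Expr S) → Prop
  | hole : LocalCtx (fun t => t)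
  | letin {C} (x : S.Var) (b : Expr S) : LocalCtx C → LocalCtx (fun t => .letin x (C t) b)
  | appFun {C} (as : List (Expr S)) : LocalCtx C → LocalCtx (fun t => .app (C t) as)
  | appArg {C} (f : Expr S) (vs es : List (Expr S)) (hf : f.IsValue) (hvs : ∀ v ∈ vs, v.IsValue) :
      LocalCtx C → LocalCtx (fun t => .app f (vs ++ C t :: es))
  | record {C} (fs : List (S.Str × Expr S)) (s : S.Str) (gs : List (S.Str × Expr S))
      (hfs : ∀ p ∈ fs, p.2.IsValue) :
      LocalCtx C → LocalCtx (fun t => .record (fs ++ (s, C t) :: gs))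
  | prim {C} (op : S.Op) (vs es : List (Expr S)) (hvs : ∀ v ∈ vs, v.IsValue) :
      LocalCtx C → LocalCtx (fun t => .prim op (vs ++ C t :: es))
  | getObj {C} (k : Expr S) : LocalCtx C → LocalCtx (fun t => .get (C t) k)
  | getKey {C} (o : Expr S) (ho : o.IsValue) : LocalCtx C → LocalCtx (fun t => .get o (C t))
  | putObj {C} (k e : Expr S) : LocalCtx C → LocalCtx (fun t => .put (C t) k e)
  | putKey {C} (o e : Expr S) (ho : o.IsValue) : LocalCtx C → LocalCtx (fun t => .put o (C t) e)
  | putVal {C} (o k : Expr S) (ho : o.IsValue) (hk : k.IsValue) :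
      LocalCtx C → LocalCtx (fun t => .put o k (C t))
  | delObj {C} (k : Expr S) : LocalCtx C → LocalCtx (fun t => .del (C t) k)
  | delKey {C} (o : Expr S) (ho : o.IsValue) : LocalCtx C → LocalCtx (fun t => .del o (C t))
  | alloc {C} : LocalCtx C → LocalCtx (fun t => .alloc (C t))
  | deref {C} : LocalCtx C → LocalCtx (fun t => .deref (C t))
  | assignLoc {C} (e : Expr S) : LocalCtx C → LocalCtx (fun t => .assign (C t) e)
  | assignVal {C} (l : Expr S) (hl : l.IsValue) : LocalCtx C → LocalCtx (fun t => .assign l (C t))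
  | ite {C} (a b : Expr S) : LocalCtx C → LocalCtx (fun t => .ite (C t) a b)
  | seq {C} (e : Expr S) : LocalCtx C → LocalCtx (fun t => .seq (C t) e)
  | throw {C} : LocalCtx C → LocalCtx (fun t => .throw (C t))
  | brk {C} (l : S.Label) : LocalCtx C → LocalCtx (fun t => .brk l (C t))

/-- Control contexts `D`. -/
inductive ControlCtx : (Expr S → Expr S) → Prop
  | hole : ControlCtx (fun t => t)
  | tryf {C D} (f : Expr S) : LocalCtx C → ControlCtx D → ControlCtx (fun t => .tryf (C (D t)) f)
  | label {C D} (l : S.Label) :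
      LocalCtx C → ControlCtx D → ControlCtx (fun t => .label l (C (D t)))
  | tryc {C D} (x : S.Var) (h : Expr S) :
      LocalCtx C → ControlCtx D → ControlCtx (fun t => .tryc (C (D t)) x h)

/-- General evaluation contexts `E ::= C[D]`. -/
inductive EvalCtx : (Expr S → Expr S) → Prop
  | mk {C D} : LocalCtx C → ControlCtx D → EvalCtx (fun t => C (D t))

/-- Local contexts including labels, `F ::= C | C[label l F]`. -/
inductive LabelCtx : (Expr S → Expr S) → Prop
  | loc {C} : LocalCtx C → LabelCtx C
  | label {C F} (l : S.Label) : LocalCtx C → LabelCtx F → LabelCtx (fun t => C (.label l (F t)))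

/-- Local contexts including exception handlers, `G ::= C | C[try G catch x e]`. -/
inductive HandlerCtx : (Expr S → Expr S) → Prop
  | loc {C} : LocalCtx C → HandlerCtx C
  | tryc {C G} (x : S.Var) (h : Expr S) :
      LocalCtx C → HandlerCtx G → HandlerCtx (fun t => C (.tryc (G t) x h))

/-- The exception raised by a run-time error. -/
def raise (r : RuntimeError) : Expr S := .throw (.const (S.errConst r))

/-- Context-insensitive, store-insensitive reductions, including those that raise run-time
errors; `δ` interprets the primitive operations. -/
inductive Red (δ : S.Op → List (Expr S) → Option (Expr S)) : Expr S → Expr S → Prop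
  | letin (x : S.Var) (v e : Expr S) (hv : v.IsValue) :
      Red δ (.letin x v e) (e.subst (assoc [(x, v)]))
  | app (xs : List S.Var) (e : Expr S) (vs : List (Expr S)) (hvs : ∀ v ∈ vs, v.IsValue)
      (hlen : xs.length = vs.length) :
      Red δ (.app (.func xs e) vs) (e.subst (assoc (xs.zip vs)))
  | getHit (fs gs : List (S.Str × Expr S)) (s : S.Str) (v : Expr S)
      (hr : (Expr.record (fs ++ (s, v) :: gs)).IsValue) :
      Red δ (.get (.record (fs ++ (s, v) :: gs)) (.const (.str s))) v
  | getMiss (fs : List (S.Str × Expr S)) (s : S.Str) (hr : (Expr.record fs).IsValue)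
      (hs : s ∉ fs.map Prod.fst) :
      Red δ (.get (.record fs) (.const (.str s))) (.const .undef)
  | putHit (fs gs : List (S.Str × Expr S)) (s : S.Str) (u v : Expr S)
      (hr : (Expr.record (fs ++ (s, u) :: gs)).IsValue) (hv : v.IsValue) :
      Red δ (.put (.record (fs ++ (s, u) :: gs)) (.const (.str s)) v)
        (.record (fs ++ (s, v) :: gs))
  | putMiss (fs : List (S.Str × Expr S)) (s : S.Str) (v : Expr S)
      (hr : (Expr.record fs).IsValue) (hv : v.IsValue) (hs : s ∉ fs.map Prod.fst) :
      Red δ (.put (.record fs) (.const (.str s)) v) (.record ((s, v) :: fs))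
  | delHit (fs gs : List (S.Str × Expr S)) (s : S.Str) (u : Expr S)
      (hr : (Expr.record (fs ++ (s, u) :: gs)).IsValue) :
      Red δ (.del (.record (fs ++ (s, u) :: gs)) (.const (.str s))) (.record (fs ++ gs))
  | delMiss (fs : List (S.Str × Expr S)) (s : S.Str) (hr : (Expr.record fs).IsValue)
      (hs : s ∉ fs.map Prod.fst) :
      Red δ (.del (.record fs) (.const (.str s))) (.record fs)
  | iteTrue (a b : Expr S) : Red δ (.ite (.const (.bool true)) a b) a
  | iteFalse (a b : Expr S) : Red δ (.ite (.const (.bool false)) a b) b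
  | seq (v e : Expr S) (hv : v.IsValue) : Red δ (.seq v e) e
  | whl (a b : Expr S) : Red δ (.whl a b) (.ite a (.seq b (.whl a b)) (.const .undef))
  | tryc (v : Expr S) (x : S.Var) (h : Expr S) (hv : v.IsValue) : Red δ (.tryc v x h) v
  | tryf (v e : Expr S) (hv : v.IsValue) : Red δ (.tryf v e) (.seq e v)
  | label (l : S.Label) (v : Expr S) (hv : v.IsValue) : Red δ (.label l v) v
  | prim (op : S.Op) (vs : List (Expr S)) (v : Expr S) (hvs : ∀ v ∈ vs, v.IsValue)
      (hδ : δ op vs = some v) : Red δ (.prim op vs) v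
  -- run-time errors
  | badCall (f : Expr S) (vs : List (Expr S)) (hf : f.IsValue) (hvs : ∀ v ∈ vs, v.IsValue)
      (hbad : ¬ ∃ xs e, f = .func xs e ∧ xs.length = vs.length) :
      Red δ (.app f vs) (raise .badCall)
  | badIndex (o k : Expr S) (ho : o.IsValue) (hk : k.IsValue)
      (hbad : ¬ ∃ fs s, o = .record fs ∧ k = .const (.str s)) :
      Red δ (.get o k) (raise .badIndex)
  | badUpdate (o k v : Expr S) (ho : o.IsValue) (hk : k.IsValue) (hv : v.IsValue)
      (hbad : ¬ ∃ fs s, o = .record fs ∧ k = .const (.str s)) :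
      Red δ (.put o k v) (raise .badUpdate)
  | badDelete (o k : Expr S) (ho : o.IsValue) (hk : k.IsValue)
      (hbad : ¬ ∃ fs s, o = .record fs ∧ k = .const (.str s)) :
      Red δ (.del o k) (raise .badDelete)
  | badCondition (v a b : Expr S) (hv : v.IsValue) (hbad : ¬ ∃ t, v = .const (.bool t)) :
      Red δ (.ite v a b) (raise .badCondition)
  | badDeref (v : Expr S) (hv : v.IsValue) (hbad : ¬ ∃ a, v = .const (.addr a)) :
      Red δ (.deref v) (raise .badDeref)
  | badAssign (u v : Expr S) (hu : u.IsValue) (hv : v.IsValue)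
      (hbad : ¬ ∃ a, u = .const (.addr a)) :
      Red δ (.assign u v) (raise .badAssign)
  | badPrim (op : S.Op) (vs : List (Expr S)) (hvs : ∀ v ∈ vs, v.IsValue) (hδ : δ op vs = none) :
      Red δ (.prim op vs) (raise .badPrim)

/-- One-step reduction of `λ_JS`. -/
inductive Step (δ : S.Op → List (Expr S) → Option (Expr S)) :
    State S (Expr S) → State S (Expr S) → Prop
  | ctx (σ : Store S (Expr S)) {E} (hE : EvalCtx E) {e e' : Expr S} (h : Red δ e e') :
      Step δ (σ, .run (E e)) (σ, .run (E e'))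
  | alloc (σ : Store S (Expr S)) {E} (hE : EvalCtx E) (v : Expr S) (hv : v.IsValue) (a : S.Addr)
      (ha : σ a = none) :
      Step δ (σ, .run (E (.alloc v))) (Function.update σ a (some v), .run (E (.const (.addr a))))
  | deref (σ : Store S (Expr S)) {E} (hE : EvalCtx E) (a : S.Addr) (v : Expr S)
      (ha : σ a = some v) :
      Step δ (σ, .run (E (.deref (.const (.addr a))))) (σ, .run (E v))
  | derefDangling (σ : Store S (Expr S)) {E} (hE : EvalCtx E) (a : S.Addr) (ha : σ a = none) :
      Step δ (σ, .run (E (.deref (.const (.addr a))))) (σ, .run (E (raise .badDeref)))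
  | assign (σ : Store S (Expr S)) {E} (hE : EvalCtx E) (a : S.Addr) (v : Expr S)
      (hv : v.IsValue) :
      Step δ (σ, .run (E (.assign (.const (.addr a)) v)))
        (Function.update σ a (some v), .run (E v))
  | uncaught (σ : Store S (Expr S)) {F} (hF : LabelCtx F) (v : Expr S) (hv : v.IsValue) :
      Step δ (σ, .run (F (.throw v))) (σ, .err v)
  | throwCatch (σ : Store S (Expr S)) {E F} (hE : EvalCtx E) (hF : LabelCtx F) (v : Expr S)
      (hv : v.IsValue) (x : S.Var) (e : Expr S) :
      Step δ (σ, .run (E (.tryc (F (.throw v)) x e)))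
        (σ, .run (E (e.subst (assoc [(x, v)]))))
  | throwFinally (σ : Store S (Expr S)) {E F} (hE : EvalCtx E) (hF : LabelCtx F) (v : Expr S)
      (hv : v.IsValue) (e : Expr S) :
      Step δ (σ, .run (E (.tryf (F (.throw v)) e))) (σ, .run (E (.seq e (.throw v))))
  | breakFinally (σ : Store S (Expr S)) {E G} (hE : EvalCtx E) (hG : HandlerCtx G) (l : S.Label)
      (v : Expr S) (hv : v.IsValue) (e : Expr S) :
      Step δ (σ, .run (E (.tryf (G (.brk l v)) e))) (σ, .run (E (.seq e (.brk l v))))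
  | breakLabel (σ : Store S (Expr S)) {E G} (hE : EvalCtx E) (hG : HandlerCtx G) (l : S.Label)
      (v : Expr S) (hv : v.IsValue) :
      Step δ (σ, .run (E (.label l (G (.brk l v))))) (σ, .run (E v))
  | breakOther (σ : Store S (Expr S)) {E G} (hE : EvalCtx E) (hG : HandlerCtx G)
      (l l' : S.Label) (hl : l' ≠ l) (v : Expr S) (hv : v.IsValue) :
      Step δ (σ, .run (E (.label l' (G (.brk l v))))) (σ, .run (E (.brk l v)))
  | breakUnbound (σ : Store S (Expr S)) {G} (hG : HandlerCtx G) (l : S.Label) (v : Expr S)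
      (hv : v.IsValue) :
      Step δ (σ, .run (G (.brk l v))) (σ, .run (raise .unboundLabel))

end JS

/-! ## The calculus of explicit substitutions `λρ_JS` -/

namespace Rho

/-- Local evaluation contexts `C`. -/
inductive LocalCtx : (Clo S → Clo S) → Prop
  | hole : LocalCtx (fun t => t)
  | letin {C} (x : S.Var) (b : Clo S) : LocalCtx C → LocalCtx (fun t => .letin x (C t) b)
  | appFun {C} (as : List (Clo S)) : LocalCtx C → LocalCtx (fun t => .app (C t) as)
  | appArg {C} (f : Clo S) (vs cs : List (Clo S)) (hf : f.IsValue) (hvs : ∀ v ∈ vs, v.IsValue) :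
      LocalCtx C → LocalCtx (fun t => .app f (vs ++ C t :: cs))
  | record {C} (fs : List (S.Str × Clo S)) (s : S.Str) (gs : List (S.Str × Clo S))
      (hfs : ∀ p ∈ fs, p.2.IsValue) :
      LocalCtx C → LocalCtx (fun t => .record (fs ++ (s, C t) :: gs))
  | prim {C} (op : S.Op) (vs cs : List (Clo S)) (hvs : ∀ v ∈ vs, v.IsValue) :
      LocalCtx C → LocalCtx (fun t => .prim op (vs ++ C t :: cs))
  | getObj {C} (k : Clo S) : LocalCtx C → LocalCtx (fun t => .get (C t) k)
  | getKey {C} (o : Clo S) (ho : o.IsValue) : LocalCtx C → LocalCtx (fun t => .get o (C t))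
  | putObj {C} (k c : Clo S) : LocalCtx C → LocalCtx (fun t => .put (C t) k c)
  | putKey {C} (o c : Clo S) (ho : o.IsValue) : LocalCtx C → LocalCtx (fun t => .put o (C t) c)
  | putVal {C} (o k : Clo S) (ho : o.IsValue) (hk : k.IsValue) :
      LocalCtx C → LocalCtx (fun t => .put o k (C t))
  | delObj {C} (k : Clo S) : LocalCtx C → LocalCtx (fun t => .del (C t) k)
  | delKey {C} (o : Clo S) (ho : o.IsValue) : LocalCtx C → LocalCtx (fun t => .del o (C t))
  | alloc {C} : LocalCtx C → LocalCtx (fun t => .alloc (C t))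
  | deref {C} : LocalCtx C → LocalCtx (fun t => .deref (C t))
  | assignLoc {C} (c : Clo S) : LocalCtx C → LocalCtx (fun t => .assign (C t) c)
  | assignVal {C} (l : Clo S) (hl : l.IsValue) : LocalCtx C → LocalCtx (fun t => .assign l (C t))
  | ite {C} (a b : Clo S) : LocalCtx C → LocalCtx (fun t => .ite (C t) a b)
  | seq {C} (c : Clo S) : LocalCtx C → LocalCtx (fun t => .seq (C t) c)
  | throw {C} : LocalCtx C → LocalCtx (fun t => .throw (C t))
  | brk {C} (l : S.Label) : LocalCtx C → LocalCtx (fun t => .brk l (C t))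

/-- Control contexts `D`. -/
inductive ControlCtx : (Clo S → Clo S) → Prop
  | hole : ControlCtx (fun t => t)
  | tryf {C D} (f : Clo S) : LocalCtx C → ControlCtx D → ControlCtx (fun t => .tryf (C (D t)) f)
  | label {C D} (l : S.Label) :
      LocalCtx C → ControlCtx D → ControlCtx (fun t => .label l (C (D t)))
  | tryc {C D} (x : S.Var) (h : Clo S) :
      LocalCtx C → ControlCtx D → ControlCtx (fun t => .tryc (C (D t)) x h)

/-- General evaluation contexts `E ::= C[D]`. -/
inductive EvalCtx : (Clo S → Clo S) → Prop
  | mk {C D} : LocalCtx C → ControlCtx D → EvalCtx (fun t => C (D t))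

/-- The exception raised by a run-time error. -/
def raise (r : RuntimeError) : Clo S := .throw (.const (S.errConst r))

/-- Context-insensitive, store-insensitive reductions, including those that raise run-time
errors; `δ` interprets the primitive operations. -/
inductive Red (δ : S.Op → List (Clo S) → Option (Clo S)) : Clo S → Clo S → Prop
  | var (x : S.Var) (ρ : Env S) (v : Clo S) (hx : ρ.lookup x = some v) : Red δ (.clos (.var x) ρ) v
  | letin (x : S.Var) (v : Clo S) (e : Expr S) (ρ : Env S) (hv : v.IsValue) :
      Red δ (.letin x v (.clos e ρ)) (.clos e ((x, v) :: ρ))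
  | app (xs : List S.Var) (e : Expr S) (ρ : Env S) (vs : List (Clo S))
      (hvs : ∀ v ∈ vs, v.IsValue) (hlen : xs.length = vs.length) :
      Red δ (.app (.clos (.func xs e) ρ) vs) (.clos e (xs.zip vs ++ ρ))
  | getHit (fs gs : List (S.Str × Clo S)) (s : S.Str) (v : Clo S)
      (hr : (Clo.record (fs ++ (s, v) :: gs)).IsValue) :
      Red δ (.get (.record (fs ++ (s, v) :: gs)) (.const (.str s))) v
  | getMiss (fs : List (S.Str × Clo S)) (s : S.Str) (hr : (Clo.record fs).IsValue)
      (hs : s ∉ fs.map Prod.fst) :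
      Red δ (.get (.record fs) (.const (.str s))) (.const .undef)
  | putHit (fs gs : List (S.Str × Clo S)) (s : S.Str) (u v : Clo S)
      (hr : (Clo.record (fs ++ (s, u) :: gs)).IsValue) (hv : v.IsValue) :
      Red δ (.put (.record (fs ++ (s, u) :: gs)) (.const (.str s)) v)
        (.record (fs ++ (s, v) :: gs))
  | putMiss (fs : List (S.Str × Clo S)) (s : S.Str) (v : Clo S)
      (hr : (Clo.record fs).IsValue) (hv : v.IsValue) (hs : s ∉ fs.map Prod.fst) :
      Red δ (.put (.record fs) (.const (.str s)) v) (.record ((s, v) :: fs))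
  | delHit (fs gs : List (S.Str × Clo S)) (s : S.Str) (u : Clo S)
      (hr : (Clo.record (fs ++ (s, u) :: gs)).IsValue) :
      Red δ (.del (.record (fs ++ (s, u) :: gs)) (.const (.str s))) (.record (fs ++ gs))
  | delMiss (fs : List (S.Str × Clo S)) (s : S.Str) (hr : (Clo.record fs).IsValue)
      (hs : s ∉ fs.map Prod.fst) :
      Red δ (.del (.record fs) (.const (.str s))) (.record fs)
  | iteTrue (a b : Clo S) : Red δ (.ite (.const (.bool true)) a b) a
  | iteFalse (a b : Clo S) : Red δ (.ite (.const (.bool false)) a b) b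
  | seq (v c : Clo S) (hv : v.IsValue) : Red δ (.seq v c) c
  | whl (a b : Clo S) : Red δ (.whl a b) (.ite a (.seq b (.whl a b)) (.const .undef))
  | tryc (v : Clo S) (x : S.Var) (h : Clo S) (hv : v.IsValue) : Red δ (.tryc v x h) v
  | tryf (v c : Clo S) (hv : v.IsValue) : Red δ (.tryf v c) (.seq c v)
  | label (l : S.Label) (v : Clo S) (hv : v.IsValue) : Red δ (.label l v) v
  | prim (op : S.Op) (vs : List (Clo S)) (v : Clo S) (hvs : ∀ v ∈ vs, v.IsValue)
      (hδ : δ op vs = some v) : Red δ (.prim op vs) v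
  -- run-time errors
  | badCall (f : Clo S) (vs : List (Clo S)) (hf : f.IsValue) (hvs : ∀ v ∈ vs, v.IsValue)
      (hbad : ¬ ∃ xs e ρ, f = .clos (.func xs e) ρ ∧ xs.length = vs.length) :
      Red δ (.app f vs) (raise .badCall)
  | badIndex (o k : Clo S) (ho : o.IsValue) (hk : k.IsValue)
      (hbad : ¬ ∃ fs s, o = .record fs ∧ k = .const (.str s)) :
      Red δ (.get o k) (raise .badIndex)
  | badUpdate (o k v : Clo S) (ho : o.IsValue) (hk : k.IsValue) (hv : v.IsValue)
      (hbad : ¬ ∃ fs s, o = .record fs ∧ k = .const (.str s)) :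
      Red δ (.put o k v) (raise .badUpdate)
  | badDelete (o k : Clo S) (ho : o.IsValue) (hk : k.IsValue)
      (hbad : ¬ ∃ fs s, o = .record fs ∧ k = .const (.str s)) :
      Red δ (.del o k) (raise .badDelete)
  | badCondition (v a b : Clo S) (hv : v.IsValue) (hbad : ¬ ∃ t, v = .const (.bool t)) :
      Red δ (.ite v a b) (raise .badCondition)
  | badDeref (v : Clo S) (hv : v.IsValue) (hbad : ¬ ∃ a, v = .const (.addr a)) :
      Red δ (.deref v) (raise .badDeref)
  | badAssign (u v : Clo S) (hu : u.IsValue) (hv : v.IsValue)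
      (hbad : ¬ ∃ a, u = .const (.addr a)) :
      Red δ (.assign u v) (raise .badAssign)
  | badPrim (op : S.Op) (vs : List (Clo S)) (hvs : ∀ v ∈ vs, v.IsValue) (hδ : δ op vs = none) :
      Red δ (.prim op vs) (raise .badPrim)

/-- Reductions that propagate an environment from a closure to the inner expressions. A closed
function `(func xs e, ρ)` is a value and a variable is looked up, so neither is propagated. -/
inductive Propagate : Clo S → Clo S → Prop
  | const (k : S.Const) (ρ : Env S) : Propagate (.clos (.const k) ρ) (.const k)
  | record (fs : List (S.Str × Expr S)) (ρ : Env S) :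
      Propagate (.clos (.record fs) ρ) (.record (fs.map fun p => (p.1, .clos p.2 ρ)))
  | letin (x : S.Var) (e b : Expr S) (ρ : Env S) :
      Propagate (.clos (.letin x e b) ρ) (.letin x (.clos e ρ) (.clos b ρ))
  | app (f : Expr S) (as : List (Expr S)) (ρ : Env S) :
      Propagate (.clos (.app f as) ρ) (.app (.clos f ρ) (as.map fun e => .clos e ρ))
  | get (o k : Expr S) (ρ : Env S) :
      Propagate (.clos (.get o k) ρ) (.get (.clos o ρ) (.clos k ρ))
  | put (o k e : Expr S) (ρ : Env S) :
      Propagate (.clos (.put o k e) ρ) (.put (.clos o ρ) (.clos k ρ) (.clos e ρ))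
  | del (o k : Expr S) (ρ : Env S) :
      Propagate (.clos (.del o k) ρ) (.del (.clos o ρ) (.clos k ρ))
  | assign (l e : Expr S) (ρ : Env S) :
      Propagate (.clos (.assign l e) ρ) (.assign (.clos l ρ) (.clos e ρ))
  | alloc (e : Expr S) (ρ : Env S) : Propagate (.clos (.alloc e) ρ) (.alloc (.clos e ρ))
  | deref (e : Expr S) (ρ : Env S) : Propagate (.clos (.deref e) ρ) (.deref (.clos e ρ))
  | ite (c t f : Expr S) (ρ : Env S) :
      Propagate (.clos (.ite c t f) ρ) (.ite (.clos c ρ) (.clos t ρ) (.clos f ρ))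
  | seq (a b : Expr S) (ρ : Env S) : Propagate (.clos (.seq a b) ρ) (.seq (.clos a ρ) (.clos b ρ))
  | whl (a b : Expr S) (ρ : Env S) : Propagate (.clos (.whl a b) ρ) (.whl (.clos a ρ) (.clos b ρ))
  | label (l : S.Label) (e : Expr S) (ρ : Env S) :
      Propagate (.clos (.label l e) ρ) (.label l (.clos e ρ))
  | brk (l : S.Label) (e : Expr S) (ρ : Env S) :
      Propagate (.clos (.brk l e) ρ) (.brk l (.clos e ρ))
  | tryc (e : Expr S) (x : S.Var) (h : Expr S) (ρ : Env S) :
      Propagate (.clos (.tryc e x h) ρ) (.tryc (.clos e ρ) x (.clos h ρ))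
  | tryf (e f : Expr S) (ρ : Env S) :
      Propagate (.clos (.tryf e f) ρ) (.tryf (.clos e ρ) (.clos f ρ))
  | throw (e : Expr S) (ρ : Env S) : Propagate (.clos (.throw e) ρ) (.throw (.clos e ρ))
  | prim (op : S.Op) (as : List (Expr S)) (ρ : Env S) :
      Propagate (.clos (.prim op as) ρ) (.prim op (as.map fun e => .clos e ρ))

/-- One-step reduction of `λρ_JS`. -/
inductive Step (δ : S.Op → List (Clo S) → Option (Clo S)) :
    State S (Clo S) → State S (Clo S) → Prop
  | ctx (σ : Store S (Clo S)) {E} (hE : EvalCtx E) {c c' : Clo S} (h : Red δ c c') :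
      Step δ (σ, .run (E c)) (σ, .run (E c'))
  | propagate (σ : Store S (Clo S)) {E} (hE : EvalCtx E) {c c' : Clo S} (h : Propagate c c') :
      Step δ (σ, .run (E c)) (σ, .run (E c'))
  | alloc (σ : Store S (Clo S)) {E} (hE : EvalCtx E) (v : Clo S) (hv : v.IsValue) (a : S.Addr)
      (ha : σ a = none) :
      Step δ (σ, .run (E (.alloc v))) (Function.update σ a (some v), .run (E (.const (.addr a))))
  | deref (σ : Store S (Clo S)) {E} (hE : EvalCtx E) (a : S.Addr) (v : Clo S)
      (ha : σ a = some v) :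
      Step δ (σ, .run (E (.deref (.const (.addr a))))) (σ, .run (E v))
  | derefDangling (σ : Store S (Clo S)) {E} (hE : EvalCtx E) (a : S.Addr) (ha : σ a = none) :
      Step δ (σ, .run (E (.deref (.const (.addr a))))) (σ, .run (E (raise .badDeref)))
  | assign (σ : Store S (Clo S)) {E} (hE : EvalCtx E) (a : S.Addr) (v : Clo S)
      (hv : v.IsValue) :
      Step δ (σ, .run (E (.assign (.const (.addr a)) v)))
        (Function.update σ a (some v), .run (E v))
  | uncaught (σ : Store S (Clo S)) {C} (hC : LocalCtx C) (v : Clo S) (hv : v.IsValue) :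
      Step δ (σ, .run (C (.throw v))) (σ, .err v)
  | throwCatch (σ : Store S (Clo S)) {E C} (hE : EvalCtx E) (hC : LocalCtx C) (v : Clo S)
      (hv : v.IsValue) (x : S.Var) (e : Expr S) (ρ : Env S) :
      Step δ (σ, .run (E (.tryc (C (.throw v)) x (.clos e ρ))))
        (σ, .run (E (.clos e ((x, v) :: ρ))))
  | throwFinally (σ : Store S (Clo S)) {E C} (hE : EvalCtx E) (hC : LocalCtx C) (v : Clo S)
      (hv : v.IsValue) (c : Clo S) :
      Step δ (σ, .run (E (.tryf (C (.throw v)) c))) (σ, .run (E (.seq c (.throw v))))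
  | throwLabel (σ : Store S (Clo S)) {E C} (hE : EvalCtx E) (hC : LocalCtx C) (v : Clo S)
      (hv : v.IsValue) (l : S.Label) :
      Step δ (σ, .run (E (.label l (C (.throw v))))) (σ, .run (E (.throw v)))
  | breakCatch (σ : Store S (Clo S)) {E C} (hE : EvalCtx E) (hC : LocalCtx C) (l : S.Label)
      (v : Clo S) (hv : v.IsValue) (x : S.Var) (c : Clo S) :
      Step δ (σ, .run (E (.tryc (C (.brk l v)) x c))) (σ, .run (E (.brk l v)))
  | breakFinally (σ : Store S (Clo S)) {E C} (hE : EvalCtx E) (hC : LocalCtx C) (l : S.Label)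
      (v : Clo S) (hv : v.IsValue) (c : Clo S) :
      Step δ (σ, .run (E (.tryf (C (.brk l v)) c))) (σ, .run (E (.seq c (.brk l v))))
  | breakLabel (σ : Store S (Clo S)) {E C} (hE : EvalCtx E) (hC : LocalCtx C) (l : S.Label)
      (v : Clo S) (hv : v.IsValue) :
      Step δ (σ, .run (E (.label l (C (.brk l v))))) (σ, .run (E v))
  | breakOther (σ : Store S (Clo S)) {E C} (hE : EvalCtx E) (hC : LocalCtx C)
      (l l' : S.Label) (hl : l' ≠ l) (v : Clo S) (hv : v.IsValue) :
      Step δ (σ, .run (E (.label l' (C (.brk l v))))) (σ, .run (E (.brk l v)))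
  | breakUnbound (σ : Store S (Clo S)) {C} (hC : LocalCtx C) (l : S.Label) (v : Clo S)
      (hv : v.IsValue) :
      Step δ (σ, .run (C (.brk l v))) (σ, .run (raise .unboundLabel))

/-- The initial state `⟨∅, (e, ∅)⟩`. -/
def inj (e : Expr S) : State S (Clo S) := (emptyStore, .run (.clos e []))

end Rho

/-! ## Forcing delayed substitutions -/

mutual
/-- The map `U` on values: it carries out the substitutions delayed in environments. It is only
meant for values; closures that are neither constants, nor pairs `(e, ρ)`, nor records are sent to
a dummy. -/
def Clo.force : Clo S → Expr S
  | .const k => .const k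
  | .clos e ρ => e.subst (assoc (Clo.forceEnv ρ))
  | .record fs => .record (Clo.forceFields fs)
  | _ => .const .undef
def Clo.forceEnv : List (S.Var × Clo S) → List (S.Var × Expr S)
  | [] => []
  | (x, c) :: ρ => (x, c.force) :: Clo.forceEnv ρ
def Clo.forceFields : List (S.Str × Clo S) → List (S.Str × Expr S)
  | [] => []
  | (s, c) :: fs => (s, c.force) :: Clo.forceFields fs
end

/-- The map `U` on answers: it forces the result and all values in the store. -/
def forceState (A : State S (Clo S)) : State S (Expr S) :=
  (fun a => (A.1 a).map Clo.force,
    match A.2 with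
    | .run c => .run c.force
    | .err c => .err c.force)

end LambdaJS

-- Let `Clo.unload` carry out every substitution that is delayed in a closure. It extends
-- `Clo.force` from values to all closures, and the theorem compares a state of `λρ_JS` with the
-- state of `λ_JS` obtained by unloading it. The comparison is made on closed states only. There
-- every environment holds closed values, so a forced environment is a substitution by closed terms,
-- no capture can occur, and two successive substitutions compose (`Expr.subst_subst`). Consequently
-- extending an environment has the same effect as substituting (`Clo.unloadUnder_subst`,
-- `Clo.unload_func_subst`). Closedness is preserved by reduction (`Rho.Step.closed`).
--
-- The calculi differ in two ways. `λρ_JS` has administrative steps, namely propagation of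
-- environments and lookup of variables, which do not change the unloaded state. And where `λ_JS`
-- lets a `throw` jump across all labels, or a `break` across all handlers, in one step, `λρ_JS`
-- removes them one by one, through states to which nothing in `λ_JS` need correspond.
--
-- From `λ_JS` to `λρ_JS` the simulation is step by step (`Rho.exists_reaches_of_step`). If a closed
-- closure denotes a redex in a context, administrative reductions expose the context frame by
-- frame, evaluating the operands to the left of the hole on the way (`Rho.exists_admin_plugAll`),
-- and then expose the redex (`Rho.exists_red_of_unload`). A `throw` first leaves the labels around
-- it and a `break` the handlers around it (`Rho.reaches_throw_local`, `Rho.reaches_break_local`).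
--
-- In the other direction a step-by-step simulation fails: when a `throw` leaves a label, `λ_JS` has
-- no step to offer. The argument runs backwards from the answer: if a step leads from `s` to `s'`
-- and the unloading of `s'` reaches the answer, so does that of `s` (`Rho.Step.reaches_answer`). If
-- the step dropped a label, the unloading of `s'` is a `throw` in a context. It is no answer, hence
-- makes a first step, and by unique decomposition (`JS.decomposition_unique`) this step consumes
-- that very `throw`. The contexts `F` in the rules for exceptions may just as well contain the
-- dropped frames, so the unloading of `s` makes the same step (`JS.Step.insert_throw`). Breaks and
-- handlers are treated alike with contexts `G`.

namespace LambdaJS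

variable {S : Domains}

/-! ## Expressions and substitution -/

/-- Structural induction on expressions, with membership hypotheses for lists. -/
@[elab_as_elim]
theorem Expr.inductionOn {P : Expr S → Prop} (e : Expr S)
    (var : ∀ x, P (.var x)) (const : ∀ k, P (.const k))
    (func : ∀ xs b, P b → P (.func xs b))
    (record : ∀ fs : List (S.Str × Expr S), (∀ p ∈ fs, P p.2) → P (.record fs))
    (letin : ∀ x a b, P a → P b → P (.letin x a b))
    (app : ∀ f as, P f → (∀ a ∈ as, P a) → P (.app f as))
    (get : ∀ o k, P o → P k → P (.get o k))
    (put : ∀ o k a, P o → P k → P a → P (.put o k a))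
    (del : ∀ o k, P o → P k → P (.del o k))
    (assign : ∀ l a, P l → P a → P (.assign l a))
    (alloc : ∀ a, P a → P (.alloc a)) (deref : ∀ a, P a → P (.deref a))
    (ite : ∀ c t f, P c → P t → P f → P (.ite c t f))
    (seq : ∀ a b, P a → P b → P (.seq a b)) (whl : ∀ a b, P a → P b → P (.whl a b))
    (label : ∀ l a, P a → P (.label l a)) (brk : ∀ l a, P a → P (.brk l a))
    (tryc : ∀ a x h, P a → P h → P (.tryc a x h)) (tryf : ∀ a f, P a → P f → P (.tryf a f))
    (throw : ∀ a, P a → P (.throw a))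
    (prim : ∀ op as, (∀ a ∈ as, P a) → P (.prim op as)) : P e :=
  Expr.rec (motive_1 := P) (motive_2 := fun fs => ∀ p ∈ fs, P p.2)
    (motive_3 := fun as => ∀ a ∈ as, P a) (motive_4 := fun p => P p.2)
    var const func record letin app get put del assign alloc deref ite seq whl label brk tryc
    tryf throw prim (by simp) (by simp +contextual) (by simp) (by simp +contextual)
    (fun _ _ h => h) e

theorem Expr.substList_eq_map (θ : S.Var → Option (Expr S)) (es : List (Expr S)) :
    Expr.substList θ es = es.map (Expr.subst θ) := by
  induction es <;> simp_all [Expr.substList]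

theorem Expr.substFields_eq_map (θ : S.Var → Option (Expr S)) (fs : List (S.Str × Expr S)) :
    Expr.substFields θ fs = fs.map fun p => (p.1, p.2.subst θ) := by
  induction fs <;> simp_all [Expr.substFields]

theorem Expr.mem_fvList {es : List (Expr S)} {x : S.Var} :
    x ∈ Expr.fvList es ↔ ∃ e ∈ es, x ∈ e.fv := by
  induction es <;> simp_all [Expr.fvList]

theorem Expr.mem_fvFields {fs : List (S.Str × Expr S)} {x : S.Var} :
    x ∈ Expr.fvFields fs ↔ ∃ p ∈ fs, x ∈ p.2.fv := by
  induction fs with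
  | nil => simp [Expr.fvFields]
  | cons p fs ih => obtain ⟨s, e⟩ := p; simp [Expr.fvFields, ih]

/-- A substitution that is undefined on the free variables does nothing. -/
theorem Expr.subst_eq_self (e : Expr S) : ∀ θ : S.Var → Option (Expr S),
    (∀ x ∈ e.fv, θ x = none) → e.subst θ = e := by
  induction e using Expr.inductionOn with
  | record fs ih =>
    intro θ h
    simp only [Expr.subst, Expr.substFields_eq_map, Expr.fv, Expr.mem_fvFields] at h ⊢
    congr 1
    conv_rhs => rw [← List.map_id fs]
    refine List.map_congr_left fun p hp => ?_
    rw [ih p hp θ fun x hx => h x ⟨p, hp, hx⟩]; rfl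
  | app f as ihf ih =>
    intro θ h
    simp only [Expr.subst, Expr.substList_eq_map, Expr.fv, Set.mem_union, Expr.mem_fvList] at h ⊢
    rw [ihf θ fun x hx => h x (.inl hx)]
    congr 1
    conv_rhs => rw [← List.map_id as]
    exact List.map_congr_left fun a ha => ih a ha θ fun x hx => h x (.inr ⟨a, ha, hx⟩)
  | prim op as ih =>
    intro θ h
    simp only [Expr.subst, Expr.substList_eq_map, Expr.fv, Expr.mem_fvList] at h ⊢
    congr 1
    conv_rhs => rw [← List.map_id as]
    exact List.map_congr_left fun a ha => ih a ha θ fun x hx => h x ⟨a, ha, hx⟩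
  | var x => intro θ h; simp [Expr.subst, h x (by simp [Expr.fv])]
  | const k => intros; rfl
  | func xs b ih =>
    intro θ h
    simp only [Expr.subst, Expr.fv] at h ⊢
    rw [ih]
    intro x hx
    by_cases hm : x ∈ xs <;> simp_all [hide]
  | letin x a b iha ihb =>
    intro θ h
    simp only [Expr.subst, Expr.fv] at h ⊢
    rw [iha θ fun y hy => h y (.inl hy), ihb]
    intro y hy
    by_cases hm : y = x <;> simp_all [hide]
  | tryc a x b iha ihb =>
    intro θ h
    simp only [Expr.subst, Expr.fv] at h ⊢
    rw [iha θ fun y hy => h y (.inl hy), ihb]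
    intro y hy
    by_cases hm : y = x <;> simp_all [hide]
  | _ => intro θ h; simp_all [Expr.subst, Expr.fv]

theorem Expr.Closed.subst_eq {e : Expr S} (he : e.Closed) (θ : S.Var → Option (Expr S)) :
    e.subst θ = e :=
  e.subst_eq_self θ fun x hx => by rw [he] at hx; exact hx.elim

/-- All expressions in the range of a substitution are closed. -/
def ClosedSubst (θ : S.Var → Option (Expr S)) : Prop := ∀ x t, θ x = some t → t.Closed

theorem ClosedSubst.hide {θ : S.Var → Option (Expr S)} (hθ : ClosedSubst θ) (xs : List S.Var) :
    ClosedSubst (hide θ xs) := by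
  intro x t h
  simp only [LambdaJS.hide] at h
  split at h
  · cases h
  · exact hθ x t h

/-- Needed to take a composition of substitutions under a binder: both factors lose the same
variables. -/
theorem hide_or (θ η : S.Var → Option (Expr S)) (xs : List S.Var) :
    hide (fun y => (θ y).or (η y)) xs = fun y => (hide θ xs y).or (hide η xs y) := by
  funext y; simp only [hide]; split <;> simp

/-- Composition of substitutions, the first of which is closed. -/
theorem Expr.subst_subst (e : Expr S) : ∀ θ η : S.Var → Option (Expr S), ClosedSubst θ →
    (e.subst θ).subst η = e.subst fun y => (θ y).or (η y) := by
  induction e using Expr.inductionOn with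
  | var x =>
    intro θ η hθ
    cases h : θ x with
    | none => simp [Expr.subst, h]
    -- The inserted term `t` is closed, so `η` leaves it alone.
    | some t => simp [Expr.subst, h, (hθ x t h).subst_eq]
  | const k => intros; rfl
  | func xs b ih => intro θ η hθ; simp [Expr.subst, ih _ _ (hθ.hide xs), hide_or]
  | letin x a b iha ihb =>
    intro θ η hθ; simp [Expr.subst, iha _ _ hθ, ihb _ _ (hθ.hide [x]), hide_or]
  | tryc a x b iha ihb =>
    intro θ η hθ; simp [Expr.subst, iha _ _ hθ, ihb _ _ (hθ.hide [x]), hide_or]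
  | record fs ih =>
    intro θ η hθ
    simp only [Expr.subst, Expr.substFields_eq_map, List.map_map]
    congr 1
    exact List.map_congr_left fun p hp => by simp [ih p hp θ η hθ]
  | app f as ihf ih =>
    intro θ η hθ
    simp only [Expr.subst, Expr.substList_eq_map, List.map_map, ihf θ η hθ]
    congr 1
    exact List.map_congr_left fun p hp => by simp [ih p hp θ η hθ]
  | prim op as ih =>
    intro θ η hθ
    simp only [Expr.subst, Expr.substList_eq_map, List.map_map]
    congr 1
    exact List.map_congr_left fun p hp => by simp [ih p hp θ η hθ]
  | _ => intro θ η hθ; simp_all [Expr.subst]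

/-- Closed terms bring in no free variables, so a variable that is free afterwards was already there
and was not replaced. This is what makes forced values closed. -/
theorem Expr.fv_subst (e : Expr S) : ∀ θ : S.Var → Option (Expr S), ClosedSubst θ →
    ∀ x ∈ (e.subst θ).fv, x ∈ e.fv ∧ θ x = none := by
  have key : ∀ (θ : S.Var → Option (Expr S)) (xs : List S.Var) (x : S.Var),
      hide θ xs x = none → x ∉ xs → θ x = none := by
    intro θ xs x h hx; simpa [hide, hx] using h
  induction e using Expr.inductionOn with
  | var x =>
    intro θ hθ y hy
    cases h : θ x with
    | none =>
      have : y = x := by simpa [Expr.subst, h, Expr.fv] using hy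
      subst this; simp [Expr.fv, h]
    | some t =>
      have : y ∈ t.fv := by simpa [Expr.subst, h] using hy
      rw [hθ x t h] at this; exact this.elim
  | const k => intro θ hθ y hy; exact hy.elim
  | func xs b ih =>
    rintro θ hθ y ⟨hy, hn⟩
    obtain ⟨h1, h2⟩ := ih _ (hθ.hide xs) y hy
    exact ⟨⟨h1, hn⟩, key _ _ _ h2 hn⟩
  | letin x a b iha ihb =>
    rintro θ hθ y (hy | ⟨hy, hn⟩)
    · exact ⟨.inl (iha θ hθ y hy).1, (iha θ hθ y hy).2⟩
    · obtain ⟨h1, h2⟩ := ihb _ (hθ.hide [x]) y hy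
      exact ⟨.inr ⟨h1, hn⟩, key _ _ _ h2 (by simpa using hn)⟩
  | tryc a x b iha ihb =>
    rintro θ hθ y (hy | ⟨hy, hn⟩)
    · exact ⟨.inl (iha θ hθ y hy).1, (iha θ hθ y hy).2⟩
    · obtain ⟨h1, h2⟩ := ihb _ (hθ.hide [x]) y hy
      exact ⟨.inr ⟨h1, hn⟩, key _ _ _ h2 (by simpa using hn)⟩
  | record fs ih =>
    intro θ hθ y hy
    simp only [Expr.subst, Expr.substFields_eq_map, Expr.fv, Expr.mem_fvFields,
      List.mem_map] at hy ⊢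
    obtain ⟨_, ⟨p, hp, rfl⟩, hy⟩ := hy
    exact ⟨⟨p, hp, (ih p hp θ hθ y hy).1⟩, (ih p hp θ hθ y hy).2⟩
  | app f as ihf ih =>
    intro θ hθ y hy
    simp only [Expr.subst, Expr.substList_eq_map, Expr.fv, Set.mem_union, Expr.mem_fvList,
      List.mem_map] at hy ⊢
    obtain hy | ⟨_, ⟨p, hp, rfl⟩, hy⟩ := hy
    · exact ⟨.inl (ihf θ hθ y hy).1, (ihf θ hθ y hy).2⟩
    · exact ⟨.inr ⟨p, hp, (ih p hp θ hθ y hy).1⟩, (ih p hp θ hθ y hy).2⟩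
  | prim op as ih =>
    intro θ hθ y hy
    simp only [Expr.subst, Expr.substList_eq_map, Expr.fv, Expr.mem_fvList,
      List.mem_map] at hy ⊢
    obtain ⟨_, ⟨p, hp, rfl⟩, hy⟩ := hy
    exact ⟨⟨p, hp, (ih p hp θ hθ y hy).1⟩, (ih p hp θ hθ y hy).2⟩
  | _ => intro θ hθ y hy; simp only [Expr.subst, Expr.fv, Set.mem_union] at *; grind

/-- The right-hand side is lookup in an environment with `x` put in front; the left-hand side is
what remains after substituting under the binder and then for the bound variable. -/
theorem assoc_cons_eq (θ : S.Var → Option (Expr S)) (x : S.Var) (v : Expr S) :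
    (fun y => (hide θ [x] y).or (assoc [(x, v)] y)) = fun y => if y = x then some v else θ y := by
  funext y
  by_cases h : y = x
  · simp [hide, assoc, h]
  · have : (y == x) = false := by simpa using h
    simp [hide, assoc, h, List.lookup, this]

theorem lookup_append {α β : Type*} [BEq α] (l m : List (α × β)) (a : α) :
    (l ++ m).lookup a = (l.lookup a).or (m.lookup a) := by
  induction l with
  | nil => simp
  | cons p l ih =>
    obtain ⟨b, c⟩ := p
    simp only [List.cons_append, List.lookup]
    split <;> simp [ih]

theorem exists_of_lookup_eq_some {α β : Type*} [BEq α] [LawfulBEq α] {l : List (α × β)} {a : α}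
    {b : β} (h : l.lookup a = some b) : (a, b) ∈ l := by
  induction l with
  | nil => simp at h
  | cons p l ih =>
    obtain ⟨c, d⟩ := p
    simp only [List.lookup] at h
    split at h
    · simp_all
    · exact List.mem_cons_of_mem _ (ih h)

theorem lookup_ne_none {α β : Type*} [BEq α] [LawfulBEq α] {l : List (α × β)} {p : α × β}
    (h : p ∈ l) : l.lookup p.1 ≠ none := by
  induction l with
  | nil => simp at h
  | cons q l ih =>
    obtain ⟨c, d⟩ := q
    simp only [List.lookup]
    split
    · simp
    · rename_i hne
      rcases List.mem_cons.1 h with rfl | h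
      · simp at hne
      · exact ih h

/-- Equal lengths guarantee that every hidden variable receives a value from the zip, so nothing
hidden in `θ` is ever missed. Parameters may repeat: both sides take the first entry. -/
theorem assoc_zip_eq (θ : S.Var → Option (Expr S)) (xs : List S.Var) (vs : List (Expr S))
    (hlen : xs.length = vs.length) :
    (fun y => (hide θ xs y).or (assoc (xs.zip vs) y)) =
      fun y => ((xs.zip vs).lookup y).or (θ y) := by
  funext y
  by_cases h : y ∈ xs
  · obtain ⟨i, hi, rfl⟩ := List.getElem_of_mem h
    -- Some entry for `y` exists; which one the lookup returns is irrelevant.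
    have hm : (xs[i], vs[i]'(hlen ▸ hi)) ∈ xs.zip vs := by
      rw [← List.getElem_zip (h := by simp [hlen] at hi ⊢; omega)]
      exact List.getElem_mem _
    obtain ⟨b, hb⟩ := Option.ne_none_iff_exists'.1 (lookup_ne_none hm)
    simp only at hb
    simp [hide, assoc, hb]
  · have hn : (xs.zip vs).lookup y = none := by
      cases hl : (xs.zip vs).lookup y with
      | none => rfl
      | some b => exact (h (List.of_mem_zip (exists_of_lookup_eq_some hl)).1).elim
    simp [hide, assoc, h, hn]

/-! ## Evaluation contexts as lists of frames -/

/-- Evaluation contexts of depth one over terms of type `T`. -/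
inductive Frame (S : Domains) (T : Type) : Type
  | letin (x : S.Var) (b : T)
  | appFun (as : List T)
  | appArg (f : T) (vs ts : List T)
  | record (fs : List (S.Str × T)) (s : S.Str) (gs : List (S.Str × T))
  | prim (op : S.Op) (vs ts : List T)
  | getObj (k : T)
  | getKey (o : T)
  | putObj (k t : T)
  | putKey (o t : T)
  | putVal (o k : T)
  | delObj (k : T)
  | delKey (o : T)
  | alloc
  | deref
  | assignLoc (t : T)
  | assignVal (l : T)
  | ite (a b : T)
  | seq (t : T)
  | throw
  | brk (l : S.Label)
  | tryf (f : T)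
  | label (l : S.Label)
  | tryc (x : S.Var) (h : T)

namespace Frame

variable {T : Type}

/-- The terms to the left of the hole are values. -/
def Valid (V : T → Prop) : Frame S T → Prop
  | appArg f vs _ => V f ∧ ∀ v ∈ vs, V v
  | record fs _ _ => ∀ p ∈ fs, V p.2
  | prim _ vs _ => ∀ v ∈ vs, V v
  | getKey o => V o
  | putKey o _ => V o
  | putVal o k => V o ∧ V k
  | delKey o => V o
  | assignVal l => V l
  | _ => True

/-- Frames of local contexts. -/
def IsLocal : Frame S T → Prop
  | tryf _ => False
  | label _ => False
  | tryc _ _ => False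
  | _ => True

/-- Frames through which exceptions propagate. -/
def PassesThrow : Frame S T → Prop
  | tryf _ => False
  | tryc _ _ => False
  | _ => True

/-- Frames through which breaks propagate. -/
def PassesBreak : Frame S T → Prop
  | tryf _ => False
  | label _ => False
  | _ => True

theorem IsLocal.passesThrow {f : Frame S T} (h : f.IsLocal) : f.PassesThrow := by
  cases f <;> trivial

theorem IsLocal.passesBreak {f : Frame S T} (h : f.IsLocal) : f.PassesBreak := by
  cases f <;> trivial

end Frame

namespace JS

/-- Filling the hole of a frame. -/
def plug : Frame S (Expr S) → Expr S → Expr S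
  | .letin x b, t => .letin x t b
  | .appFun as, t => .app t as
  | .appArg f vs ts, t => .app f (vs ++ t :: ts)
  | .record fs s gs, t => .record (fs ++ (s, t) :: gs)
  | .prim op vs ts, t => .prim op (vs ++ t :: ts)
  | .getObj k, t => .get t k
  | .getKey o, t => .get o t
  | .putObj k e, t => .put t k e
  | .putKey o e, t => .put o t e
  | .putVal o k, t => .put o k t
  | .delObj k, t => .del t k
  | .delKey o, t => .del o t
  | .alloc, t => .alloc t
  | .deref, t => .deref t
  | .assignLoc e, t => .assign t e
  | .assignVal l, t => .assign l t
  | .ite a b, t => .ite t a b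
  | .seq e, t => .seq t e
  | .throw, t => .throw t
  | .brk l, t => .brk l t
  | .tryf f, t => .tryf t f
  | .label l, t => .label l t
  | .tryc x h, t => .tryc t x h

/-- Filling the hole of a context, given as a list of frames from the outside in. -/
def plugAll (L : List (Frame S (Expr S))) (t : Expr S) : Expr S := L.foldr plug t

@[simp] theorem plugAll_nil (t : Expr S) : plugAll [] t = t := rfl

@[simp] theorem plugAll_cons (f : Frame S (Expr S)) (L : List (Frame S (Expr S))) (t : Expr S) :
    plugAll (f :: L) t = plug f (plugAll L t) := rfl

@[simp] theorem plugAll_append (L M : List (Frame S (Expr S))) (t : Expr S) :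
    plugAll (L ++ M) t = plugAll L (plugAll M t) := by simp [plugAll]

/-- The induction step common to all context formers, for whichever property `P` of frames is to be
recorded. -/
theorem exists_frames_plug {P : Frame S (Expr S) → Prop} (f : Frame S (Expr S)) (hf : P f)
    {C : Expr S → Expr S} (h : ∃ L : List (Frame S (Expr S)), (∀ f ∈ L, P f) ∧ C = plugAll L) :
    ∃ L : List (Frame S (Expr S)), (∀ f ∈ L, P f) ∧ (fun t => plug f (C t)) = plugAll L := by
  obtain ⟨L, hL, rfl⟩ := h
  exact ⟨f :: L, List.forall_mem_cons.2 ⟨hf, hL⟩, rfl⟩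

/-- Contexts are given as functions, whose syntax cannot be inspected; lists of frames make them
comparable, splittable and concatenable. -/
theorem LocalCtx.exists_frames {C : Expr S → Expr S} (hC : LocalCtx C) :
    ∃ L : List (Frame S (Expr S)),
      (∀ f ∈ L, f.Valid Expr.IsValue ∧ f.IsLocal) ∧ C = plugAll L := by
  induction hC with
  | hole => exact ⟨[], by simp, rfl⟩
  | letin x b _ ih => exact exists_frames_plug (.letin x b) ⟨trivial, trivial⟩ ih
  | appFun as _ ih => exact exists_frames_plug (.appFun as) ⟨trivial, trivial⟩ ih
  | appArg f vs es hf hvs _ ih => exact exists_frames_plug (.appArg f vs es) ⟨⟨hf, hvs⟩, trivial⟩ ih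
  | record fs s gs hfs _ ih => exact exists_frames_plug (.record fs s gs) ⟨hfs, trivial⟩ ih
  | prim op vs es hvs _ ih => exact exists_frames_plug (.prim op vs es) ⟨hvs, trivial⟩ ih
  | getObj k _ ih => exact exists_frames_plug (.getObj k) ⟨trivial, trivial⟩ ih
  | getKey o ho _ ih => exact exists_frames_plug (.getKey o) ⟨ho, trivial⟩ ih
  | putObj k e _ ih => exact exists_frames_plug (.putObj k e) ⟨trivial, trivial⟩ ih
  | putKey o e ho _ ih => exact exists_frames_plug (.putKey o e) ⟨ho, trivial⟩ ih
  | putVal o k ho hk _ ih => exact exists_frames_plug (.putVal o k) ⟨⟨ho, hk⟩, trivial⟩ ih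
  | delObj k _ ih => exact exists_frames_plug (.delObj k) ⟨trivial, trivial⟩ ih
  | delKey o ho _ ih => exact exists_frames_plug (.delKey o) ⟨ho, trivial⟩ ih
  | alloc _ ih => exact exists_frames_plug .alloc ⟨trivial, trivial⟩ ih
  | deref _ ih => exact exists_frames_plug .deref ⟨trivial, trivial⟩ ih
  | assignLoc e _ ih => exact exists_frames_plug (.assignLoc e) ⟨trivial, trivial⟩ ih
  | assignVal l hl _ ih => exact exists_frames_plug (.assignVal l) ⟨hl, trivial⟩ ih
  | ite a b _ ih => exact exists_frames_plug (.ite a b) ⟨trivial, trivial⟩ ih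
  | seq e _ ih => exact exists_frames_plug (.seq e) ⟨trivial, trivial⟩ ih
  | throw _ ih => exact exists_frames_plug .throw ⟨trivial, trivial⟩ ih
  | brk l _ ih => exact exists_frames_plug (.brk l) ⟨trivial, trivial⟩ ih

theorem LocalCtx.plug {f : Frame S (Expr S)} (hf : f.Valid Expr.IsValue) (hl : f.IsLocal)
    {C : Expr S → Expr S} (hC : LocalCtx C) : LocalCtx fun t => JS.plug f (C t) := by
  cases f with
  | letin x b => exact .letin x b hC
  | appFun as => exact .appFun as hC
  | appArg f vs ts => exact .appArg f vs ts hf.1 hf.2 hC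
  | record fs s gs => exact .record fs s gs hf hC
  | prim op vs ts => exact .prim op vs ts hf hC
  | getObj k => exact .getObj k hC
  | getKey o => exact .getKey o hf hC
  | putObj k e => exact .putObj k e hC
  | putKey o e => exact .putKey o e hf hC
  | putVal o k => exact .putVal o k hf.1 hf.2 hC
  | delObj k => exact .delObj k hC
  | delKey o => exact .delKey o hf hC
  | alloc => exact .alloc hC
  | deref => exact .deref hC
  | assignLoc e => exact .assignLoc e hC
  | assignVal l => exact .assignVal l hf hC
  | ite a b => exact .ite a b hC
  | seq e => exact .seq e hC
  | throw => exact .throw hC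
  | brk l => exact .brk l hC
  | tryf f => exact hl.elim
  | label l => exact hl.elim
  | tryc x h => exact hl.elim

theorem ControlCtx.exists_frames {D : Expr S → Expr S} (hD : ControlCtx D) :
    ∃ L : List (Frame S (Expr S)), (∀ f ∈ L, f.Valid Expr.IsValue) ∧ D = plugAll L := by
  induction hD with
  | hole => exact ⟨[], by simp, rfl⟩
  | tryf f hC _ ih =>
    obtain ⟨L, hL, rfl⟩ := ih
    obtain ⟨M, hM, rfl⟩ := hC.exists_frames
    exact ⟨.tryf f :: (M ++ L), List.forall_mem_cons.2 ⟨trivial, List.forall_mem_append.2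
      ⟨fun f hf => (hM f hf).1, hL⟩⟩, by funext; simp [JS.plug]⟩
  | label l hC _ ih =>
    obtain ⟨L, hL, rfl⟩ := ih
    obtain ⟨M, hM, rfl⟩ := hC.exists_frames
    exact ⟨.label l :: (M ++ L), List.forall_mem_cons.2 ⟨trivial, List.forall_mem_append.2
      ⟨fun f hf => (hM f hf).1, hL⟩⟩, by funext; simp [JS.plug]⟩
  | tryc x h hC _ ih =>
    obtain ⟨L, hL, rfl⟩ := ih
    obtain ⟨M, hM, rfl⟩ := hC.exists_frames
    exact ⟨.tryc x h :: (M ++ L), List.forall_mem_cons.2 ⟨trivial, List.forall_mem_append.2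
      ⟨fun f hf => (hM f hf).1, hL⟩⟩, by funext; simp [JS.plug]⟩

theorem EvalCtx.exists_frames {E : Expr S → Expr S} (hE : EvalCtx E) :
    ∃ L : List (Frame S (Expr S)), (∀ f ∈ L, f.Valid Expr.IsValue) ∧ E = plugAll L := by
  obtain ⟨hC, hD⟩ := hE
  obtain ⟨L, hL, rfl⟩ := hC.exists_frames
  obtain ⟨M, hM, rfl⟩ := hD.exists_frames
  exact ⟨L ++ M, List.forall_mem_append.2 ⟨fun f hf => (hL f hf).1, hM⟩, by funext; simp⟩

/-- The grammar `C[D]` imposes no order on frames: a local frame is absorbed by the outer `C`, and a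
control frame starts a new `D` below an empty `C`. -/
theorem evalCtx_plugAll {L : List (Frame S (Expr S))} (hL : ∀ f ∈ L, f.Valid Expr.IsValue) :
    EvalCtx (plugAll L) := by
  induction L with
  | nil => exact .mk .hole .hole
  | cons f L ih =>
    obtain ⟨hf, hL⟩ := List.forall_mem_cons.1 hL
    generalize hE : plugAll L = E at ih
    have : plugAll (f :: L) = fun t => JS.plug f (E t) := by subst hE; rfl
    rw [this]
    obtain @⟨C, D, hC, hD⟩ := ih hL
    by_cases hl : f.IsLocal
    · exact .mk (C := fun t => JS.plug f (C t)) (hC.plug hf hl) hD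
    · cases f with
      | tryf f => exact .mk (C := fun t => t) .hole (.tryf f hC hD)
      | label l => exact .mk (C := fun t => t) .hole (.label l hC hD)
      | tryc x h => exact .mk (C := fun t => t) .hole (.tryc x h hC hD)
      | _ => exact (hl trivial).elim

theorem LabelCtx.exists_frames {F : Expr S → Expr S} (hF : LabelCtx F) :
    ∃ L : List (Frame S (Expr S)),
      (∀ f ∈ L, f.Valid Expr.IsValue ∧ f.PassesThrow) ∧ F = plugAll L := by
  induction hF with
  | loc hC =>
    obtain ⟨L, hL, rfl⟩ := hC.exists_frames
    exact ⟨L, fun f hf => ⟨(hL f hf).1, (hL f hf).2.passesThrow⟩, rfl⟩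
  | label l hC _ ih =>
    obtain ⟨L, hL, rfl⟩ := ih
    obtain ⟨M, hM, rfl⟩ := hC.exists_frames
    exact ⟨M ++ .label l :: L, List.forall_mem_append.2
      ⟨fun f hf => ⟨(hM f hf).1, (hM f hf).2.passesThrow⟩,
        List.forall_mem_cons.2 ⟨⟨trivial, trivial⟩, hL⟩⟩, by funext; simp [JS.plug]⟩

/-- With the converse above, contexts `F` are exactly the lists of local frames and labels, which
makes them closed under concatenation. -/
theorem labelCtx_plugAll {L : List (Frame S (Expr S))}
    (hL : ∀ f ∈ L, f.Valid Expr.IsValue ∧ f.PassesThrow) : LabelCtx (plugAll L) := by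
  induction L with
  | nil => exact .loc .hole
  | cons f L ih =>
    obtain ⟨⟨hf, hp⟩, hL'⟩ := List.forall_mem_cons.1 hL
    generalize hE : plugAll L = E at ih
    have : plugAll (f :: L) = fun t => JS.plug f (E t) := by subst hE; rfl
    rw [this]
    by_cases hl : f.IsLocal
    · cases ih hL' with
      | loc hC => exact .loc (hC.plug hf hl)
      | label l hC hF => exact .label l (hC.plug hf hl) hF
    · cases f with
      | tryf f => exact hp.elim
      | label l => exact .label l .hole (ih hL')
      | tryc x h => exact hp.elim
      | _ => exact (hl trivial).elim

theorem HandlerCtx.exists_frames {G : Expr S → Expr S} (hG : HandlerCtx G) :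
    ∃ L : List (Frame S (Expr S)),
      (∀ f ∈ L, f.Valid Expr.IsValue ∧ f.PassesBreak) ∧ G = plugAll L := by
  induction hG with
  | loc hC =>
    obtain ⟨L, hL, rfl⟩ := hC.exists_frames
    exact ⟨L, fun f hf => ⟨(hL f hf).1, (hL f hf).2.passesBreak⟩, rfl⟩
  | tryc x h hC _ ih =>
    obtain ⟨L, hL, rfl⟩ := ih
    obtain ⟨M, hM, rfl⟩ := hC.exists_frames
    exact ⟨M ++ .tryc x h :: L, List.forall_mem_append.2
      ⟨fun f hf => ⟨(hM f hf).1, (hM f hf).2.passesBreak⟩,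
        List.forall_mem_cons.2 ⟨⟨trivial, trivial⟩, hL⟩⟩, by funext; simp [JS.plug]⟩

theorem handlerCtx_plugAll {L : List (Frame S (Expr S))}
    (hL : ∀ f ∈ L, f.Valid Expr.IsValue ∧ f.PassesBreak) : HandlerCtx (plugAll L) := by
  induction L with
  | nil => exact .loc .hole
  | cons f L ih =>
    obtain ⟨⟨hf, hp⟩, hL'⟩ := List.forall_mem_cons.1 hL
    generalize hE : plugAll L = E at ih
    have : plugAll (f :: L) = fun t => JS.plug f (E t) := by subst hE; rfl
    rw [this]
    by_cases hl : f.IsLocal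
    · cases ih hL' with
      | loc hC => exact .loc (hC.plug hf hl)
      | tryc x h hC hG => exact .tryc x h (hC.plug hf hl) hG
    · cases f with
      | tryf f => exact hp.elim
      | label l => exact hp.elim
      | tryc x h => exact .tryc x h .hole (ih hL')
      | _ => exact (hl trivial).elim

/-! ## Unique decomposition in `λ_JS` -/

/-- Among filled frames only a record can be a value, and then the field in the hole is a value too.
-/
theorem plug_not_isValue (f : Frame S (Expr S)) {t : Expr S} (ht : ¬ t.IsValue) :
    ¬ (plug f t).IsValue := by
  intro h
  cases f <;> simp only [plug] at h <;> cases h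
  rename_i hv
  exact ht (hv _ (List.mem_append_right _ List.mem_cons_self))

theorem plugAll_not_isValue (L : List (Frame S (Expr S))) {t : Expr S} (ht : ¬ t.IsValue) :
    ¬ (plugAll L t).IsValue := by
  induction L with
  | nil => exact ht
  | cons f L ih => exact plug_not_isValue f ih

end JS

/-- The first element of a list that fails to satisfy `P` splits the list in a unique way. -/
theorem append_cons_inj_of_first {α : Type*} {P : α → Prop} {l m : List α} {a b : α}
    {l' m' : List α}
    (h : l ++ a :: l' = m ++ b :: m') (hl : ∀ x ∈ l, P x) (hm : ∀ x ∈ m, P x) (ha : ¬ P a)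
    (hb : ¬ P b) : l = m ∧ a = b ∧ l' = m' := by
  induction l generalizing m with
  | nil =>
    cases m with
    | nil => simpa using h
    | cons c m => exact (ha ((List.cons.inj h).1 ▸ hm c List.mem_cons_self)).elim
  | cons c l ih =>
    cases m with
    | nil => exact (hb ((List.cons.inj h).1 ▸ hl c List.mem_cons_self)).elim
    | cons d m =>
      simp only [List.cons_append, List.cons.injEq, List.forall_mem_cons] at h hl hm
      obtain ⟨rfl, h2, h3⟩ := ih h.2 hl.2 hm.2
      exact ⟨by rw [h.1], h2, h3⟩

namespace JS

/-- The hole of a valid frame sits at the first non-value in evaluation order, a position that the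
filled term determines. Two different frames of one constructor, such as `appFun` and `appArg`,
would require the same subterm to be both a value and not. -/
theorem plug_inj {f g : Frame S (Expr S)} {t u : Expr S} (hf : f.Valid Expr.IsValue)
    (hg : g.Valid Expr.IsValue) (ht : ¬ t.IsValue) (hu : ¬ u.IsValue)
    (h : plug f t = plug g u) : f = g ∧ t = u := by
  cases f with
  | record fs s gs =>
    cases g <;> simp only [plug, reduceCtorEq, Expr.record.injEq] at h
    obtain ⟨rfl, h2, rfl⟩ :=
      append_cons_inj_of_first (P := fun p : S.Str × Expr S => p.2.IsValue) h hf hg ht hu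
    simp_all
  | prim op vs ts =>
    cases g <;> simp only [plug, reduceCtorEq, Expr.prim.injEq] at h
    obtain ⟨rfl, rfl, rfl⟩ := append_cons_inj_of_first h.2 hf hg ht hu
    simp_all
  | appArg f vs ts =>
    cases g <;> simp only [plug, reduceCtorEq, Expr.app.injEq] at h
    · exact (hu (h.1 ▸ hf.1)).elim
    · obtain ⟨rfl, rfl, rfl⟩ := append_cons_inj_of_first h.2 hf.2 hg.2 ht hu
      simp_all
  | _ => cases g <;> simp_all [plug, Frame.Valid]

/-- A term that is not a value and whose subterms in evaluation position are values. -/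
def Core (t : Expr S) : Prop :=
  ¬ t.IsValue ∧ ∀ (f : Frame S (Expr S)) (u : Expr S),
    f.Valid Expr.IsValue → t = plug f u → u.IsValue

/-- Frames are peeled off in parallel by `plug_inj`. Neither list can run out before the other,
because a core term is not a valid frame around a non-value. -/
theorem decomposition_unique {L M : List (Frame S (Expr S))} {t u : Expr S}
    (hL : ∀ f ∈ L, f.Valid Expr.IsValue) (hM : ∀ f ∈ M, f.Valid Expr.IsValue) (ht : Core t)
    (hu : Core u) (h : plugAll L t = plugAll M u) : L = M ∧ t = u := by
  induction L generalizing M with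
  | nil =>
    cases M with
    | nil => exact ⟨rfl, h⟩
    | cons g M =>
      exact (plugAll_not_isValue M hu.1 (ht.2 g _ (hM g (by simp)) h)).elim
  | cons f L ih =>
    cases M with
    | nil => exact (plugAll_not_isValue L ht.1 (hu.2 f _ (hL f (by simp)) h.symm)).elim
    | cons g M =>
      obtain ⟨hf, hL'⟩ := List.forall_mem_cons.1 hL
      obtain ⟨hg, hM'⟩ := List.forall_mem_cons.1 hM
      obtain ⟨rfl, h'⟩ :=
        plug_inj hf hg (plugAll_not_isValue L ht.1) (plugAll_not_isValue M hu.1) h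
      obtain ⟨rfl, h''⟩ := ih hL' hM' h'
      exact ⟨rfl, h''⟩

theorem core_throw {v : Expr S} (hv : v.IsValue) : Core (.throw v) :=
  ⟨by rintro ⟨⟩, fun f u _ h => by cases f <;> simp_all [plug]⟩

theorem core_brk (l : S.Label) {v : Expr S} (hv : v.IsValue) : Core (.brk l v) :=
  ⟨by rintro ⟨⟩, fun f u _ h => by cases f <;> simp_all [plug]⟩

theorem core_alloc {v : Expr S} (hv : v.IsValue) : Core (.alloc v) :=
  ⟨by rintro ⟨⟩, fun f u _ h => by cases f <;> simp_all [plug]⟩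

theorem core_deref {v : Expr S} (hv : v.IsValue) : Core (.deref v) :=
  ⟨by rintro ⟨⟩, fun f u _ h => by cases f <;> simp_all [plug]⟩

theorem core_assign {u v : Expr S} (hu : u.IsValue) (hv : v.IsValue) : Core (.assign u v) :=
  ⟨by rintro ⟨⟩, fun f u _ h => by cases f <;> simp_all [plug]⟩

/-- In every left-hand side the evaluation positions are filled by values; a `while` has none at
all. -/
theorem Red.core {δ : S.Op → List (Expr S) → Option (Expr S)} {e e' : Expr S} (h : Red δ e e') :
    Core e := by
  have hc : ∀ k : S.Const, (Expr.const k).IsValue := .const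
  have hfn : ∀ (xs : List S.Var) (b : Expr S), (Expr.func xs b).IsValue := .func
  refine ⟨by cases h <;> rintro ⟨⟩, fun f u _ he => ?_⟩
  cases h <;> cases f <;> simp_all [plug] <;> grind

/-- Together with `Red.ne_brk` this leaves `throw` and `break` to the rules that mention their
surrounding context. -/
theorem Red.ne_throw {δ : S.Op → List (Expr S) → Option (Expr S)} {e e' : Expr S}
    (h : Red δ e e') (v : Expr S) : e ≠ .throw v := by
  cases h <;> simp

theorem Red.ne_brk {δ : S.Op → List (Expr S) → Option (Expr S)} {e e' : Expr S}
    (h : Red δ e e') (l : S.Label) (v : Expr S) : e ≠ .brk l v := by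
  cases h <;> simp

-- Frames that a throw or a break skips

/-- An expression that throws does not change its reductions when frames through which exceptions
propagate are inserted around the `throw`. -/
theorem Step.insert_throw {δ : S.Op → List (Expr S) → Option (Expr S)} {σ : Store S (Expr S)}
    {L M : List (Frame S (Expr S))} {v : Expr S} {s : State S (Expr S)}
    (hL : ∀ f ∈ L, f.Valid Expr.IsValue) (hM : ∀ f ∈ M, f.Valid Expr.IsValue ∧ f.PassesThrow)
    (hv : v.IsValue) (h : Step δ (σ, .run (plugAll L (.throw v))) s) :
    Step δ (σ, .run (plugAll L (plugAll M (.throw v)))) s := by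
  generalize hs : (σ, Outcome.run (plugAll L (.throw v))) = s₀ at h
  -- A rule that rewrites some other redex in an evaluation context cannot apply, since unique
  -- decomposition identifies that redex with the `throw`.
  have absurd_core : ∀ {E : Expr S → Expr S} {t : Expr S}, EvalCtx E → Core t →
      plugAll L (.throw v) = E t → .throw v = t := by
    intro E t hE ht h
    obtain ⟨K, hK, rfl⟩ := hE.exists_frames
    exact (decomposition_unique hL hK (core_throw hv) ht h).2
  cases h <;> simp only [Prod.mk.injEq, Outcome.run.injEq] at hs <;> obtain ⟨rfl, hs⟩ := hs
  case ctx hE _ _ h => exact (h.ne_throw v (absurd_core hE h.core hs).symm).elim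
  case alloc hE _ h _ _ => cases absurd_core hE (core_alloc h) hs
  case deref hE _ _ _ => cases absurd_core hE (core_deref (.const _)) hs
  case derefDangling hE _ _ => cases absurd_core hE (core_deref (.const _)) hs
  case assign hE _ _ h => cases absurd_core hE (core_assign (.const _) h) hs
  case uncaught F hF w hw =>
    obtain ⟨K, hK, rfl⟩ := hF.exists_frames
    obtain ⟨rfl, h⟩ := decomposition_unique hL (fun f hf => (hK f hf).1) (core_throw hv)
      (core_throw hw) hs
    obtain rfl := Expr.throw.inj h
    rw [← plugAll_append]
    -- The context of the rule becomes `K` followed by `M`, again a context through which exceptions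
    -- pass.
    exact .uncaught _ (labelCtx_plugAll (List.forall_mem_append.2 ⟨hK, hM⟩)) v hv
  case throwCatch E F hE hF w hw x e =>
    obtain ⟨K, hK, rfl⟩ := hF.exists_frames
    obtain ⟨N, hN, rfl⟩ := hE.exists_frames
    -- The whole term is decomposed around the innermost `throw`: outer context, catching frame,
    -- skipped frames. Hence `L` ends with the frames `K`, and `M` extends them.
    obtain ⟨rfl, h⟩ := decomposition_unique (M := N ++ .tryc x e :: K) hL
      (List.forall_mem_append.2 ⟨hN, List.forall_mem_cons.2 ⟨trivial, fun f hf => (hK f hf).1⟩⟩)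
      (core_throw hv) (core_throw hw) (by simpa [plug] using hs)
    obtain rfl := Expr.throw.inj h
    have := Step.throwCatch (δ := δ) σ (evalCtx_plugAll hN)
      (labelCtx_plugAll (List.forall_mem_append.2 ⟨hK, hM⟩)) v hv x e
    simpa [plug] using this
  case throwFinally E F hE hF w hw e =>
    obtain ⟨K, hK, rfl⟩ := hF.exists_frames
    obtain ⟨N, hN, rfl⟩ := hE.exists_frames
    obtain ⟨rfl, h⟩ := decomposition_unique (M := N ++ .tryf e :: K) hL
      (List.forall_mem_append.2 ⟨hN, List.forall_mem_cons.2 ⟨trivial, fun f hf => (hK f hf).1⟩⟩)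
      (core_throw hv) (core_throw hw) (by simpa [plug] using hs)
    obtain rfl := Expr.throw.inj h
    have := Step.throwFinally (δ := δ) σ (evalCtx_plugAll hN)
      (labelCtx_plugAll (List.forall_mem_append.2 ⟨hK, hM⟩)) v hv e
    simpa [plug] using this
  case breakFinally E G hE hG l w hw e =>
    obtain ⟨K, hK, rfl⟩ := hG.exists_frames
    obtain ⟨N, hN, rfl⟩ := hE.exists_frames
    -- The rules for breaks are excluded: the core of the term would be both a `throw` and a
    -- `break`.
    cases (decomposition_unique (M := N ++ .tryf e :: K) hL
      (List.forall_mem_append.2 ⟨hN, List.forall_mem_cons.2 ⟨trivial, fun f hf => (hK f hf).1⟩⟩)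
      (core_throw hv) (core_brk l hw) (by simpa [plug] using hs)).2
  case breakLabel E G hE hG l w hw =>
    obtain ⟨K, hK, rfl⟩ := hG.exists_frames
    obtain ⟨N, hN, rfl⟩ := hE.exists_frames
    cases (decomposition_unique (M := N ++ .label l :: K) hL
      (List.forall_mem_append.2 ⟨hN, List.forall_mem_cons.2 ⟨trivial, fun f hf => (hK f hf).1⟩⟩)
      (core_throw hv) (core_brk l hw) (by simpa [plug] using hs)).2
  case breakOther E G hE hG l l' hl w hw =>
    obtain ⟨K, hK, rfl⟩ := hG.exists_frames
    obtain ⟨N, hN, rfl⟩ := hE.exists_frames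
    cases (decomposition_unique (M := N ++ .label l' :: K) hL
      (List.forall_mem_append.2 ⟨hN, List.forall_mem_cons.2 ⟨trivial, fun f hf => (hK f hf).1⟩⟩)
      (core_throw hv) (core_brk l hw) (by simpa [plug] using hs)).2
  case breakUnbound G hG l w hw =>
    obtain ⟨K, hK, rfl⟩ := hG.exists_frames
    cases (decomposition_unique hL (fun f hf => (hK f hf).1) (core_throw hv)
      (core_brk l hw) hs).2

/-- An expression that breaks does not change its reductions when frames through which breaks
propagate are inserted around the `break`. -/
theorem Step.insert_break {δ : S.Op → List (Expr S) → Option (Expr S)} {σ : Store S (Expr S)}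
    {L M : List (Frame S (Expr S))} {l : S.Label} {v : Expr S} {s : State S (Expr S)}
    (hL : ∀ f ∈ L, f.Valid Expr.IsValue) (hM : ∀ f ∈ M, f.Valid Expr.IsValue ∧ f.PassesBreak)
    (hv : v.IsValue) (h : Step δ (σ, .run (plugAll L (.brk l v))) s) :
    Step δ (σ, .run (plugAll L (plugAll M (.brk l v)))) s := by
  generalize hs : (σ, Outcome.run (plugAll L (.brk l v))) = s₀ at h
  have absurd_core : ∀ {E : Expr S → Expr S} {t : Expr S}, EvalCtx E → Core t →
      plugAll L (.brk l v) = E t → .brk l v = t := by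
    intro E t hE ht h
    obtain ⟨K, hK, rfl⟩ := hE.exists_frames
    exact (decomposition_unique hL hK (core_brk l hv) ht h).2
  cases h <;> simp only [Prod.mk.injEq, Outcome.run.injEq] at hs <;> obtain ⟨rfl, hs⟩ := hs
  case ctx hE _ _ h => exact (h.ne_brk l v (absurd_core hE h.core hs).symm).elim
  case alloc hE _ h _ _ => cases absurd_core hE (core_alloc h) hs
  case deref hE _ _ _ => cases absurd_core hE (core_deref (.const _)) hs
  case derefDangling hE _ _ => cases absurd_core hE (core_deref (.const _)) hs
  case assign hE _ _ h => cases absurd_core hE (core_assign (.const _) h) hs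
  case uncaught F hF w hw =>
    obtain ⟨K, hK, rfl⟩ := hF.exists_frames
    cases (decomposition_unique hL (fun f hf => (hK f hf).1) (core_brk l hv)
      (core_throw hw) hs).2
  case throwCatch E F hE hF w hw x e =>
    obtain ⟨K, hK, rfl⟩ := hF.exists_frames
    obtain ⟨N, hN, rfl⟩ := hE.exists_frames
    cases (decomposition_unique (M := N ++ .tryc x e :: K) hL
      (List.forall_mem_append.2 ⟨hN, List.forall_mem_cons.2 ⟨trivial, fun f hf => (hK f hf).1⟩⟩)
      (core_brk l hv) (core_throw hw) (by simpa [plug] using hs)).2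
  case throwFinally E F hE hF w hw e =>
    obtain ⟨K, hK, rfl⟩ := hF.exists_frames
    obtain ⟨N, hN, rfl⟩ := hE.exists_frames
    cases (decomposition_unique (M := N ++ .tryf e :: K) hL
      (List.forall_mem_append.2 ⟨hN, List.forall_mem_cons.2 ⟨trivial, fun f hf => (hK f hf).1⟩⟩)
      (core_brk l hv) (core_throw hw) (by simpa [plug] using hs)).2
  case breakFinally E G hE hG l₁ w hw e =>
    obtain ⟨K, hK, rfl⟩ := hG.exists_frames
    obtain ⟨N, hN, rfl⟩ := hE.exists_frames
    obtain ⟨rfl, h⟩ := decomposition_unique (M := N ++ .tryf e :: K) hL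
      (List.forall_mem_append.2 ⟨hN, List.forall_mem_cons.2 ⟨trivial, fun f hf => (hK f hf).1⟩⟩)
      (core_brk l hv) (core_brk l₁ hw) (by simpa [plug] using hs)
    obtain ⟨rfl, rfl⟩ := Expr.brk.inj h
    have := Step.breakFinally (δ := δ) σ (evalCtx_plugAll hN)
      (handlerCtx_plugAll (List.forall_mem_append.2 ⟨hK, hM⟩)) l v hv e
    simpa [plug] using this
  case breakLabel E G hE hG l₁ w hw =>
    obtain ⟨K, hK, rfl⟩ := hG.exists_frames
    obtain ⟨N, hN, rfl⟩ := hE.exists_frames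
    obtain ⟨rfl, h⟩ := decomposition_unique (M := N ++ .label l₁ :: K) hL
      (List.forall_mem_append.2 ⟨hN, List.forall_mem_cons.2 ⟨trivial, fun f hf => (hK f hf).1⟩⟩)
      (core_brk l hv) (core_brk l₁ hw) (by simpa [plug] using hs)
    obtain ⟨rfl, rfl⟩ := Expr.brk.inj h
    have := Step.breakLabel (δ := δ) σ (evalCtx_plugAll hN)
      (handlerCtx_plugAll (List.forall_mem_append.2 ⟨hK, hM⟩)) l v hv
    simpa [plug] using this
  case breakOther E G hE hG l₁ l' hl w hw =>
    obtain ⟨K, hK, rfl⟩ := hG.exists_frames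
    obtain ⟨N, hN, rfl⟩ := hE.exists_frames
    obtain ⟨rfl, h⟩ := decomposition_unique (M := N ++ .label l' :: K) hL
      (List.forall_mem_append.2 ⟨hN, List.forall_mem_cons.2 ⟨trivial, fun f hf => (hK f hf).1⟩⟩)
      (core_brk l hv) (core_brk l₁ hw) (by simpa [plug] using hs)
    obtain ⟨rfl, rfl⟩ := Expr.brk.inj h
    have := Step.breakOther (δ := δ) σ (evalCtx_plugAll hN)
      (handlerCtx_plugAll (List.forall_mem_append.2 ⟨hK, hM⟩)) l l' hl v hv
    simpa [plug] using this
  case breakUnbound G hG l₁ w hw =>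
    obtain ⟨K, hK, rfl⟩ := hG.exists_frames
    obtain ⟨rfl, h⟩ := decomposition_unique hL (fun f hf => (hK f hf).1) (core_brk l hv)
      (core_brk l₁ hw) hs
    obtain ⟨rfl, rfl⟩ := Expr.brk.inj h
    rw [← plugAll_append]
    exact .breakUnbound _ (handlerCtx_plugAll (List.forall_mem_append.2 ⟨hK, hM⟩)) l v hv

/-- Only first steps are compared. As `t` is not a value, the filled context is not an answer, so
the given reduction has a first step, which can be taken from the other state instead. The state
with `t` itself need not be reachable from the one with `u`; this is why the target must be an
answer. -/
theorem reaches_answer_insert {δ : S.Op → List (Expr S) → Option (Expr S)} {σ : Store S (Expr S)}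
    {L : List (Frame S (Expr S))} {t u : Expr S} {A : State S (Expr S)} (ht : ¬ t.IsValue)
    (hstep : ∀ s, Step δ (σ, .run (plugAll L t)) s → Step δ (σ, .run (plugAll L u)) s)
    (hA : IsAnswer Expr.IsValue A)
    (h : Relation.ReflTransGen (Step δ) (σ, .run (plugAll L t)) A) :
    Relation.ReflTransGen (Step δ) (σ, .run (plugAll L u)) A := by
  rcases h.cases_head with rfl | ⟨s, h₁, h₂⟩
  · obtain ⟨-, -, v, hv, h | h⟩ := hA
    · exact (plugAll_not_isValue L ht (Outcome.run.inj h ▸ hv)).elim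
    · cases h
  · exact .head (hstep s h₁) h₂

end JS

-- Frames of closures

namespace Rho

/-- Filling the hole of a frame. -/
def plug : Frame S (Clo S) → Clo S → Clo S
  | .letin x b, t => .letin x t b
  | .appFun as, t => .app t as
  | .appArg f vs ts, t => .app f (vs ++ t :: ts)
  | .record fs s gs, t => .record (fs ++ (s, t) :: gs)
  | .prim op vs ts, t => .prim op (vs ++ t :: ts)
  | .getObj k, t => .get t k
  | .getKey o, t => .get o t
  | .putObj k e, t => .put t k e
  | .putKey o e, t => .put o t e
  | .putVal o k, t => .put o k t
  | .delObj k, t => .del t k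
  | .delKey o, t => .del o t
  | .alloc, t => .alloc t
  | .deref, t => .deref t
  | .assignLoc e, t => .assign t e
  | .assignVal l, t => .assign l t
  | .ite a b, t => .ite t a b
  | .seq e, t => .seq t e
  | .throw, t => .throw t
  | .brk l, t => .brk l t
  | .tryf f, t => .tryf t f
  | .label l, t => .label l t
  | .tryc x h, t => .tryc t x h

/-- Filling the hole of a context, given as a list of frames from the outside in. -/
def plugAll (L : List (Frame S (Clo S))) (t : Clo S) : Clo S := L.foldr plug t

@[simp] theorem plugAll_nil (t : Clo S) : plugAll [] t = t := rfl

@[simp] theorem plugAll_cons (f : Frame S (Clo S)) (L : List (Frame S (Clo S))) (t : Clo S) :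
    plugAll (f :: L) t = plug f (plugAll L t) := rfl

@[simp] theorem plugAll_append (L M : List (Frame S (Clo S))) (t : Clo S) :
    plugAll (L ++ M) t = plugAll L (plugAll M t) := by simp [plugAll]

theorem exists_frames_plug {P : Frame S (Clo S) → Prop} (f : Frame S (Clo S)) (hf : P f)
    {C : Clo S → Clo S} (h : ∃ L : List (Frame S (Clo S)), (∀ f ∈ L, P f) ∧ C = plugAll L) :
    ∃ L : List (Frame S (Clo S)), (∀ f ∈ L, P f) ∧ (fun t => plug f (C t)) = plugAll L := by
  obtain ⟨L, hL, rfl⟩ := h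
  exact ⟨f :: L, List.forall_mem_cons.2 ⟨hf, hL⟩, rfl⟩

theorem LocalCtx.exists_frames {C : Clo S → Clo S} (hC : LocalCtx C) :
    ∃ L : List (Frame S (Clo S)),
      (∀ f ∈ L, f.Valid Clo.IsValue ∧ f.IsLocal) ∧ C = plugAll L := by
  induction hC with
  | hole => exact ⟨[], by simp, rfl⟩
  | letin x b _ ih => exact exists_frames_plug (.letin x b) ⟨trivial, trivial⟩ ih
  | appFun as _ ih => exact exists_frames_plug (.appFun as) ⟨trivial, trivial⟩ ih
  | appArg f vs cs hf hvs _ ih => exact exists_frames_plug (.appArg f vs cs) ⟨⟨hf, hvs⟩, trivial⟩ ih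
  | record fs s gs hfs _ ih => exact exists_frames_plug (.record fs s gs) ⟨hfs, trivial⟩ ih
  | prim op vs cs hvs _ ih => exact exists_frames_plug (.prim op vs cs) ⟨hvs, trivial⟩ ih
  | getObj k _ ih => exact exists_frames_plug (.getObj k) ⟨trivial, trivial⟩ ih
  | getKey o ho _ ih => exact exists_frames_plug (.getKey o) ⟨ho, trivial⟩ ih
  | putObj k e _ ih => exact exists_frames_plug (.putObj k e) ⟨trivial, trivial⟩ ih
  | putKey o e ho _ ih => exact exists_frames_plug (.putKey o e) ⟨ho, trivial⟩ ih
  | putVal o k ho hk _ ih => exact exists_frames_plug (.putVal o k) ⟨⟨ho, hk⟩, trivial⟩ ih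
  | delObj k _ ih => exact exists_frames_plug (.delObj k) ⟨trivial, trivial⟩ ih
  | delKey o ho _ ih => exact exists_frames_plug (.delKey o) ⟨ho, trivial⟩ ih
  | alloc _ ih => exact exists_frames_plug .alloc ⟨trivial, trivial⟩ ih
  | deref _ ih => exact exists_frames_plug .deref ⟨trivial, trivial⟩ ih
  | assignLoc e _ ih => exact exists_frames_plug (.assignLoc e) ⟨trivial, trivial⟩ ih
  | assignVal l hl _ ih => exact exists_frames_plug (.assignVal l) ⟨hl, trivial⟩ ih
  | ite a b _ ih => exact exists_frames_plug (.ite a b) ⟨trivial, trivial⟩ ih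
  | seq e _ ih => exact exists_frames_plug (.seq e) ⟨trivial, trivial⟩ ih
  | throw _ ih => exact exists_frames_plug .throw ⟨trivial, trivial⟩ ih
  | brk l _ ih => exact exists_frames_plug (.brk l) ⟨trivial, trivial⟩ ih

theorem LocalCtx.plug {f : Frame S (Clo S)} (hf : f.Valid Clo.IsValue) (hl : f.IsLocal)
    {C : Clo S → Clo S} (hC : LocalCtx C) : LocalCtx fun t => Rho.plug f (C t) := by
  cases f with
  | letin x b => exact .letin x b hC
  | appFun as => exact .appFun as hC
  | appArg f vs ts => exact .appArg f vs ts hf.1 hf.2 hC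
  | record fs s gs => exact .record fs s gs hf hC
  | prim op vs ts => exact .prim op vs ts hf hC
  | getObj k => exact .getObj k hC
  | getKey o => exact .getKey o hf hC
  | putObj k e => exact .putObj k e hC
  | putKey o e => exact .putKey o e hf hC
  | putVal o k => exact .putVal o k hf.1 hf.2 hC
  | delObj k => exact .delObj k hC
  | delKey o => exact .delKey o hf hC
  | alloc => exact .alloc hC
  | deref => exact .deref hC
  | assignLoc e => exact .assignLoc e hC
  | assignVal l => exact .assignVal l hf hC
  | ite a b => exact .ite a b hC
  | seq e => exact .seq e hC
  | throw => exact .throw hC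
  | brk l => exact .brk l hC
  | tryf f => exact hl.elim
  | label l => exact hl.elim
  | tryc x h => exact hl.elim

theorem ControlCtx.exists_frames {D : Clo S → Clo S} (hD : ControlCtx D) :
    ∃ L : List (Frame S (Clo S)), (∀ f ∈ L, f.Valid Clo.IsValue) ∧ D = plugAll L := by
  induction hD with
  | hole => exact ⟨[], by simp, rfl⟩
  | tryf f hC _ ih =>
    obtain ⟨L, hL, rfl⟩ := ih
    obtain ⟨M, hM, rfl⟩ := hC.exists_frames
    exact ⟨.tryf f :: (M ++ L), List.forall_mem_cons.2 ⟨trivial, List.forall_mem_append.2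
      ⟨fun f hf => (hM f hf).1, hL⟩⟩, by funext; simp [Rho.plug]⟩
  | label l hC _ ih =>
    obtain ⟨L, hL, rfl⟩ := ih
    obtain ⟨M, hM, rfl⟩ := hC.exists_frames
    exact ⟨.label l :: (M ++ L), List.forall_mem_cons.2 ⟨trivial, List.forall_mem_append.2
      ⟨fun f hf => (hM f hf).1, hL⟩⟩, by funext; simp [Rho.plug]⟩
  | tryc x h hC _ ih =>
    obtain ⟨L, hL, rfl⟩ := ih
    obtain ⟨M, hM, rfl⟩ := hC.exists_frames
    exact ⟨.tryc x h :: (M ++ L), List.forall_mem_cons.2 ⟨trivial, List.forall_mem_append.2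
      ⟨fun f hf => (hM f hf).1, hL⟩⟩, by funext; simp [Rho.plug]⟩

theorem EvalCtx.exists_frames {E : Clo S → Clo S} (hE : EvalCtx E) :
    ∃ L : List (Frame S (Clo S)), (∀ f ∈ L, f.Valid Clo.IsValue) ∧ E = plugAll L := by
  obtain ⟨hC, hD⟩ := hE
  obtain ⟨L, hL, rfl⟩ := hC.exists_frames
  obtain ⟨M, hM, rfl⟩ := hD.exists_frames
  exact ⟨L ++ M, List.forall_mem_append.2 ⟨fun f hf => (hL f hf).1, hM⟩, by funext; simp⟩

theorem evalCtx_plugAll {L : List (Frame S (Clo S))} (hL : ∀ f ∈ L, f.Valid Clo.IsValue) :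
    EvalCtx (plugAll L) := by
  induction L with
  | nil => exact .mk .hole .hole
  | cons f L ih =>
    obtain ⟨hf, hL⟩ := List.forall_mem_cons.1 hL
    generalize hE : plugAll L = E at ih
    have : plugAll (f :: L) = fun t => Rho.plug f (E t) := by subst hE; rfl
    rw [this]
    obtain @⟨C, D, hC, hD⟩ := ih hL
    by_cases hl : f.IsLocal
    · exact .mk (C := fun t => Rho.plug f (C t)) (hC.plug hf hl) hD
    · cases f with
      | tryf f => exact .mk (C := fun t => t) .hole (.tryf f hC hD)
      | label l => exact .mk (C := fun t => t) .hole (.label l hC hD)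
      | tryc x h => exact .mk (C := fun t => t) .hole (.tryc x h hC hD)
      | _ => exact (hl trivial).elim

theorem localCtx_plugAll {L : List (Frame S (Clo S))}
    (hL : ∀ f ∈ L, f.Valid Clo.IsValue ∧ f.IsLocal) : LocalCtx (plugAll L) := by
  induction L with
  | nil => exact .hole
  | cons f L ih =>
    obtain ⟨⟨hf, hp⟩, hL'⟩ := List.forall_mem_cons.1 hL
    exact (ih hL').plug hf hp

end Rho

/-! ## Unloading closures -/

/-- The expression denoted by a closure below a binder for `x`. -/
def Clo.unloadUnder (x : S.Var) : Clo S → Expr S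
  | .clos e ρ => e.subst (hide (assoc (Clo.forceEnv ρ)) [x])
  | _ => .const .undef

mutual
/-- The expression denoted by a closure: all delayed substitutions are carried out. -/
def Clo.unload : Clo S → Expr S
  | .const k => .const k
  | .clos e ρ => e.subst (assoc (Clo.forceEnv ρ))
  | .record fs => .record (Clo.unloadFields fs)
  | .letin x c b => .letin x c.unload (b.unloadUnder x)
  | .app f as => .app f.unload (Clo.unloadList as)
  | .get o k => .get o.unload k.unload
  | .put o k c => .put o.unload k.unload c.unload
  | .del o k => .del o.unload k.unload
  | .assign l c => .assign l.unload c.unload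
  | .alloc c => .alloc c.unload
  | .deref c => .deref c.unload
  | .ite c t f => .ite c.unload t.unload f.unload
  | .seq a b => .seq a.unload b.unload
  | .whl c b => .whl c.unload b.unload
  | .label l c => .label l c.unload
  | .brk l c => .brk l c.unload
  | .tryc c x h => .tryc c.unload x (h.unloadUnder x)
  | .tryf c f => .tryf c.unload f.unload
  | .throw c => .throw c.unload
  | .prim op as => .prim op (Clo.unloadList as)
def Clo.unloadList : List (Clo S) → List (Expr S)
  | [] => []
  | c :: cs => c.unload :: Clo.unloadList cs
def Clo.unloadFields : List (S.Str × Clo S) → List (S.Str × Expr S)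
  | [] => []
  | (s, c) :: fs => (s, c.unload) :: Clo.unloadFields fs
end

/-- The environment `ρ` binds all variables in `X`, and only to closed values. -/
def EnvFor (ρ : Env S) (X : Set S.Var) : Prop :=
  (∀ x ∈ X, ∃ p ∈ ρ, p.1 = x) ∧ ∀ p ∈ ρ, p.2.IsClosedValue

/-- Closed closures below a binder for `x`; only pairs `(e, ρ)` occur there. -/
def Clo.ClosedUnder (x : S.Var) : Clo S → Prop
  | .clos e ρ => EnvFor ρ (e.fv \ {x})
  | _ => False

mutual
/-- Closed closures: environments bind all free variables to closed values. -/
def Clo.Closed : Clo S → Prop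
  | .const _ => True
  | .clos e ρ => EnvFor ρ e.fv
  | .record fs => Clo.ClosedFields fs
  | .letin x c b => c.Closed ∧ b.ClosedUnder x
  | .app f as => f.Closed ∧ Clo.ClosedList as
  | .get o k => o.Closed ∧ k.Closed
  | .put o k c => o.Closed ∧ k.Closed ∧ c.Closed
  | .del o k => o.Closed ∧ k.Closed
  | .assign l c => l.Closed ∧ c.Closed
  | .alloc c => c.Closed
  | .deref c => c.Closed
  | .ite c t f => c.Closed ∧ t.Closed ∧ f.Closed
  | .seq a b => a.Closed ∧ b.Closed
  | .whl c b => c.Closed ∧ b.Closed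
  | .label _ c => c.Closed
  | .brk _ c => c.Closed
  | .tryc c x h => c.Closed ∧ h.ClosedUnder x
  | .tryf c f => c.Closed ∧ f.Closed
  | .throw c => c.Closed
  | .prim _ as => Clo.ClosedList as
def Clo.ClosedList : List (Clo S) → Prop
  | [] => True
  | c :: cs => c.Closed ∧ Clo.ClosedList cs
def Clo.ClosedFields : List (S.Str × Clo S) → Prop
  | [] => True
  | (_, c) :: fs => c.Closed ∧ Clo.ClosedFields fs
end

theorem Clo.unloadList_eq_map (cs : List (Clo S)) : Clo.unloadList cs = cs.map Clo.unload := by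
  induction cs <;> simp_all [Clo.unloadList]

theorem Clo.unloadFields_eq_map (fs : List (S.Str × Clo S)) :
    Clo.unloadFields fs = fs.map fun p => (p.1, p.2.unload) := by
  induction fs <;> simp_all [Clo.unloadFields]

theorem Clo.forceFields_eq_map (fs : List (S.Str × Clo S)) :
    Clo.forceFields fs = fs.map fun p => (p.1, p.2.force) := by
  induction fs <;> simp_all [Clo.forceFields]

theorem Clo.forceEnv_eq_map (ρ : Env S) :
    Clo.forceEnv ρ = ρ.map fun p => (p.1, p.2.force) := by
  induction ρ <;> simp_all [Clo.forceEnv]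

theorem Clo.closedList_iff {cs : List (Clo S)} : Clo.ClosedList cs ↔ ∀ c ∈ cs, c.Closed := by
  induction cs <;> simp_all [Clo.ClosedList]

theorem Clo.closedFields_iff {fs : List (S.Str × Clo S)} :
    Clo.ClosedFields fs ↔ ∀ p ∈ fs, p.2.Closed := by
  induction fs with
  | nil => simp [Clo.ClosedFields]
  | cons p fs ih => obtain ⟨s, c⟩ := p; simp only [Clo.ClosedFields, ih, List.forall_mem_cons]

theorem assoc_forceEnv (ρ : Env S) (x : S.Var) :
    assoc (Clo.forceEnv ρ) x = (ρ.lookup x).map Clo.force := by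
  induction ρ with
  | nil => rfl
  | cons p ρ ih =>
    obtain ⟨y, c⟩ := p
    simp only [assoc, Clo.forceEnv, List.lookup] at ih ⊢
    split <;> simp_all

theorem Clo.IsClosedValue.isValue {v : Clo S} (hv : v.IsClosedValue) : v.IsValue := by
  induction hv with
  | const k => exact .const k
  | func xs e ρ _ _ ih => exact .func xs e ρ ih
  | record fs _ ih => exact .record fs ih

theorem Clo.IsClosedValue.closed {v : Clo S} (hv : v.IsClosedValue) : v.Closed := by
  induction hv with
  | const k => trivial
  | func xs e ρ hd h _ => exact ⟨hd, h⟩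
  | record fs _ ih => exact Clo.closedFields_iff.2 ih

theorem Clo.IsValue.isClosedValue {v : Clo S} (hv : v.IsValue) (hc : v.Closed) :
    v.IsClosedValue := by
  induction hv with
  | const k => exact .const k
  | func xs e ρ _ _ => exact .func xs e ρ hc.1 hc.2
  | record fs _ ih => exact .record fs fun p hp => ih p hp (Clo.closedFields_iff.1 hc p hp)

/-- `unload` follows all closure formers, whereas `force` has dummy values outside constants, pairs
and records. On values the dummies never occur. -/
theorem Clo.IsValue.unload_eq_force {v : Clo S} (hv : v.IsValue) : v.unload = v.force := by
  induction hv with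
  | const k => rfl
  | func xs e ρ _ _ => rfl
  | record fs _ ih =>
    simp only [Clo.unload, Clo.force, Clo.unloadFields_eq_map, Clo.forceFields_eq_map]
    congr 1
    exact List.map_congr_left fun p hp => by rw [ih p hp]

theorem Clo.IsValue.unload_isValue {v : Clo S} (hv : v.IsValue) : v.unload.IsValue := by
  induction hv with
  | const k => exact .const k
  | func xs e ρ _ _ => exact .func _ _
  | record fs _ ih =>
    rw [Clo.unload, Clo.unloadFields_eq_map]
    refine .record _ fun p hp => ?_
    obtain ⟨q, hq, rfl⟩ := List.mem_map.1 hp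
    exact ih q hq

theorem Clo.IsClosedValue.unload_eq_force {v : Clo S} (hv : v.IsClosedValue) :
    v.unload = v.force := hv.isValue.unload_eq_force

theorem Clo.map_unload_eq_map_force {vs : List (Clo S)} (hvs : ∀ v ∈ vs, v.IsValue) :
    vs.map Clo.unload = vs.map Clo.force :=
  List.map_congr_left fun v hv => (hvs v hv).unload_eq_force

/-- By induction the forced environment is a closed substitution. It is defined on all free
variables of the function, so `Expr.fv_subst` leaves none. -/
theorem Clo.IsClosedValue.force_closed {v : Clo S} (hv : v.IsClosedValue) : v.force.Closed := by
  induction hv with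
  | const k => rfl
  | func xs e ρ hd h ih =>
    refine Set.eq_empty_of_forall_notMem fun x hx => ?_
    have hθ : ClosedSubst (assoc (Clo.forceEnv ρ)) := by
      intro y t hy
      rw [assoc_forceEnv, Option.map_eq_some_iff] at hy
      obtain ⟨c, hc, rfl⟩ := hy
      exact ih (y, c) (exists_of_lookup_eq_some hc)
    obtain ⟨h1, h2⟩ := Expr.fv_subst _ _ hθ x hx
    obtain ⟨p, hp, rfl⟩ := hd x h1
    rw [assoc_forceEnv, Option.map_eq_none_iff] at h2
    exact lookup_ne_none hp h2
  | record fs _ ih =>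
    refine Set.eq_empty_of_forall_notMem fun x hx => ?_
    simp only [Clo.force, Clo.forceFields_eq_map, Expr.fv, Expr.mem_fvFields] at hx
    obtain ⟨p, hp, hx⟩ := hx
    obtain ⟨q, hq, rfl⟩ := List.mem_map.1 hp
    have := ih q hq
    simp only at hx
    rw [this] at hx
    exact hx

theorem closedSubst_forceEnv {ρ : Env S} (hρ : ∀ p ∈ ρ, p.2.IsClosedValue) :
    ClosedSubst (assoc (Clo.forceEnv ρ)) := by
  intro y t hy
  rw [assoc_forceEnv, Option.map_eq_some_iff] at hy
  obtain ⟨c, hc, rfl⟩ := hy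
  exact (hρ _ (exists_of_lookup_eq_some hc)).force_closed

/-- Extending an environment amounts to substituting the new value. -/
theorem Clo.unloadUnder_subst {e : Expr S} {ρ : Env S} (hρ : ∀ p ∈ ρ, p.2.IsClosedValue)
    (x : S.Var) (v : Clo S) :
    ((Clo.clos e ρ).unloadUnder x).subst (assoc [(x, v.force)]) =
      (Clo.clos e ((x, v) :: ρ)).unload := by
  rw [Clo.unloadUnder, Expr.subst_subst _ _ _ ((closedSubst_forceEnv hρ).hide [x]), assoc_cons_eq,
    Clo.unload]
  congr 1
  funext y
  by_cases h : y = x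
  · simp [h, assoc_forceEnv]
  · have : (y == x) = false := by simpa using h
    simp [h, assoc_forceEnv, List.lookup, this]

/-- The counterpart of `Clo.unloadUnder_subst` for calls. The arguments go in front of `ρ`, where
they shadow it just as hiding the parameters does. -/
theorem Clo.unload_func_subst {xs : List S.Var} {e : Expr S} {ρ : Env S}
    (hρ : ∀ p ∈ ρ, p.2.IsClosedValue) (vs : List (Clo S)) (hlen : xs.length = vs.length) :
    (e.subst (hide (assoc (Clo.forceEnv ρ)) xs)).subst (assoc (xs.zip (vs.map Clo.force))) =
      (Clo.clos e (xs.zip vs ++ ρ)).unload := by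
  rw [Expr.subst_subst _ _ _ ((closedSubst_forceEnv hρ).hide xs),
    assoc_zip_eq _ _ _ (by simpa using hlen), Clo.unload]
  congr 1
  funext y
  have : (xs.zip (vs.map Clo.force)).lookup y = ((xs.zip vs).lookup y).map Clo.force := by
    rw [← assoc_forceEnv, assoc, Clo.forceEnv_eq_map, List.zip_map_right]
    rfl
  rw [assoc_forceEnv, assoc_forceEnv, lookup_append, this, Option.map_or]

/-- All terms of a frame are closed. -/
def Frame.Closed : Frame S (Clo S) → Prop
  | .letin x b => b.ClosedUnder x
  | .appFun as => ∀ a ∈ as, a.Closed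
  | .appArg f vs ts => f.Closed ∧ (∀ v ∈ vs, v.Closed) ∧ ∀ t ∈ ts, t.Closed
  | .record fs _ gs => (∀ p ∈ fs, p.2.Closed) ∧ ∀ p ∈ gs, p.2.Closed
  | .prim _ vs ts => (∀ v ∈ vs, v.Closed) ∧ ∀ t ∈ ts, t.Closed
  | .getObj k => k.Closed
  | .getKey o => o.Closed
  | .putObj k t => k.Closed ∧ t.Closed
  | .putKey o t => o.Closed ∧ t.Closed
  | .putVal o k => o.Closed ∧ k.Closed
  | .delObj k => k.Closed
  | .delKey o => o.Closed
  | .assignLoc t => t.Closed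
  | .assignVal l => l.Closed
  | .ite a b => a.Closed ∧ b.Closed
  | .seq t => t.Closed
  | .tryf f => f.Closed
  | .tryc x h => h.ClosedUnder x
  | _ => True

/-- The frame of expressions denoted by a frame of closures. -/
def Frame.unload : Frame S (Clo S) → Frame S (Expr S)
  | .letin x b => .letin x (b.unloadUnder x)
  | .appFun as => .appFun (as.map Clo.unload)
  | .appArg f vs ts => .appArg f.unload (vs.map Clo.unload) (ts.map Clo.unload)
  | .record fs s gs =>
    .record (fs.map fun p => (p.1, p.2.unload)) s (gs.map fun p => (p.1, p.2.unload))
  | .prim op vs ts => .prim op (vs.map Clo.unload) (ts.map Clo.unload)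
  | .getObj k => .getObj k.unload
  | .getKey o => .getKey o.unload
  | .putObj k t => .putObj k.unload t.unload
  | .putKey o t => .putKey o.unload t.unload
  | .putVal o k => .putVal o.unload k.unload
  | .delObj k => .delObj k.unload
  | .delKey o => .delKey o.unload
  | .alloc => .alloc
  | .deref => .deref
  | .assignLoc t => .assignLoc t.unload
  | .assignVal l => .assignVal l.unload
  | .ite a b => .ite a.unload b.unload
  | .seq t => .seq t.unload
  | .throw => .throw
  | .brk l => .brk l
  | .tryf f => .tryf f.unload
  | .label l => .label l
  | .tryc x h => .tryc x (h.unloadUnder x)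

/-- Unloading is compositional: the denoted context depends on the frame alone, so closures in the
hole can be exchanged without touching it. -/
theorem Rho.unload_plug (f : Frame S (Clo S)) (c : Clo S) :
    (Rho.plug f c).unload = JS.plug f.unload c.unload := by
  cases f <;>
    simp [Rho.plug, JS.plug, Frame.unload, Clo.unload, Clo.unloadList_eq_map,
      Clo.unloadFields_eq_map]

theorem Rho.unload_plugAll (L : List (Frame S (Clo S))) (c : Clo S) :
    (Rho.plugAll L c).unload = JS.plugAll (L.map Frame.unload) c.unload := by
  induction L with
  | nil => rfl
  | cons f L ih => simp [Rho.unload_plug, ih]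

theorem Rho.closed_plug {f : Frame S (Clo S)} {c : Clo S} :
    (Rho.plug f c).Closed ↔ f.Closed ∧ c.Closed := by
  cases f <;>
    simp only [Rho.plug, Frame.Closed, Clo.Closed, Clo.closedList_iff, Clo.closedFields_iff,
      List.forall_mem_append, List.forall_mem_cons] <;> tauto

theorem Rho.closed_plugAll {L : List (Frame S (Clo S))} {c : Clo S} :
    (Rho.plugAll L c).Closed ↔ (∀ f ∈ L, f.Closed) ∧ c.Closed := by
  induction L with
  | nil => simp
  | cons f L ih => simp only [plugAll_cons, Rho.closed_plug, ih, List.forall_mem_cons]; tauto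

theorem Frame.Valid.unload {f : Frame S (Clo S)} (hf : f.Valid Clo.IsValue) :
    f.unload.Valid Expr.IsValue := by
  have key : ∀ {vs : List (Clo S)}, (∀ v ∈ vs, v.IsValue) →
      ∀ v ∈ vs.map Clo.unload, v.IsValue := by
    intro vs h v hv
    obtain ⟨w, hw, rfl⟩ := List.mem_map.1 hv
    exact (h w hw).unload_isValue
  cases f with
  | appArg f vs ts => exact ⟨hf.1.unload_isValue, key hf.2⟩
  | record fs s gs =>
    intro p hp
    obtain ⟨q, hq, rfl⟩ := List.mem_map.1 hp
    exact (hf q hq).unload_isValue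
  | prim op vs ts => exact key hf
  | getKey o => exact hf.unload_isValue
  | putKey o t => exact hf.unload_isValue
  | putVal o k => exact ⟨hf.1.unload_isValue, hf.2.unload_isValue⟩
  | delKey o => exact hf.unload_isValue
  | assignVal l => exact hf.unload_isValue
  | _ => trivial

theorem Frame.IsLocal.unload {f : Frame S (Clo S)} (hf : f.IsLocal) : f.unload.IsLocal := by
  cases f <;> trivial

theorem Frame.valid_map_unload {L : List (Frame S (Clo S))} (hL : ∀ f ∈ L, f.Valid Clo.IsValue) :
    ∀ f ∈ L.map Frame.unload, f.Valid Expr.IsValue := by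
  intro f hf
  obtain ⟨g, hg, rfl⟩ := List.mem_map.1 hf
  exact (hL g hg).unload

theorem Frame.local_map_unload {L : List (Frame S (Clo S))}
    (hL : ∀ f ∈ L, f.Valid Clo.IsValue ∧ f.IsLocal) :
    ∀ f ∈ L.map Frame.unload, f.Valid Expr.IsValue ∧ f.IsLocal := by
  intro f hf
  obtain ⟨g, hg, rfl⟩ := List.mem_map.1 hf
  exact ⟨(hL g hg).1.unload, (hL g hg).2.unload⟩

/-! ## Reductions of closures preserve closedness -/

theorem EnvFor.cons {ρ : Env S} {X : Set S.Var} {x : S.Var} {v : Clo S}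
    (hρ : EnvFor ρ (X \ {x})) (hv : v.IsClosedValue) : EnvFor ((x, v) :: ρ) X := by
  refine ⟨fun y hy => ?_, List.forall_mem_cons.2 ⟨hv, hρ.2⟩⟩
  by_cases h : y = x
  · exact ⟨_, List.mem_cons_self, h.symm⟩
  · obtain ⟨p, hp, rfl⟩ := hρ.1 y ⟨hy, h⟩
    exact ⟨p, List.mem_cons_of_mem _ hp, rfl⟩

theorem EnvFor.zip_append {ρ : Env S} {X : Set S.Var} {xs : List S.Var} {vs : List (Clo S)}
    (hρ : EnvFor ρ (X \ {x | x ∈ xs})) (hvs : ∀ v ∈ vs, v.IsClosedValue)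
    (hlen : xs.length = vs.length) : EnvFor (xs.zip vs ++ ρ) X := by
  refine ⟨fun y hy => ?_, List.forall_mem_append.2 ⟨fun p hp => hvs _ (List.of_mem_zip hp).2, hρ.2⟩⟩
  by_cases h : y ∈ xs
  · rw [← List.map_fst_zip hlen.le] at h
    obtain ⟨p, hp, rfl⟩ := List.mem_map.1 h
    exact ⟨p, List.mem_append_left _ hp, rfl⟩
  · obtain ⟨p, hp, rfl⟩ := hρ.1 y ⟨hy, h⟩
    exact ⟨p, List.mem_append_right _ hp, rfl⟩

theorem EnvFor.mono {ρ : Env S} {X Y : Set S.Var} (hρ : EnvFor ρ X) (h : Y ⊆ X) : EnvFor ρ Y :=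
  ⟨fun y hy => hρ.1 y (h hy), hρ.2⟩

namespace Rho

theorem Propagate.closed {c c' : Clo S} (h : Propagate c c') (hc : c.Closed) : c'.Closed := by
  cases h with
  | const => trivial
  | record fs ρ =>
    rw [Clo.Closed, Clo.closedFields_iff]
    intro p hp
    obtain ⟨q, hq, rfl⟩ := List.mem_map.1 hp
    exact EnvFor.mono hc fun x hx => Expr.mem_fvFields.2 ⟨q, hq, hx⟩
  | app f as ρ =>
    rw [Clo.Closed, Clo.closedList_iff]
    refine ⟨EnvFor.mono hc Set.subset_union_left, fun p hp => ?_⟩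
    obtain ⟨q, hq, rfl⟩ := List.mem_map.1 hp
    exact EnvFor.mono hc fun x hx => .inr (Expr.mem_fvList.2 ⟨q, hq, hx⟩)
  | prim op as ρ =>
    rw [Clo.Closed, Clo.closedList_iff]
    intro p hp
    obtain ⟨q, hq, rfl⟩ := List.mem_map.1 hp
    exact EnvFor.mono hc fun x hx => Expr.mem_fvList.2 ⟨q, hq, hx⟩
  | _ =>
    simp only [Clo.Closed, Clo.ClosedUnder, Expr.fv] at hc ⊢
    first
      | exact hc
      | exact ⟨hc.mono fun x hx => by simp_all, hc.mono fun x hx => by simp_all⟩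
      | exact ⟨hc.mono fun x hx => by simp_all, hc.mono fun x hx => by simp_all,
          hc.mono fun x hx => by simp_all⟩

/-- Substitution commutes with every constructor, and `unloadUnder` hides the bound variable exactly
as `Expr.subst` does under a binder. -/
theorem Propagate.unload_eq {c c' : Clo S} (h : Propagate c c') : c'.unload = c.unload := by
  cases h <;>
    simp [Clo.unload, Clo.unloadUnder, Expr.subst, Clo.unloadList_eq_map, Clo.unloadFields_eq_map,
      Expr.substList_eq_map, Expr.substFields_eq_map, Function.comp_def]

/-- New environments are made of values already present in the closure, and only primitive
operations create other values; for these the hypothesis on `δρ` is used. -/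
theorem Red.closed {δρ : S.Op → List (Clo S) → Option (Clo S)}
    (hclosed : ∀ (op : S.Op) (vs : List (Clo S)) (v : Clo S),
      (∀ v ∈ vs, v.IsClosedValue) → δρ op vs = some v → v.IsClosedValue)
    {c c' : Clo S} (h : Red δρ c c') (hc : c.Closed) : c'.Closed := by
  cases h with
  | var x ρ v hx => exact (hc.2 _ (exists_of_lookup_eq_some hx)).closed
  | letin x v e ρ hv => exact EnvFor.cons hc.2 (hv.isClosedValue hc.1)
  | app xs e ρ vs hvs hlen =>
    exact EnvFor.zip_append hc.1
      (fun v hv => (hvs v hv).isClosedValue (Clo.closedList_iff.1 hc.2 v hv)) hlen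
  | prim op vs v hvs hδ =>
    exact (hclosed op vs _
      (fun v hv => (hvs v hv).isClosedValue (Clo.closedList_iff.1 hc v hv)) hδ).closed
  | _ =>
    simp only [raise, Clo.Closed, Clo.closedFields_iff, List.forall_mem_append,
      List.forall_mem_cons] at hc ⊢ <;> tauto

/-- A reduction of closures is a reduction of the denoted expressions, or invisible there. -/
theorem Red.unload {δ : S.Op → List (Expr S) → Option (Expr S)}
    {δρ : S.Op → List (Clo S) → Option (Clo S)}
    (hδ : ∀ (op : S.Op) (vs : List (Clo S)), (∀ v ∈ vs, v.IsClosedValue) →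
      δ op (vs.map Clo.force) = (δρ op vs).map Clo.force)
    (hclosed : ∀ (op : S.Op) (vs : List (Clo S)) (v : Clo S),
      (∀ v ∈ vs, v.IsClosedValue) → δρ op vs = some v → v.IsClosedValue)
    {c c' : Clo S} (h : Red δρ c c') (hc : c.Closed) :
    c'.unload = c.unload ∨ JS.Red δ c.unload c'.unload := by
  have hvals : ∀ {vs : List (Clo S)}, (∀ v ∈ vs, v.IsValue) →
      ∀ v ∈ vs.map Clo.unload, v.IsValue := by
    intro vs h v hv
    obtain ⟨w, hw, rfl⟩ := List.mem_map.1 hv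
    exact (h w hw).unload_isValue
  -- Conditions for run-time errors survive unloading because a value denotes a record or a constant
  -- only if it is one.
  have hrec : ∀ {o k : Clo S}, o.IsValue → k.IsValue →
      (¬ ∃ fs s, o = .record fs ∧ k = .const (.str s)) →
      ¬ ∃ fs s, o.unload = .record fs ∧ k.unload = .const (.str s) := by
    rintro o k ho hk hn ⟨fs, s, h1, h2⟩
    cases ho <;> simp only [Clo.unload, Expr.subst, reduceCtorEq] at h1
    cases hk <;> simp only [Clo.unload, Expr.subst, reduceCtorEq, Expr.const.injEq] at h2
    exact hn ⟨_, s, rfl, by rw [h2]⟩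
  have haddr : ∀ {v : Clo S}, v.IsValue → (¬ ∃ a, v = .const (.addr a)) →
      ¬ ∃ a, v.unload = .const (.addr a) := by
    rintro v hv hn ⟨a, h⟩
    cases hv <;> simp only [Clo.unload, Expr.subst, reduceCtorEq, Expr.const.injEq] at h
    exact hn ⟨a, by rw [h]⟩
  cases h with
  | var x ρ v hx =>
    left
    -- A lookup is invisible: the unloaded variable is already the forced value.
    have hv := hc.2 _ (exists_of_lookup_eq_some hx)
    simp [Clo.unload, Expr.subst, assoc_forceEnv, hx, hv.unload_eq_force]
  | letin x v e ρ hv =>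
    right
    -- Read from right to left, environment extension becomes the substitution that the rule of
    -- `λ_JS` performs.
    rw [← Clo.unloadUnder_subst hc.2.2, ← hv.unload_eq_force]
    exact .letin x _ _ hv.unload_isValue
  | app xs e ρ vs hvs hlen =>
    right
    rw [← Clo.unload_func_subst hc.1.2 vs hlen, ← Clo.map_unload_eq_map_force hvs, Clo.unload,
      Clo.unloadList_eq_map]
    exact .app xs _ _ (hvals hvs) (by simpa using hlen)
  | getHit fs gs s v hr =>
    right
    have := hr.unload_isValue
    simp only [Clo.unload, Clo.unloadFields_eq_map, List.map_append, List.map_cons] at this ⊢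
    exact .getHit _ _ s _ this
  | getMiss fs s hr hs =>
    right
    have := hr.unload_isValue
    simp only [Clo.unload, Clo.unloadFields_eq_map] at this ⊢
    exact .getMiss _ s this (by simpa using hs)
  | putHit fs gs s u v hr hv =>
    right
    have := hr.unload_isValue
    simp only [Clo.unload, Clo.unloadFields_eq_map, List.map_append, List.map_cons] at this ⊢
    exact .putHit _ _ s _ _ this hv.unload_isValue
  | putMiss fs s v hr hv hs =>
    right
    have := hr.unload_isValue
    simp only [Clo.unload, Clo.unloadFields_eq_map, List.map_cons] at this ⊢
    exact .putMiss _ s _ this hv.unload_isValue (by simpa using hs)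
  | delHit fs gs s u hr =>
    right
    have := hr.unload_isValue
    simp only [Clo.unload, Clo.unloadFields_eq_map, List.map_append, List.map_cons] at this ⊢
    exact .delHit _ _ s _ this
  | delMiss fs s hr hs =>
    right
    have := hr.unload_isValue
    simp only [Clo.unload, Clo.unloadFields_eq_map] at this ⊢
    exact .delMiss _ s this (by simpa using hs)
  | iteTrue a b => exact .inr (.iteTrue _ _)
  | iteFalse a b => exact .inr (.iteFalse _ _)
  | seq v c hv => exact .inr (.seq _ _ hv.unload_isValue)
  | whl a b => exact .inr (.whl _ _)
  | tryc v x h hv => exact .inr (.tryc _ x _ hv.unload_isValue)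
  | tryf v c hv => exact .inr (.tryf _ _ hv.unload_isValue)
  | label l v hv => exact .inr (.label l _ hv.unload_isValue)
  | prim op vs v hvs h =>
    right
    have hcv : ∀ v ∈ vs, v.IsClosedValue :=
      fun v hv => (hvs v hv).isClosedValue (Clo.closedList_iff.1 hc v hv)
    rw [Clo.unload, Clo.unloadList_eq_map]
    refine .prim op _ _ (hvals hvs) ?_
    rw [Clo.map_unload_eq_map_force hvs, hδ op vs hcv, h,
      (hclosed op vs _ hcv h).unload_eq_force]
    rfl
  | badPrim op vs hvs h =>
    right
    have hcv : ∀ v ∈ vs, v.IsClosedValue :=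
      fun v hv => (hvs v hv).isClosedValue (Clo.closedList_iff.1 hc v hv)
    rw [Clo.unload, Clo.unloadList_eq_map]
    refine .badPrim op _ (hvals hvs) ?_
    rw [Clo.map_unload_eq_map_force hvs, hδ op vs hcv, h]
    rfl
  | badCall f vs hf hvs hbad =>
    right
    rw [Clo.unload, Clo.unloadList_eq_map]
    refine .badCall _ _ hf.unload_isValue (hvals hvs) ?_
    rintro ⟨xs, e, h1, h2⟩
    -- The only values that denote functions are pairs, and substitution keeps the parameter list,
    -- so the arities agree.
    cases hf <;> simp only [Clo.unload, Expr.subst, reduceCtorEq, Expr.func.injEq] at h1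
    exact hbad ⟨_, _, _, rfl, by rw [h1.1, h2, List.length_map]⟩
  | badIndex o k ho hk hbad =>
    exact .inr (.badIndex _ _ ho.unload_isValue hk.unload_isValue (hrec ho hk hbad))
  | badUpdate o k v ho hk hv hbad =>
    exact .inr (.badUpdate _ _ _ ho.unload_isValue hk.unload_isValue hv.unload_isValue
      (hrec ho hk hbad))
  | badDelete o k ho hk hbad =>
    exact .inr (.badDelete _ _ ho.unload_isValue hk.unload_isValue (hrec ho hk hbad))
  | badCondition v a b hv hbad =>
    refine .inr (.badCondition _ _ _ hv.unload_isValue ?_)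
    rintro ⟨t, h⟩
    cases hv <;> simp only [Clo.unload, Expr.subst, reduceCtorEq, Expr.const.injEq] at h
    exact hbad ⟨t, by rw [h]⟩
  | badDeref v hv hbad => exact .inr (.badDeref _ hv.unload_isValue (haddr hv hbad))
  | badAssign u v hu hv hbad =>
    exact .inr (.badAssign _ _ hu.unload_isValue hv.unload_isValue (haddr hu hbad))

end Rho

/-! ## States -/

/-- The stored values and the outcome of a state are closed. -/
def ClosedState (s : State S (Clo S)) : Prop :=
  (∀ a v, s.1 a = some v → v.IsClosedValue) ∧
    match s.2 with
    | .run c => c.Closed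
    | .err v => v.IsClosedValue

/-- The state of `λ_JS` denoted by a state of `λρ_JS`. -/
def unloadState (s : State S (Clo S)) : State S (Expr S) :=
  (fun a => (s.1 a).map Clo.force,
    match s.2 with
    | .run c => .run c.unload
    | .err c => .err c.force)

theorem closed_update {σ : Store S (Clo S)} (hσ : ∀ a v, σ a = some v → v.IsClosedValue)
    {v : Clo S} (hv : v.IsClosedValue) (b : S.Addr) :
    ∀ a w, Function.update σ b (some v) a = some w → w.IsClosedValue := by
  intro a w h
  by_cases hab : a = b
  · subst hab; simp only [Function.update_self, Option.some.injEq] at h; exact h ▸ hv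
  · rw [Function.update_of_ne hab] at h; exact hσ a w h

theorem map_update (σ : Store S (Clo S)) (v : Clo S) (b : S.Addr) :
    (fun a => (Function.update σ b (some v) a).map Clo.force) =
      Function.update (fun a => (σ a).map Clo.force) b (some v.force) := by
  funext a
  by_cases hab : a = b
  · subst hab; simp
  · simp [Function.update_of_ne hab]

-- From `λρ_JS` to `λ_JS`

namespace Rho

/-- A filled context is closed exactly when its frames and its content are, so each rule is checked
on the part that it rewrites. -/
theorem Step.closed {δρ : S.Op → List (Clo S) → Option (Clo S)}
    (hclosed : ∀ (op : S.Op) (vs : List (Clo S)) (v : Clo S),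
      (∀ v ∈ vs, v.IsClosedValue) → δρ op vs = some v → v.IsClosedValue)
    {s s' : State S (Clo S)} (h : Step δρ s s') (hs : ClosedState s) : ClosedState s' := by
  obtain ⟨hσ, hc⟩ := hs
  cases h with
  | ctx σ hE h =>
    obtain ⟨L, -, rfl⟩ := hE.exists_frames
    obtain ⟨hL, hc⟩ := closed_plugAll.1 hc
    exact ⟨hσ, closed_plugAll.2 ⟨hL, h.closed hclosed hc⟩⟩
  | propagate σ hE h =>
    obtain ⟨L, -, rfl⟩ := hE.exists_frames
    obtain ⟨hL, hc⟩ := closed_plugAll.1 hc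
    exact ⟨hσ, closed_plugAll.2 ⟨hL, h.closed hc⟩⟩
  | alloc σ hE v hv a ha =>
    obtain ⟨L, -, rfl⟩ := hE.exists_frames
    obtain ⟨hL, hc⟩ := closed_plugAll.1 hc
    exact ⟨closed_update hσ (hv.isClosedValue hc) a, closed_plugAll.2 ⟨hL, trivial⟩⟩
  | deref σ hE a v ha =>
    obtain ⟨L, -, rfl⟩ := hE.exists_frames
    obtain ⟨hL, hc⟩ := closed_plugAll.1 hc
    exact ⟨hσ, closed_plugAll.2 ⟨hL, (hσ a v ha).closed⟩⟩
  | derefDangling σ hE a ha =>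
    obtain ⟨L, -, rfl⟩ := hE.exists_frames
    obtain ⟨hL, hc⟩ := closed_plugAll.1 hc
    exact ⟨hσ, closed_plugAll.2 ⟨hL, trivial⟩⟩
  | assign σ hE a v hv =>
    obtain ⟨L, -, rfl⟩ := hE.exists_frames
    obtain ⟨hL, hc⟩ := closed_plugAll.1 hc
    exact ⟨closed_update hσ (hv.isClosedValue hc.2) a, closed_plugAll.2 ⟨hL, hc.2⟩⟩
  | uncaught σ hC v hv =>
    obtain ⟨L, -, rfl⟩ := hC.exists_frames
    obtain ⟨hL, hc⟩ := closed_plugAll.1 hc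
    exact ⟨hσ, hv.isClosedValue hc⟩
  | throwCatch σ hE hC v hv x e ρ =>
    obtain ⟨L, -, rfl⟩ := hE.exists_frames
    obtain ⟨M, -, rfl⟩ := hC.exists_frames
    obtain ⟨hL, hc, hρ⟩ := closed_plugAll.1 hc
    obtain ⟨hM, hc⟩ := closed_plugAll.1 hc
    exact ⟨hσ, closed_plugAll.2 ⟨hL, EnvFor.cons hρ (hv.isClosedValue hc)⟩⟩
  | throwFinally σ hE hC v hv c =>
    obtain ⟨L, -, rfl⟩ := hE.exists_frames
    obtain ⟨M, -, rfl⟩ := hC.exists_frames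
    obtain ⟨hL, hc, hf⟩ := closed_plugAll.1 hc
    obtain ⟨hM, hc⟩ := closed_plugAll.1 hc
    exact ⟨hσ, closed_plugAll.2 ⟨hL, hf, hc⟩⟩
  | throwLabel σ hE hC v hv l =>
    obtain ⟨L, -, rfl⟩ := hE.exists_frames
    obtain ⟨M, -, rfl⟩ := hC.exists_frames
    obtain ⟨hL, hc⟩ := closed_plugAll.1 hc
    obtain ⟨hM, hc⟩ := closed_plugAll.1 hc
    exact ⟨hσ, closed_plugAll.2 ⟨hL, hc⟩⟩
  | breakCatch σ hE hC l v hv x c =>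
    obtain ⟨L, -, rfl⟩ := hE.exists_frames
    obtain ⟨M, -, rfl⟩ := hC.exists_frames
    obtain ⟨hL, hc, -⟩ := closed_plugAll.1 hc
    obtain ⟨hM, hc⟩ := closed_plugAll.1 hc
    exact ⟨hσ, closed_plugAll.2 ⟨hL, hc⟩⟩
  | breakFinally σ hE hC l v hv c =>
    obtain ⟨L, -, rfl⟩ := hE.exists_frames
    obtain ⟨M, -, rfl⟩ := hC.exists_frames
    obtain ⟨hL, hc, hf⟩ := closed_plugAll.1 hc
    obtain ⟨hM, hc⟩ := closed_plugAll.1 hc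
    exact ⟨hσ, closed_plugAll.2 ⟨hL, hf, hc⟩⟩
  | breakLabel σ hE hC l v hv =>
    obtain ⟨L, -, rfl⟩ := hE.exists_frames
    obtain ⟨M, -, rfl⟩ := hC.exists_frames
    obtain ⟨hL, hc⟩ := closed_plugAll.1 hc
    obtain ⟨hM, hc⟩ := closed_plugAll.1 hc
    exact ⟨hσ, closed_plugAll.2 ⟨hL, hc⟩⟩
  | breakOther σ hE hC l l' hl v hv =>
    obtain ⟨L, -, rfl⟩ := hE.exists_frames
    obtain ⟨M, -, rfl⟩ := hC.exists_frames
    obtain ⟨hL, hc⟩ := closed_plugAll.1 hc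
    obtain ⟨hM, hc⟩ := closed_plugAll.1 hc
    exact ⟨hσ, closed_plugAll.2 ⟨hL, hc⟩⟩
  | breakUnbound σ hC l v hv => exact ⟨hσ, trivial⟩

theorem closedState_of_reaches {δρ : S.Op → List (Clo S) → Option (Clo S)}
    (hclosed : ∀ (op : S.Op) (vs : List (Clo S)) (v : Clo S),
      (∀ v ∈ vs, v.IsClosedValue) → δρ op vs = some v → v.IsClosedValue)
    {s s' : State S (Clo S)} (h : Relation.ReflTransGen (Step δρ) s s') (hs : ClosedState s) :
    ClosedState s' := by
  induction h with
  | refl => exact hs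
  | tail _ h ih => exact h.closed hclosed ih

/-- If the result of a step of `λρ_JS` denotes a state of `λ_JS` from which an answer is reached,
then so does its source. -/
theorem Step.reaches_answer {δ : S.Op → List (Expr S) → Option (Expr S)}
    {δρ : S.Op → List (Clo S) → Option (Clo S)}
    (hδ : ∀ (op : S.Op) (vs : List (Clo S)), (∀ v ∈ vs, v.IsClosedValue) →
      δ op (vs.map Clo.force) = (δρ op vs).map Clo.force)
    (hclosed : ∀ (op : S.Op) (vs : List (Clo S)) (v : Clo S),
      (∀ v ∈ vs, v.IsClosedValue) → δρ op vs = some v → v.IsClosedValue)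
    {s s' : State S (Clo S)} {A : State S (Expr S)} (hA : IsAnswer Expr.IsValue A)
    (h : Step δρ s s') (hs : ClosedState s)
    (h' : Relation.ReflTransGen (JS.Step δ) (unloadState s') A) :
    Relation.ReflTransGen (JS.Step δ) (unloadState s) A := by
  obtain ⟨hσ, hc⟩ := hs
  cases h with
  | ctx σ hE h =>
    obtain ⟨L, hL, rfl⟩ := hE.exists_frames
    obtain ⟨-, hc⟩ := closed_plugAll.1 hc
    simp only [unloadState, unload_plugAll] at h' ⊢
    rcases h.unload hδ hclosed hc with heq | h
    -- A lookup of a variable costs no step in `λ_JS`.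
    · rwa [heq] at h'
    · exact .head (.ctx _ (JS.evalCtx_plugAll (Frame.valid_map_unload hL)) h) h'
  | propagate σ hE h =>
    obtain ⟨L, hL, rfl⟩ := hE.exists_frames
    simpa only [unloadState, unload_plugAll, h.unload_eq] using h'
  | alloc σ hE v hv a ha =>
    obtain ⟨L, hL, rfl⟩ := hE.exists_frames
    simp only [unloadState, unload_plugAll, map_update, Clo.unload] at h' ⊢
    -- Forcing the stored values keeps the domain of the store, so `a` is fresh on both sides.
    refine .head (.alloc _ (JS.evalCtx_plugAll (Frame.valid_map_unload hL)) _ hv.unload_isValue a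
      (by simp [ha])) ?_
    rwa [hv.unload_eq_force]
  | deref σ hE a v ha =>
    obtain ⟨L, hL, rfl⟩ := hE.exists_frames
    simp only [unloadState, unload_plugAll, Clo.unload] at h' ⊢
    refine .head (.deref _ (JS.evalCtx_plugAll (Frame.valid_map_unload hL)) a v.unload ?_) h'
    simp [ha, (hσ a v ha).unload_eq_force]
  | derefDangling σ hE a ha =>
    obtain ⟨L, hL, rfl⟩ := hE.exists_frames
    simp only [unloadState, unload_plugAll, Clo.unload] at h' ⊢
    exact .head (.derefDangling _ (JS.evalCtx_plugAll (Frame.valid_map_unload hL)) a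
      (by simp [ha])) h'
  | assign σ hE a v hv =>
    obtain ⟨L, hL, rfl⟩ := hE.exists_frames
    simp only [unloadState, unload_plugAll, map_update, Clo.unload] at h' ⊢
    refine .head (.assign _ (JS.evalCtx_plugAll (Frame.valid_map_unload hL)) a _
      hv.unload_isValue) ?_
    rwa [← hv.unload_eq_force] at h'
  | uncaught σ hC v hv =>
    obtain ⟨L, hL, rfl⟩ := hC.exists_frames
    simp only [unloadState, unload_plugAll, Clo.unload, ← hv.unload_eq_force] at h' ⊢
    refine .head (.uncaught _ (JS.labelCtx_plugAll fun f hf => ?_) _ hv.unload_isValue) h'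
    exact ⟨(Frame.local_map_unload hL f hf).1, (Frame.local_map_unload hL f hf).2.passesThrow⟩
  | throwCatch σ hE hC v hv x e ρ =>
    obtain ⟨L, hL, rfl⟩ := hE.exists_frames
    obtain ⟨M, hM, rfl⟩ := hC.exists_frames
    obtain ⟨-, -, hρ⟩ := closed_plugAll.1 hc
    simp only [unloadState, unload_plugAll] at h' ⊢
    rw [← Clo.unloadUnder_subst hρ.2, ← hv.unload_eq_force] at h'
    simp only [Clo.unload, unload_plugAll]
    refine .head (.throwCatch _ (JS.evalCtx_plugAll (Frame.valid_map_unload hL))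
      (JS.labelCtx_plugAll fun f hf => ?_) _ hv.unload_isValue x _) h'
    exact ⟨(Frame.local_map_unload hM f hf).1, (Frame.local_map_unload hM f hf).2.passesThrow⟩
  | throwFinally σ hE hC v hv c =>
    obtain ⟨L, hL, rfl⟩ := hE.exists_frames
    obtain ⟨M, hM, rfl⟩ := hC.exists_frames
    simp only [unloadState, unload_plugAll, Clo.unload] at h' ⊢
    refine .head (.throwFinally _ (JS.evalCtx_plugAll (Frame.valid_map_unload hL))
      (JS.labelCtx_plugAll fun f hf => ?_) _ hv.unload_isValue _) h'
    exact ⟨(Frame.local_map_unload hM f hf).1, (Frame.local_map_unload hM f hf).2.passesThrow⟩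
  | throwLabel σ hE hC v hv l =>
    obtain ⟨L, hL, rfl⟩ := hE.exists_frames
    obtain ⟨M, hM, rfl⟩ := hC.exists_frames
    simp only [unloadState, unload_plugAll, Clo.unload] at h' ⊢
    -- `λ_JS` has no rule that removes just the label. The first step after the removal is replayed
    -- with the label and the frames inside it still in place.
    refine JS.reaches_answer_insert (by rintro ⟨⟩) (fun s hs => ?_) hA h'
    refine hs.insert_throw (M := .label l :: M.map Frame.unload) (Frame.valid_map_unload hL)
      (List.forall_mem_cons.2 ⟨⟨trivial, trivial⟩, fun f hf => ?_⟩) hv.unload_isValue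
    exact ⟨(Frame.local_map_unload hM f hf).1, (Frame.local_map_unload hM f hf).2.passesThrow⟩
  | breakCatch σ hE hC l v hv x c =>
    obtain ⟨L, hL, rfl⟩ := hE.exists_frames
    obtain ⟨M, hM, rfl⟩ := hC.exists_frames
    simp only [unloadState, unload_plugAll, Clo.unload] at h' ⊢
    -- As for a label around a `throw`, now with the handler and the frames inside it around a
    -- `break`.
    refine JS.reaches_answer_insert (by rintro ⟨⟩) (fun s hs => ?_) hA h'
    refine hs.insert_break (M := .tryc x (c.unloadUnder x) :: M.map Frame.unload)
      (Frame.valid_map_unload hL)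
      (List.forall_mem_cons.2 ⟨⟨trivial, trivial⟩, fun f hf => ?_⟩) hv.unload_isValue
    exact ⟨(Frame.local_map_unload hM f hf).1, (Frame.local_map_unload hM f hf).2.passesBreak⟩
  | breakFinally σ hE hC l v hv c =>
    obtain ⟨L, hL, rfl⟩ := hE.exists_frames
    obtain ⟨M, hM, rfl⟩ := hC.exists_frames
    simp only [unloadState, unload_plugAll, Clo.unload] at h' ⊢
    refine .head (.breakFinally _ (JS.evalCtx_plugAll (Frame.valid_map_unload hL))
      (JS.handlerCtx_plugAll fun f hf => ?_) l _ hv.unload_isValue _) h'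
    exact ⟨(Frame.local_map_unload hM f hf).1, (Frame.local_map_unload hM f hf).2.passesBreak⟩
  | breakLabel σ hE hC l v hv =>
    obtain ⟨L, hL, rfl⟩ := hE.exists_frames
    obtain ⟨M, hM, rfl⟩ := hC.exists_frames
    simp only [unloadState, unload_plugAll, Clo.unload] at h' ⊢
    refine .head (.breakLabel _ (JS.evalCtx_plugAll (Frame.valid_map_unload hL))
      (JS.handlerCtx_plugAll fun f hf => ?_) l _ hv.unload_isValue) h'
    exact ⟨(Frame.local_map_unload hM f hf).1, (Frame.local_map_unload hM f hf).2.passesBreak⟩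
  | breakOther σ hE hC l l' hl v hv =>
    obtain ⟨L, hL, rfl⟩ := hE.exists_frames
    obtain ⟨M, hM, rfl⟩ := hC.exists_frames
    simp only [unloadState, unload_plugAll, Clo.unload] at h' ⊢
    refine .head (.breakOther _ (JS.evalCtx_plugAll (Frame.valid_map_unload hL))
      (JS.handlerCtx_plugAll fun f hf => ?_) l l' hl _ hv.unload_isValue) h'
    exact ⟨(Frame.local_map_unload hM f hf).1, (Frame.local_map_unload hM f hf).2.passesBreak⟩
  | breakUnbound σ hC l v hv =>
    obtain ⟨L, hL, rfl⟩ := hC.exists_frames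
    simp only [unloadState, unload_plugAll, Clo.unload] at h' ⊢
    refine .head (.breakUnbound _ (JS.handlerCtx_plugAll fun f hf => ?_) l _ hv.unload_isValue) h'
    exact ⟨(Frame.local_map_unload hL f hf).1, (Frame.local_map_unload hL f hf).2.passesBreak⟩

end Rho

/-! ## Administrative reductions of closures -/

namespace Rho

/-- A reduction that only propagates environments or looks up variables. -/
def AdminStep (c c' : Clo S) : Prop :=
  ∃ (L : List (Frame S (Clo S))) (r r' : Clo S), (∀ f ∈ L, f.Valid Clo.IsValue) ∧
    (Propagate r r' ∨ ∃ x ρ, r = .clos (.var x) ρ ∧ ρ.lookup x = some r') ∧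
    c = plugAll L r ∧ c' = plugAll L r'

abbrev Admin : Clo S → Clo S → Prop := Relation.ReflTransGen AdminStep

theorem Admin.plug {c c' : Clo S} (h : Admin c c') {f : Frame S (Clo S)}
    (hf : f.Valid Clo.IsValue) : Admin (Rho.plug f c) (Rho.plug f c') := by
  refine h.lift _ fun a b => ?_
  rintro ⟨L, r, r', hL, h, rfl, rfl⟩
  exact ⟨f :: L, r, r', List.forall_mem_cons.2 ⟨hf, hL⟩, h, rfl, rfl⟩

theorem Admin.plugAll {c c' : Clo S} (h : Admin c c') {L : List (Frame S (Clo S))}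
    (hL : ∀ f ∈ L, f.Valid Clo.IsValue) : Admin (Rho.plugAll L c) (Rho.plugAll L c') := by
  induction L with
  | nil => exact h
  | cons f L ih =>
    obtain ⟨hf, hL'⟩ := List.forall_mem_cons.1 hL
    exact (ih hL').plug hf

theorem AdminStep.closed_unload {c c' : Clo S} (h : AdminStep c c') (hc : c.Closed) :
    c'.Closed ∧ c'.unload = c.unload := by
  obtain ⟨L, r, r', -, h, rfl, rfl⟩ := h
  obtain ⟨hL, hc⟩ := closed_plugAll.1 hc
  rw [closed_plugAll, unload_plugAll, unload_plugAll]
  rcases h with h | ⟨x, ρ, rfl, hx⟩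
  · exact ⟨⟨hL, h.closed hc⟩, by rw [h.unload_eq]⟩
  · have hv := hc.2 _ (exists_of_lookup_eq_some hx)
    refine ⟨⟨hL, hv.closed⟩, ?_⟩
    simp [Clo.unload, Expr.subst, assoc_forceEnv, hx, hv.unload_eq_force]

theorem Admin.closed_unload {c c' : Clo S} (h : Admin c c') (hc : c.Closed) :
    c'.Closed ∧ c'.unload = c.unload := by
  induction h with
  | refl => exact ⟨hc, rfl⟩
  | tail _ h ih =>
    obtain ⟨h1, h2⟩ := h.closed_unload ih.1
    exact ⟨h1, h2.trans ih.2⟩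

theorem Propagate.admin {c c' : Clo S} (h : Propagate c c') : Admin c c' :=
  .single ⟨[], c, c', by simp, .inl h, rfl, rfl⟩

theorem Admin.reaches {δρ : S.Op → List (Clo S) → Option (Clo S)} {c c' : Clo S} (h : Admin c c')
    (σ : Store S (Clo S)) : Relation.ReflTransGen (Step δρ) (σ, .run c) (σ, .run c') := by
  refine h.lift (fun c => (σ, Outcome.run c)) fun a b => ?_
  rintro ⟨L, r, r', hL, h | ⟨x, ρ, rfl, hx⟩, rfl, rfl⟩
  · exact .propagate σ (evalCtx_plugAll hL) h
  · exact .ctx σ (evalCtx_plugAll hL) (.var x ρ _ hx)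

/-- Every closed closure reduces administratively to a value or to a closure that is not a pair. -/
theorem exists_admin_head {c : Clo S} (hc : c.Closed) :
    ∃ c', Admin c c' ∧ (c'.IsValue ∨ ∀ e ρ, c' ≠ .clos e ρ) := by
  cases c with
  | clos e ρ =>
    cases e with
    | var x =>
      -- Closedness makes the lookup succeed and return a value, which needs no further propagation.
      obtain ⟨p, hp, rfl⟩ := hc.1 x rfl
      obtain ⟨v, hv⟩ := Option.ne_none_iff_exists'.1 (lookup_ne_none hp)
      exact ⟨v, .single ⟨[], _, v, by simp, .inr ⟨_, ρ, rfl, hv⟩, rfl, rfl⟩,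
        .inl (hc.2 _ (exists_of_lookup_eq_some hv)).isValue⟩
    | func xs e => exact ⟨_, .refl, .inl (.func xs e ρ fun p hp => (hc.2 p hp).isValue)⟩
    | const k => exact ⟨_, (Propagate.const k ρ).admin, .inr nofun⟩
    | record fs => exact ⟨_, (Propagate.record fs ρ).admin, .inr nofun⟩
    | letin x e b => exact ⟨_, (Propagate.letin x e b ρ).admin, .inr nofun⟩
    | app f as => exact ⟨_, (Propagate.app f as ρ).admin, .inr nofun⟩
    | get o k => exact ⟨_, (Propagate.get o k ρ).admin, .inr nofun⟩
    | put o k e => exact ⟨_, (Propagate.put o k e ρ).admin, .inr nofun⟩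
    | del o k => exact ⟨_, (Propagate.del o k ρ).admin, .inr nofun⟩
    | assign l e => exact ⟨_, (Propagate.assign l e ρ).admin, .inr nofun⟩
    | alloc e => exact ⟨_, (Propagate.alloc e ρ).admin, .inr nofun⟩
    | deref e => exact ⟨_, (Propagate.deref e ρ).admin, .inr nofun⟩
    | ite c t f => exact ⟨_, (Propagate.ite c t f ρ).admin, .inr nofun⟩
    | seq a b => exact ⟨_, (Propagate.seq a b ρ).admin, .inr nofun⟩
    | whl a b => exact ⟨_, (Propagate.whl a b ρ).admin, .inr nofun⟩
    | label l e => exact ⟨_, (Propagate.label l e ρ).admin, .inr nofun⟩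
    | brk l e => exact ⟨_, (Propagate.brk l e ρ).admin, .inr nofun⟩
    | tryc e x h => exact ⟨_, (Propagate.tryc e x h ρ).admin, .inr nofun⟩
    | tryf e f => exact ⟨_, (Propagate.tryf e f ρ).admin, .inr nofun⟩
    | throw e => exact ⟨_, (Propagate.throw e ρ).admin, .inr nofun⟩
    | prim op as => exact ⟨_, (Propagate.prim op as ρ).admin, .inr nofun⟩
  | _ => exact ⟨_, .refl, .inr nofun⟩

/-- If all elements of a segment of a list can be evaluated, then they can be evaluated from left
to right. -/
theorem exists_eval_segment {α : Type*} {A : α → α → Prop} {V : α → Prop}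
    {R : List α → List α → Prop} (hrefl : ∀ l, R l l)
    (htrans : ∀ l m n, R l m → R m n → R l n)
    (hR : ∀ vs c c' cs, (∀ v ∈ vs, V v) → A c c' → R (vs ++ c :: cs) (vs ++ c' :: cs))
    (rest : List α) (cs : List α) : ∀ pre : List α, (∀ v ∈ pre, V v) →
      (∀ c ∈ cs, ∃ v, V v ∧ A c v) →
      ∃ vs, (∀ v ∈ vs, V v) ∧ List.Forall₂ A cs vs ∧
        R (pre ++ (cs ++ rest)) (pre ++ (vs ++ rest)) := by
  induction cs with
  | nil => exact fun pre _ _ => ⟨[], by simp, .nil, hrefl _⟩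
  | cons c cs ih =>
    intro pre hd h
    obtain ⟨⟨v, hv, hA⟩, h⟩ := List.forall_mem_cons.1 h
    -- The induction goes from left to right: once evaluated, `v` joins the prefix of values, and
    -- the next element is in evaluation position.
    obtain ⟨vs, hvs, hf, hr⟩ := ih (pre ++ [v])
      (List.forall_mem_append.2 ⟨hd, by simpa using hv⟩) h
    refine ⟨v :: vs, List.forall_mem_cons.2 ⟨hv, hvs⟩, .cons hA hf, ?_⟩
    exact htrans _ _ _ (hR pre c v (cs ++ rest) hd hA) (by simpa using hr)

theorem map_unload_eq_of_forall₂ {cs vs : List (Clo S)} (h : List.Forall₂ Admin cs vs)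
    (hc : ∀ c ∈ cs, c.Closed) : vs.map Clo.unload = cs.map Clo.unload := by
  induction h with
  | nil => rfl
  | cons h _ ih =>
    obtain ⟨h1, h2⟩ := List.forall_mem_cons.1 hc
    simp [ih h2, (h.closed_unload h1).2]

/-- Administrative reduction of the closure in a field. -/
def AdminField (p q : S.Str × Clo S) : Prop := p.1 = q.1 ∧ Admin p.2 q.2

theorem map_unload_eq_of_forall₂_fields {cs vs : List (S.Str × Clo S)}
    (h : List.Forall₂ AdminField cs vs) (hc : ∀ p ∈ cs, p.2.Closed) :
    (vs.map fun p => (p.1, p.2.unload)) = cs.map fun p => (p.1, p.2.unload) := by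
  induction h with
  | nil => rfl
  | cons h _ ih =>
    obtain ⟨h1, h2⟩ := List.forall_mem_cons.1 hc
    simp [ih h2, (h.2.closed_unload h1).2, h.1]

/-- `rest` stays unevaluated. It is empty when a whole record is evaluated, and begins with the
field in the hole when a record frame is exposed. -/
theorem exists_eval_fields (cs rest : List (S.Str × Clo S))
    (h : ∀ p ∈ cs, ∃ v : Clo S, v.IsValue ∧ Admin p.2 v) :
    ∃ vs : List (S.Str × Clo S), (∀ p ∈ vs, p.2.IsValue) ∧ List.Forall₂ AdminField cs vs ∧
      Admin (.record (cs ++ rest)) (.record (vs ++ rest)) := by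
  refine exists_eval_segment (A := AdminField) (V := fun p => p.2.IsValue)
    (R := fun l m => Admin (.record l) (.record m)) (fun _ => .refl)
    (fun _ _ _ h h' => h.trans h') ?_ rest cs [] (by simp) ?_
  · rintro vs ⟨s, c⟩ ⟨_, c'⟩ cs hvs ⟨rfl, h⟩
    exact h.plug (f := .record vs s cs) hvs
  · intro p hp
    obtain ⟨v, hv, hA⟩ := h p hp
    exact ⟨(p.1, v), hv, rfl, hA⟩

/-- A closure that denotes a value reduces administratively to a value. -/
theorem exists_admin_value {w : Expr S} (hw : w.IsValue) :
    ∀ {c : Clo S}, c.Closed → c.unload = w → ∃ v : Clo S, v.IsValue ∧ Admin c v := by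
  induction hw with
  | record fs _ ih =>
    intro c hc hu
    obtain ⟨c', h, hv | hn⟩ := exists_admin_head hc
    · exact ⟨c', hv, h⟩
    obtain ⟨hc', hu'⟩ := h.closed_unload hc
    rw [hu] at hu'
    cases c' with
    | clos e ρ => exact (hn e ρ rfl).elim
    | record cs =>
      simp only [Clo.unload, Clo.unloadFields_eq_map, Expr.record.injEq] at hu'
      subst hu'
      rw [Clo.Closed, Clo.closedFields_iff] at hc'
      obtain ⟨vs, hvs, -, h'⟩ := exists_eval_fields cs [] fun p hp =>
        ih (p.1, p.2.unload) (List.mem_map.2 ⟨p, hp, rfl⟩) (hc' p hp) rfl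
      simp only [List.append_nil] at h'
      exact ⟨_, .record vs hvs, h.trans h'⟩
    | _ => simp [Clo.unload] at hu'
  | _ =>
    intro c hc hu
    obtain ⟨c', h, hv | hn⟩ := exists_admin_head hc
    · exact ⟨c', hv, h⟩
    obtain ⟨hc', hu'⟩ := h.closed_unload hc
    rw [hu] at hu'
    cases c' with
    | clos e ρ => exact (hn e ρ rfl).elim
    -- With pairs excluded, a constant is denoted by a constant only, and a function by nothing.
    | const k => exact ⟨_, .const k, h⟩
    | _ => simp [Clo.unload] at hu'

/-- Apart from pairs, every closure has the head constructor of the expression that it denotes.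
Removing a pair at the head therefore reveals that constructor; since the expression is not a value,
the removal cannot end in a value. -/
theorem exists_admin_not_clos {c : Clo S} (hc : c.Closed) (hu : ¬ c.unload.IsValue) :
    ∃ c', Admin c c' ∧ c'.Closed ∧ c'.unload = c.unload ∧ ∀ e ρ, c' ≠ .clos e ρ := by
  obtain ⟨c', h, h'⟩ := exists_admin_head hc
  obtain ⟨hc', hu'⟩ := h.closed_unload hc
  rcases h' with hv | hn
  · exact (hu (hu' ▸ hv.unload_isValue)).elim
  · exact ⟨c', h, hc', hu', hn⟩

/-- First of a family of inversion lemmas, one for each constructor: the head is exposed by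
administrative reductions, and the components denote the components of the expression. -/
theorem exists_admin_app {c : Clo S} {f' : Expr S} {as' : List (Expr S)} (hc : c.Closed)
    (hu : c.unload = .app f' as') :
    ∃ f as, Admin c (.app f as) ∧
      f.Closed ∧ f.unload = f' ∧
      (∀ c ∈ as, c.Closed) ∧ as.map Clo.unload = as' := by
  obtain ⟨c', h, hc', hu', hn⟩ := exists_admin_not_clos hc (by rw [hu]; rintro ⟨⟩)
  rw [hu] at hu'
  cases c' with
  | clos e ρ => exact (hn e ρ rfl).elim
  | app =>
    simp only [Clo.unload, Clo.unloadList_eq_map, Expr.app.injEq] at hu'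
    obtain ⟨hu_f, hu_as⟩ := hu'
    exact ⟨_, _, h, hc'.1, hu_f, Clo.closedList_iff.1 hc'.2, hu_as⟩
  | _ => simp [Clo.unload] at hu'

theorem exists_admin_get {c : Clo S} {o' : Expr S} {k' : Expr S} (hc : c.Closed)
    (hu : c.unload = .get o' k') :
    ∃ o k, Admin c (.get o k) ∧
      o.Closed ∧ o.unload = o' ∧
      k.Closed ∧ k.unload = k' := by
  obtain ⟨c', h, hc', hu', hn⟩ := exists_admin_not_clos hc (by rw [hu]; rintro ⟨⟩)
  rw [hu] at hu'
  cases c' with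
  | clos e ρ => exact (hn e ρ rfl).elim
  | get =>
    simp only [Clo.unload, Expr.get.injEq] at hu'
    obtain ⟨hu_o, hu_k⟩ := hu'
    exact ⟨_, _, h, hc'.1, hu_o, hc'.2, hu_k⟩
  | _ => simp [Clo.unload] at hu'

theorem exists_admin_put {c : Clo S} {o' : Expr S} {k' : Expr S} {d' : Expr S} (hc : c.Closed)
    (hu : c.unload = .put o' k' d') :
    ∃ o k d, Admin c (.put o k d) ∧
      o.Closed ∧ o.unload = o' ∧
      k.Closed ∧ k.unload = k' ∧
      d.Closed ∧ d.unload = d' := by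
  obtain ⟨c', h, hc', hu', hn⟩ := exists_admin_not_clos hc (by rw [hu]; rintro ⟨⟩)
  rw [hu] at hu'
  cases c' with
  | clos e ρ => exact (hn e ρ rfl).elim
  | put =>
    simp only [Clo.unload, Expr.put.injEq] at hu'
    obtain ⟨hu_o, hu_k, hu_d⟩ := hu'
    exact ⟨_, _, _, h, hc'.1, hu_o, hc'.2.1, hu_k, hc'.2.2, hu_d⟩
  | _ => simp [Clo.unload] at hu'

theorem exists_admin_del {c : Clo S} {o' : Expr S} {k' : Expr S} (hc : c.Closed)
    (hu : c.unload = .del o' k') :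
    ∃ o k, Admin c (.del o k) ∧
      o.Closed ∧ o.unload = o' ∧
      k.Closed ∧ k.unload = k' := by
  obtain ⟨c', h, hc', hu', hn⟩ := exists_admin_not_clos hc (by rw [hu]; rintro ⟨⟩)
  rw [hu] at hu'
  cases c' with
  | clos e ρ => exact (hn e ρ rfl).elim
  | del =>
    simp only [Clo.unload, Expr.del.injEq] at hu'
    obtain ⟨hu_o, hu_k⟩ := hu'
    exact ⟨_, _, h, hc'.1, hu_o, hc'.2, hu_k⟩
  | _ => simp [Clo.unload] at hu'

theorem exists_admin_assign {c : Clo S} {l' : Expr S} {d' : Expr S} (hc : c.Closed)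
    (hu : c.unload = .assign l' d') :
    ∃ l d, Admin c (.assign l d) ∧
      l.Closed ∧ l.unload = l' ∧
      d.Closed ∧ d.unload = d' := by
  obtain ⟨c', h, hc', hu', hn⟩ := exists_admin_not_clos hc (by rw [hu]; rintro ⟨⟩)
  rw [hu] at hu'
  cases c' with
  | clos e ρ => exact (hn e ρ rfl).elim
  | assign =>
    simp only [Clo.unload, Expr.assign.injEq] at hu'
    obtain ⟨hu_l, hu_d⟩ := hu'
    exact ⟨_, _, h, hc'.1, hu_l, hc'.2, hu_d⟩
  | _ => simp [Clo.unload] at hu'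

theorem exists_admin_alloc {c : Clo S} {d' : Expr S} (hc : c.Closed)
    (hu : c.unload = .alloc d') :
    ∃ d, Admin c (.alloc d) ∧
      d.Closed ∧ d.unload = d' := by
  obtain ⟨c', h, hc', hu', hn⟩ := exists_admin_not_clos hc (by rw [hu]; rintro ⟨⟩)
  rw [hu] at hu'
  cases c' with
  | clos e ρ => exact (hn e ρ rfl).elim
  | alloc =>
    simp only [Clo.unload, Expr.alloc.injEq] at hu'
    exact ⟨_, h, hc', hu'⟩
  | _ => simp [Clo.unload] at hu'

theorem exists_admin_deref {c : Clo S} {d' : Expr S} (hc : c.Closed)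
    (hu : c.unload = .deref d') :
    ∃ d, Admin c (.deref d) ∧
      d.Closed ∧ d.unload = d' := by
  obtain ⟨c', h, hc', hu', hn⟩ := exists_admin_not_clos hc (by rw [hu]; rintro ⟨⟩)
  rw [hu] at hu'
  cases c' with
  | clos e ρ => exact (hn e ρ rfl).elim
  | deref =>
    simp only [Clo.unload, Expr.deref.injEq] at hu'
    exact ⟨_, h, hc', hu'⟩
  | _ => simp [Clo.unload] at hu'

theorem exists_admin_ite {c : Clo S} {d' : Expr S} {a' : Expr S} {b' : Expr S} (hc : c.Closed)
    (hu : c.unload = .ite d' a' b') :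
    ∃ d a b, Admin c (.ite d a b) ∧
      d.Closed ∧ d.unload = d' ∧
      a.Closed ∧ a.unload = a' ∧
      b.Closed ∧ b.unload = b' := by
  obtain ⟨c', h, hc', hu', hn⟩ := exists_admin_not_clos hc (by rw [hu]; rintro ⟨⟩)
  rw [hu] at hu'
  cases c' with
  | clos e ρ => exact (hn e ρ rfl).elim
  | ite =>
    simp only [Clo.unload, Expr.ite.injEq] at hu'
    obtain ⟨hu_d, hu_a, hu_b⟩ := hu'
    exact ⟨_, _, _, h, hc'.1, hu_d, hc'.2.1, hu_a, hc'.2.2, hu_b⟩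
  | _ => simp [Clo.unload] at hu'

theorem exists_admin_seq {c : Clo S} {a' : Expr S} {b' : Expr S} (hc : c.Closed)
    (hu : c.unload = .seq a' b') :
    ∃ a b, Admin c (.seq a b) ∧
      a.Closed ∧ a.unload = a' ∧
      b.Closed ∧ b.unload = b' := by
  obtain ⟨c', h, hc', hu', hn⟩ := exists_admin_not_clos hc (by rw [hu]; rintro ⟨⟩)
  rw [hu] at hu'
  cases c' with
  | clos e ρ => exact (hn e ρ rfl).elim
  | seq =>
    simp only [Clo.unload, Expr.seq.injEq] at hu'
    obtain ⟨hu_a, hu_b⟩ := hu'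
    exact ⟨_, _, h, hc'.1, hu_a, hc'.2, hu_b⟩
  | _ => simp [Clo.unload] at hu'

theorem exists_admin_whl {c : Clo S} {a' : Expr S} {b' : Expr S} (hc : c.Closed)
    (hu : c.unload = .whl a' b') :
    ∃ a b, Admin c (.whl a b) ∧
      a.Closed ∧ a.unload = a' ∧
      b.Closed ∧ b.unload = b' := by
  obtain ⟨c', h, hc', hu', hn⟩ := exists_admin_not_clos hc (by rw [hu]; rintro ⟨⟩)
  rw [hu] at hu'
  cases c' with
  | clos e ρ => exact (hn e ρ rfl).elim
  | whl =>
    simp only [Clo.unload, Expr.whl.injEq] at hu'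
    obtain ⟨hu_a, hu_b⟩ := hu'
    exact ⟨_, _, h, hc'.1, hu_a, hc'.2, hu_b⟩
  | _ => simp [Clo.unload] at hu'

theorem exists_admin_label {c : Clo S} {l : S.Label} {d' : Expr S} (hc : c.Closed)
    (hu : c.unload = .label l d') :
    ∃ d, Admin c (.label l d) ∧
      d.Closed ∧ d.unload = d' := by
  obtain ⟨c', h, hc', hu', hn⟩ := exists_admin_not_clos hc (by rw [hu]; rintro ⟨⟩)
  rw [hu] at hu'
  cases c' with
  | clos e ρ => exact (hn e ρ rfl).elim
  | label =>
    simp only [Clo.unload, Expr.label.injEq] at hu'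
    obtain ⟨rfl, hu_d⟩ := hu'
    exact ⟨_, h, hc', hu_d⟩
  | _ => simp [Clo.unload] at hu'

theorem exists_admin_brk {c : Clo S} {l : S.Label} {d' : Expr S} (hc : c.Closed)
    (hu : c.unload = .brk l d') :
    ∃ d, Admin c (.brk l d) ∧
      d.Closed ∧ d.unload = d' := by
  obtain ⟨c', h, hc', hu', hn⟩ := exists_admin_not_clos hc (by rw [hu]; rintro ⟨⟩)
  rw [hu] at hu'
  cases c' with
  | clos e ρ => exact (hn e ρ rfl).elim
  | brk =>
    simp only [Clo.unload, Expr.brk.injEq] at hu'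
    obtain ⟨rfl, hu_d⟩ := hu'
    exact ⟨_, h, hc', hu_d⟩
  | _ => simp [Clo.unload] at hu'

theorem exists_admin_tryf {c : Clo S} {a' : Expr S} {b' : Expr S} (hc : c.Closed)
    (hu : c.unload = .tryf a' b') :
    ∃ a b, Admin c (.tryf a b) ∧
      a.Closed ∧ a.unload = a' ∧
      b.Closed ∧ b.unload = b' := by
  obtain ⟨c', h, hc', hu', hn⟩ := exists_admin_not_clos hc (by rw [hu]; rintro ⟨⟩)
  rw [hu] at hu'
  cases c' with
  | clos e ρ => exact (hn e ρ rfl).elim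
  | tryf =>
    simp only [Clo.unload, Expr.tryf.injEq] at hu'
    obtain ⟨hu_a, hu_b⟩ := hu'
    exact ⟨_, _, h, hc'.1, hu_a, hc'.2, hu_b⟩
  | _ => simp [Clo.unload] at hu'

theorem exists_admin_throw {c : Clo S} {d' : Expr S} (hc : c.Closed)
    (hu : c.unload = .throw d') :
    ∃ d, Admin c (.throw d) ∧
      d.Closed ∧ d.unload = d' := by
  obtain ⟨c', h, hc', hu', hn⟩ := exists_admin_not_clos hc (by rw [hu]; rintro ⟨⟩)
  rw [hu] at hu'
  cases c' with
  | clos e ρ => exact (hn e ρ rfl).elim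
  | throw =>
    simp only [Clo.unload, Expr.throw.injEq] at hu'
    exact ⟨_, h, hc', hu'⟩
  | _ => simp [Clo.unload] at hu'

theorem exists_admin_prim {c : Clo S} {op : S.Op} {as' : List (Expr S)} (hc : c.Closed)
    (hu : c.unload = .prim op as') :
    ∃ as, Admin c (.prim op as) ∧
      (∀ c ∈ as, c.Closed) ∧ as.map Clo.unload = as' := by
  obtain ⟨c', h, hc', hu', hn⟩ := exists_admin_not_clos hc (by rw [hu]; rintro ⟨⟩)
  rw [hu] at hu'
  cases c' with
  | clos e ρ => exact (hn e ρ rfl).elim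
  | prim =>
    simp only [Clo.unload, Clo.unloadList_eq_map, Expr.prim.injEq] at hu'
    obtain ⟨rfl, hu_as⟩ := hu'
    exact ⟨_, h, Clo.closedList_iff.1 hc', hu_as⟩
  | _ => simp [Clo.unload] at hu'

/-- Unlike the other constructors in this family, a record may itself be a value, so this has to be
excluded by hypothesis. -/
theorem exists_admin_record {c : Clo S} {fs' : List (S.Str × Expr S)} (hc : c.Closed)
    (hu : c.unload = .record fs') (hv : ¬ (Expr.record fs').IsValue) :
    ∃ fs : List (S.Str × Clo S), Admin c (.record fs) ∧ (∀ p ∈ fs, p.2.Closed) ∧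
      (fs.map fun p => (p.1, p.2.unload)) = fs' := by
  obtain ⟨c', h, hc', hu', hn⟩ := exists_admin_not_clos hc (by rwa [hu])
  rw [hu] at hu'
  cases c' with
  | clos e ρ => exact (hn e ρ rfl).elim
  | record =>
    simp only [Clo.unload, Clo.unloadFields_eq_map, Expr.record.injEq] at hu'
    exact ⟨_, h, Clo.closedFields_iff.1 hc', hu'⟩
  | _ => simp [Clo.unload] at hu'

/-- Reduction never enters a `let` body or a handler, so these are still pairs, the form that the
rules for `let` and `catch` demand. -/
theorem _root_.LambdaJS.Clo.ClosedUnder.exists_clos {x : S.Var} {c : Clo S}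
    (h : c.ClosedUnder x) : ∃ e ρ, c = .clos e ρ ∧ EnvFor ρ (e.fv \ {x}) := by
  cases c with
  | clos e ρ => exact ⟨e, ρ, rfl, h⟩
  | _ => exact h.elim

theorem exists_admin_letin {c : Clo S} {x : S.Var} {a' b' : Expr S} (hc : c.Closed)
    (hu : c.unload = .letin x a' b') :
    ∃ a e ρ, Admin c (.letin x a (.clos e ρ)) ∧ a.Closed ∧ a.unload = a' ∧
      EnvFor ρ (e.fv \ {x}) ∧ (Clo.clos e ρ).unloadUnder x = b' := by
  obtain ⟨c', h, hc', hu', hn⟩ := exists_admin_not_clos hc (by rw [hu]; rintro ⟨⟩)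
  rw [hu] at hu'
  cases c' with
  | clos e ρ => exact (hn e ρ rfl).elim
  | letin y a b =>
    simp only [Clo.unload, Expr.letin.injEq] at hu'
    obtain ⟨rfl, hua, hub⟩ := hu'
    obtain ⟨e, ρ, rfl, hρ⟩ := hc'.2.exists_clos
    exact ⟨a, e, ρ, h, hc'.1, hua, hρ, hub⟩
  | _ => simp [Clo.unload] at hu'

theorem exists_admin_tryc {c : Clo S} {x : S.Var} {a' b' : Expr S} (hc : c.Closed)
    (hu : c.unload = .tryc a' x b') :
    ∃ a e ρ, Admin c (.tryc a x (.clos e ρ)) ∧ a.Closed ∧ a.unload = a' ∧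
      EnvFor ρ (e.fv \ {x}) ∧ (Clo.clos e ρ).unloadUnder x = b' := by
  obtain ⟨c', h, hc', hu', hn⟩ := exists_admin_not_clos hc (by rw [hu]; rintro ⟨⟩)
  rw [hu] at hu'
  cases c' with
  | clos e ρ => exact (hn e ρ rfl).elim
  | tryc a y b =>
    simp only [Clo.unload, Expr.tryc.injEq] at hu'
    obtain ⟨hua, rfl, hub⟩ := hu'
    obtain ⟨e, ρ, rfl, hρ⟩ := hc'.2.exists_clos
    exact ⟨a, e, ρ, h, hc'.1, hua, hρ, hub⟩
  | _ => simp [Clo.unload] at hu'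

end Rho

/-! ## Lifting reductions of expressions to closures -/

namespace Rho

theorem exists_eval {c : Clo S} (hc : c.Closed) (hv : c.unload.IsValue) :
    ∃ v : Clo S, v.IsValue ∧ Admin c v ∧ v.Closed ∧ v.unload = c.unload := by
  obtain ⟨v, hv, h⟩ := exists_admin_value hv hc rfl
  exact ⟨v, hv, h, h.closed_unload hc⟩

/-- Serves calls and primitive operations at once: `K` is the constructor applied to its arguments,
and `hK` says that an argument preceded by values is in evaluation position. -/
theorem exists_eval_args (K : List (Clo S) → Clo S)
    (hK : ∀ vs cs : List (Clo S), (∀ v ∈ vs, v.IsValue) →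
      ∃ f : Frame S (Clo S), f.Valid Clo.IsValue ∧ ∀ t, K (vs ++ t :: cs) = plug f t)
    (cs rest : List (Clo S)) (hc : ∀ c ∈ cs, c.Closed) (hv : ∀ c ∈ cs, c.unload.IsValue) :
    ∃ vs : List (Clo S), (∀ v ∈ vs, v.IsValue) ∧ (∀ v ∈ vs, v.Closed) ∧
      vs.map Clo.unload = cs.map Clo.unload ∧ Admin (K (cs ++ rest)) (K (vs ++ rest)) := by
  obtain ⟨vs, hvs, hf, h⟩ := exists_eval_segment (A := fun c v => c.Closed ∧ Admin c v)
    (V := fun v : Clo S => v.IsValue)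
    (R := fun l m => Admin (K l) (K m)) (fun _ => .refl) (fun _ _ _ h h' => h.trans h')
    (fun vs c c' cs hvs h => by
      obtain ⟨f, hf, hp⟩ := hK vs cs hvs
      rw [hp, hp]
      exact h.2.plug hf) rest cs [] (by simp) (fun c hcs => by
        obtain ⟨v, h1, h2, -⟩ := exists_eval (hc c hcs) (hv c hcs)
        exact ⟨v, h1, hc c hcs, h2⟩)
  refine ⟨vs, hvs, ?_, map_unload_eq_of_forall₂ (hf.imp fun _ _ h => h.2) hc, h⟩
  clear h hvs hc hv
  induction hf with
  | nil => simp
  | cons h _ ih => exact List.forall_mem_cons.2 ⟨(h.2.closed_unload h.1).1, ih⟩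

theorem appArg_frame {f : Clo S} (hf : f.IsValue) (vs cs : List (Clo S))
    (hvs : ∀ v ∈ vs, v.IsValue) :
    ∃ g : Frame S (Clo S), g.Valid Clo.IsValue ∧ ∀ t, Clo.app f (vs ++ t :: cs) = plug g t :=
  ⟨.appArg f vs cs, ⟨hf, hvs⟩, fun _ => rfl⟩

theorem prim_frame (op : S.Op) (vs cs : List (Clo S)) (hvs : ∀ v ∈ vs, v.IsValue) :
    ∃ g : Frame S (Clo S), g.Valid Clo.IsValue ∧ ∀ t, Clo.prim op (vs ++ t :: cs) = plug g t :=
  ⟨.prim op vs cs, hvs, fun _ => rfl⟩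

/-- A closure that denotes an expression inside a frame reduces administratively to a closure
inside a frame. -/
theorem exists_admin_plug {c : Clo S} {f : Frame S (Expr S)} {t : Expr S} (hc : c.Closed)
    (hf : f.Valid Expr.IsValue) (ht : ¬ t.IsValue) (hu : c.unload = JS.plug f t) :
    ∃ (g : Frame S (Clo S)) (d : Clo S), g.Valid Clo.IsValue ∧ g.unload = f ∧ d.unload = t ∧
      Admin c (plug g d) := by
  cases f with
  | letin x b =>
    obtain ⟨a, e, ρ, h, -, rfl, -, rfl⟩ := exists_admin_letin hc hu
    exact ⟨.letin x (.clos e ρ), a, trivial, rfl, rfl, h⟩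
  | appFun as =>
    obtain ⟨f, as, h, -, rfl, -, rfl⟩ := exists_admin_app hc hu
    exact ⟨.appFun as, f, trivial, rfl, rfl, h⟩
  | appArg f vs ts =>
    obtain ⟨f, as, h, hcf, rfl, hcs, hus⟩ := exists_admin_app hc hu
    -- The arguments are split as in the frame of expressions. Those before the hole denote values
    -- but need not be values yet, so they are evaluated before the frame becomes valid.
    obtain ⟨cs, cs', rfl, rfl, hus'⟩ := List.map_eq_append_iff.1 hus
    obtain ⟨d, cs', rfl, rfl, rfl⟩ := List.map_eq_cons_iff.1 hus'
    obtain ⟨g, hg, hA, -, hug⟩ := exists_eval hcf hf.1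
    obtain ⟨ws, hws, -, huw, hAs⟩ := exists_eval_args (.app g) (appArg_frame hg) cs (d :: cs')
      (List.forall_mem_append.1 hcs).1 fun c hc => hf.2 _ (List.mem_map_of_mem hc)
    refine ⟨.appArg g ws cs', d, ⟨hg, hws⟩, by simp [Frame.unload, hug, huw], rfl, ?_⟩
    exact (h.trans (hA.plug (f := .appFun (cs ++ d :: cs')) trivial)).trans hAs
  | record fs s gs =>
    obtain ⟨as, h, hcs, hus⟩ := exists_admin_record hc hu
      (JS.plug_not_isValue (.record fs s gs) ht)
    obtain ⟨cs, cs', rfl, rfl, hus'⟩ := List.map_eq_append_iff.1 hus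
    obtain ⟨⟨s', d⟩, cs', rfl, hd, rfl⟩ := List.map_eq_cons_iff.1 hus'
    obtain ⟨rfl, rfl⟩ := Prod.mk.inj hd
    have hcs' := (List.forall_mem_append.1 hcs).1
    obtain ⟨ws, hws, huw, hAs⟩ := exists_eval_fields cs ((s', d) :: cs') fun p hp =>
      exists_admin_value (hf (p.1, p.2.unload) (List.mem_map.2 ⟨p, hp, rfl⟩)) (hcs' p hp) rfl
    refine ⟨.record ws s' cs', d, hws, ?_, rfl, h.trans hAs⟩
    simp [Frame.unload, map_unload_eq_of_forall₂_fields huw hcs']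
  | prim op vs ts =>
    obtain ⟨as, h, hcs, hus⟩ := exists_admin_prim hc hu
    obtain ⟨cs, cs', rfl, rfl, hus'⟩ := List.map_eq_append_iff.1 hus
    obtain ⟨d, cs', rfl, rfl, rfl⟩ := List.map_eq_cons_iff.1 hus'
    obtain ⟨ws, hws, -, huw, hAs⟩ := exists_eval_args (.prim op) (prim_frame op) cs (d :: cs')
      (List.forall_mem_append.1 hcs).1 fun c hc => hf _ (List.mem_map_of_mem hc)
    exact ⟨.prim op ws cs', d, hws, by simp [Frame.unload, huw], rfl, h.trans hAs⟩
  | getObj k =>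
    obtain ⟨o, k, h, -, rfl, -, rfl⟩ := exists_admin_get hc hu
    exact ⟨.getObj k, o, trivial, rfl, rfl, h⟩
  | getKey o =>
    obtain ⟨o, k, h, ho, rfl, -, rfl⟩ := exists_admin_get hc hu
    obtain ⟨v, hv, hA, -, huv⟩ := exists_eval ho hf
    exact ⟨.getKey v, k, hv, by rw [Frame.unload, huv], rfl,
      h.trans (hA.plug (f := .getObj k) trivial)⟩
  | putObj k e =>
    obtain ⟨o, k, d, h, -, rfl, -, rfl, -, rfl⟩ := exists_admin_put hc hu
    exact ⟨.putObj k d, o, trivial, rfl, rfl, h⟩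
  | putKey o e =>
    obtain ⟨o, k, d, h, ho, rfl, -, rfl, -, rfl⟩ := exists_admin_put hc hu
    obtain ⟨v, hv, hA, -, huv⟩ := exists_eval ho hf
    exact ⟨.putKey v d, k, hv, by rw [Frame.unload, huv], rfl,
      h.trans (hA.plug (f := .putObj k d) trivial)⟩
  | putVal o k =>
    obtain ⟨o, k, d, h, ho, rfl, hk, rfl, -, rfl⟩ := exists_admin_put hc hu
    obtain ⟨v, hv, hA, -, huv⟩ := exists_eval ho hf.1
    obtain ⟨w, hw, hB, -, huw⟩ := exists_eval hk hf.2
    exact ⟨.putVal v w, d, ⟨hv, hw⟩, by rw [Frame.unload, huv, huw], rfl,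
      (h.trans (hA.plug (f := .putObj k d) trivial)).trans (hB.plug (f := .putKey v d) hv)⟩
  | delObj k =>
    obtain ⟨o, k, h, -, rfl, -, rfl⟩ := exists_admin_del hc hu
    exact ⟨.delObj k, o, trivial, rfl, rfl, h⟩
  | delKey o =>
    obtain ⟨o, k, h, ho, rfl, -, rfl⟩ := exists_admin_del hc hu
    obtain ⟨v, hv, hA, -, huv⟩ := exists_eval ho hf
    exact ⟨.delKey v, k, hv, by rw [Frame.unload, huv], rfl,
      h.trans (hA.plug (f := .delObj k) trivial)⟩
  | alloc =>
    obtain ⟨d, h, -, rfl⟩ := exists_admin_alloc hc hu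
    exact ⟨.alloc, d, trivial, rfl, rfl, h⟩
  | deref =>
    obtain ⟨d, h, -, rfl⟩ := exists_admin_deref hc hu
    exact ⟨.deref, d, trivial, rfl, rfl, h⟩
  | assignLoc e =>
    obtain ⟨l, d, h, -, rfl, -, rfl⟩ := exists_admin_assign hc hu
    exact ⟨.assignLoc d, l, trivial, rfl, rfl, h⟩
  | assignVal l =>
    obtain ⟨l, d, h, hl, rfl, -, rfl⟩ := exists_admin_assign hc hu
    obtain ⟨v, hv, hA, -, huv⟩ := exists_eval hl hf
    exact ⟨.assignVal v, d, hv, by rw [Frame.unload, huv], rfl,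
      h.trans (hA.plug (f := .assignLoc d) trivial)⟩
  | ite a b =>
    obtain ⟨d, a, b, h, -, rfl, -, rfl, -, rfl⟩ := exists_admin_ite hc hu
    exact ⟨.ite a b, d, trivial, rfl, rfl, h⟩
  | seq e =>
    obtain ⟨a, b, h, -, rfl, -, rfl⟩ := exists_admin_seq hc hu
    exact ⟨.seq b, a, trivial, rfl, rfl, h⟩
  | throw =>
    obtain ⟨d, h, -, rfl⟩ := exists_admin_throw hc hu
    exact ⟨.throw, d, trivial, rfl, rfl, h⟩
  | brk l =>
    obtain ⟨d, h, -, rfl⟩ := exists_admin_brk hc hu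
    exact ⟨.brk l, d, trivial, rfl, rfl, h⟩
  | tryf e =>
    obtain ⟨a, b, h, -, rfl, -, rfl⟩ := exists_admin_tryf hc hu
    exact ⟨.tryf b, a, trivial, rfl, rfl, h⟩
  | label l =>
    obtain ⟨d, h, -, rfl⟩ := exists_admin_label hc hu
    exact ⟨.label l, d, trivial, rfl, rfl, h⟩
  | tryc x e =>
    obtain ⟨a, e, ρ, h, -, rfl, -, rfl⟩ := exists_admin_tryc hc hu
    exact ⟨.tryc x (.clos e ρ), a, trivial, rfl, rfl, h⟩

/-- The context is exposed from the outside in. As `t` is not a value, what remains in the hole is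
never a value, so each frame can be recovered by `exists_admin_plug`. -/
theorem exists_admin_plugAll {L : List (Frame S (Expr S))} {t : Expr S}
    (hL : ∀ f ∈ L, f.Valid Expr.IsValue) (ht : ¬ t.IsValue) :
    ∀ {c : Clo S}, c.Closed → c.unload = JS.plugAll L t →
      ∃ (M : List (Frame S (Clo S))) (d : Clo S), (∀ f ∈ M, f.Valid Clo.IsValue) ∧
        M.map Frame.unload = L ∧ d.Closed ∧ d.unload = t ∧ Admin c (plugAll M d) := by
  induction L with
  | nil => exact fun {c} hc hu => ⟨[], c, by simp, rfl, hc, hu, .refl⟩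
  | cons f L ih =>
    intro c hc hu
    obtain ⟨hf, hL'⟩ := List.forall_mem_cons.1 hL
    obtain ⟨g, d, hg, rfl, hd, h⟩ :=
      exists_admin_plug hc hf (JS.plugAll_not_isValue L ht) hu
    obtain ⟨M, d', hM, rfl, hc', hd', h'⟩ :=
      ih hL' (closed_plug.1 (h.closed_unload hc).1).2 hd
    exact ⟨g :: M, d', List.forall_mem_cons.2 ⟨hg, hM⟩, rfl, hc', hd',
      h.trans (h'.plug hg)⟩

/-- Fails for closures that are not values: a pair with a variable may denote a constant too. -/
theorem eq_const_of_unload {v : Clo S} (hv : v.IsValue) {k : S.Const}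
    (h : v.unload = .const k) : v = .const k := by
  cases hv <;> simp_all [Clo.unload, Expr.subst]

theorem exists_record_of_unload {v : Clo S} (hv : v.IsValue) {fs : List (S.Str × Expr S)}
    (h : v.unload = .record fs) :
    ∃ gs : List (S.Str × Clo S), v = .record gs ∧ (gs.map fun p => (p.1, p.2.unload)) = fs := by
  cases hv with
  | record gs _ =>
    rw [Clo.unload, Clo.unloadFields_eq_map] at h
    exact ⟨gs, rfl, Expr.record.inj h⟩
  | _ => simp_all [Clo.unload, Expr.subst]

theorem exists_record_append_of_unload {v : Clo S} (hv : v.IsValue)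
    {fs gs : List (S.Str × Expr S)} {s : S.Str} {u : Expr S}
    (h : v.unload = .record (fs ++ (s, u) :: gs)) :
    ∃ (fs' gs' : List (S.Str × Clo S)) (u' : Clo S), v = .record (fs' ++ (s, u') :: gs') ∧
      (fs'.map fun p => (p.1, p.2.unload)) = fs ∧ u'.unload = u ∧
      (gs'.map fun p => (p.1, p.2.unload)) = gs := by
  obtain ⟨hs, rfl, h₁⟩ := exists_record_of_unload hv h
  obtain ⟨fs', hs, rfl, rfl, h₂⟩ := List.map_eq_append_iff.1 h₁
  obtain ⟨⟨s', u'⟩, gs', rfl, h₃, rfl⟩ := List.map_eq_cons_iff.1 h₂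
  obtain ⟨rfl, rfl⟩ := Prod.mk.inj h₃
  exact ⟨fs', gs', u', rfl, rfl, rfl, rfl⟩

theorem exists_func_of_unload {v : Clo S} (hv : v.IsValue) {xs : List S.Var} {e : Expr S}
    (h : v.unload = .func xs e) :
    ∃ (e' : Expr S) (ρ : Env S), v = .clos (.func xs e') ρ ∧
      e'.subst (hide (assoc (Clo.forceEnv ρ)) xs) = e := by
  cases hv with
  | func ys e' ρ _ =>
    simp only [Clo.unload, Expr.subst, Expr.func.injEq] at h
    obtain ⟨rfl, h⟩ := h
    exact ⟨e', ρ, rfl, h⟩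
  | _ => simp_all [Clo.unload]

/-- This and the following lemmas combine inversion at the head with evaluation of the operands from
left to right. The result has values in all evaluation positions, as the reduction rules require. -/
theorem exists_eval_app {c : Clo S} {f' : Expr S} {vs' : List (Expr S)} (hc : c.Closed)
    (hf : f'.IsValue) (hvs : ∀ v ∈ vs', v.IsValue) (hu : c.unload = .app f' vs') :
    ∃ f vs, Admin c (.app f vs) ∧ f.IsValue ∧ f.Closed ∧ f.unload = f' ∧
      (∀ v ∈ vs, v.IsValue) ∧ (∀ v ∈ vs, v.Closed) ∧ vs.map Clo.unload = vs' := by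
  obtain ⟨f, as, h, hcf, rfl, hcs, rfl⟩ := exists_admin_app hc hu
  obtain ⟨g, hg, hA, hcg, hug⟩ := exists_eval hcf hf
  obtain ⟨ws, hws, hcw, huw, hAs⟩ := exists_eval_args (.app g) (appArg_frame hg) as []
    hcs fun c hc => hvs _ (List.mem_map_of_mem hc)
  simp only [List.append_nil] at hAs
  exact ⟨g, ws, (h.trans (hA.plug (f := .appFun as) trivial)).trans hAs, hg, hcg, hug, hws, hcw,
    huw⟩

theorem exists_eval_prim {c : Clo S} {op : S.Op} {vs' : List (Expr S)} (hc : c.Closed)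
    (hvs : ∀ v ∈ vs', v.IsValue) (hu : c.unload = .prim op vs') :
    ∃ vs, Admin c (.prim op vs) ∧ (∀ v ∈ vs, v.IsValue) ∧ (∀ v ∈ vs, v.Closed) ∧
      vs.map Clo.unload = vs' := by
  obtain ⟨as, h, hcs, rfl⟩ := exists_admin_prim hc hu
  obtain ⟨ws, hws, hcw, huw, hAs⟩ := exists_eval_args (.prim op) (prim_frame op) as []
    hcs fun c hc => hvs _ (List.mem_map_of_mem hc)
  simp only [List.append_nil] at hAs
  exact ⟨ws, h.trans hAs, hws, hcw, huw⟩

theorem exists_eval_get {c : Clo S} {o' k' : Expr S} (hc : c.Closed) (ho : o'.IsValue)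
    (hk : k'.IsValue) (hu : c.unload = .get o' k') :
    ∃ o k, Admin c (.get o k) ∧ o.IsValue ∧ o.unload = o' ∧ k.IsValue ∧ k.unload = k' := by
  obtain ⟨o, k, h, hco, rfl, hck, rfl⟩ := exists_admin_get hc hu
  obtain ⟨v, hv, hA, -, huv⟩ := exists_eval hco ho
  obtain ⟨w, hw, hB, -, huw⟩ := exists_eval hck hk
  exact ⟨v, w, (h.trans (hA.plug (f := .getObj k) trivial)).trans (hB.plug (f := .getKey v) hv),
    hv, huv, hw, huw⟩

theorem exists_eval_del {c : Clo S} {o' k' : Expr S} (hc : c.Closed) (ho : o'.IsValue)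
    (hk : k'.IsValue) (hu : c.unload = .del o' k') :
    ∃ o k, Admin c (.del o k) ∧ o.IsValue ∧ o.unload = o' ∧ k.IsValue ∧ k.unload = k' := by
  obtain ⟨o, k, h, hco, rfl, hck, rfl⟩ := exists_admin_del hc hu
  obtain ⟨v, hv, hA, -, huv⟩ := exists_eval hco ho
  obtain ⟨w, hw, hB, -, huw⟩ := exists_eval hck hk
  exact ⟨v, w, (h.trans (hA.plug (f := .delObj k) trivial)).trans (hB.plug (f := .delKey v) hv),
    hv, huv, hw, huw⟩

theorem exists_eval_put {c : Clo S} {o' k' d' : Expr S} (hc : c.Closed) (ho : o'.IsValue)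
    (hk : k'.IsValue) (hd : d'.IsValue) (hu : c.unload = .put o' k' d') :
    ∃ o k d, Admin c (.put o k d) ∧ o.IsValue ∧ o.unload = o' ∧ k.IsValue ∧ k.unload = k' ∧
      d.IsValue ∧ d.unload = d' := by
  obtain ⟨o, k, d, h, hco, rfl, hck, rfl, hcd, rfl⟩ := exists_admin_put hc hu
  obtain ⟨v, hv, hA, -, huv⟩ := exists_eval hco ho
  obtain ⟨w, hw, hB, -, huw⟩ := exists_eval hck hk
  obtain ⟨x, hx, hC, -, hux⟩ := exists_eval hcd hd
  exact ⟨v, w, x, ((h.trans (hA.plug (f := .putObj k d) trivial)).trans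
    (hB.plug (f := .putKey v d) hv)).trans (hC.plug (f := .putVal v w) ⟨hv, hw⟩),
    hv, huv, hw, huw, hx, hux⟩

theorem exists_eval_assign {c : Clo S} {l' d' : Expr S} (hc : c.Closed) (hl : l'.IsValue)
    (hd : d'.IsValue) (hu : c.unload = .assign l' d') :
    ∃ l d, Admin c (.assign l d) ∧ l.IsValue ∧ l.unload = l' ∧ d.IsValue ∧ d.unload = d' := by
  obtain ⟨l, d, h, hcl, rfl, hcd, rfl⟩ := exists_admin_assign hc hu
  obtain ⟨v, hv, hA, -, huv⟩ := exists_eval hcl hl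
  obtain ⟨w, hw, hB, -, huw⟩ := exists_eval hcd hd
  exact ⟨v, w, (h.trans (hA.plug (f := .assignLoc d) trivial)).trans
    (hB.plug (f := .assignVal v) hv), hv, huv, hw, huw⟩

theorem exists_eval_alloc {c : Clo S} {d' : Expr S} (hc : c.Closed) (hd : d'.IsValue)
    (hu : c.unload = .alloc d') : ∃ d, Admin c (.alloc d) ∧ d.IsValue ∧ d.unload = d' := by
  obtain ⟨d, h, hcd, rfl⟩ := exists_admin_alloc hc hu
  obtain ⟨v, hv, hA, -, huv⟩ := exists_eval hcd hd
  exact ⟨v, h.trans (hA.plug (f := .alloc) trivial), hv, huv⟩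

theorem exists_eval_deref {c : Clo S} {d' : Expr S} (hc : c.Closed) (hd : d'.IsValue)
    (hu : c.unload = .deref d') : ∃ d, Admin c (.deref d) ∧ d.IsValue ∧ d.unload = d' := by
  obtain ⟨d, h, hcd, rfl⟩ := exists_admin_deref hc hu
  obtain ⟨v, hv, hA, -, huv⟩ := exists_eval hcd hd
  exact ⟨v, h.trans (hA.plug (f := .deref) trivial), hv, huv⟩

theorem exists_eval_throw {c : Clo S} {d' : Expr S} (hc : c.Closed) (hd : d'.IsValue)
    (hu : c.unload = .throw d') : ∃ d, Admin c (.throw d) ∧ d.IsValue ∧ d.unload = d' := by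
  obtain ⟨d, h, hcd, rfl⟩ := exists_admin_throw hc hu
  obtain ⟨v, hv, hA, -, huv⟩ := exists_eval hcd hd
  exact ⟨v, h.trans (hA.plug (f := .throw) trivial), hv, huv⟩

theorem exists_eval_brk {c : Clo S} {l : S.Label} {d' : Expr S} (hc : c.Closed) (hd : d'.IsValue)
    (hu : c.unload = .brk l d') : ∃ d, Admin c (.brk l d) ∧ d.IsValue ∧ d.unload = d' := by
  obtain ⟨d, h, hcd, rfl⟩ := exists_admin_brk hc hu
  obtain ⟨v, hv, hA, -, huv⟩ := exists_eval hcd hd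
  exact ⟨v, h.trans (hA.plug (f := .brk l) trivial), hv, huv⟩

theorem exists_eval_ite {c : Clo S} {d' a' b' : Expr S} (hc : c.Closed) (hd : d'.IsValue)
    (hu : c.unload = .ite d' a' b') :
    ∃ d a b, Admin c (.ite d a b) ∧ d.IsValue ∧ d.unload = d' ∧ a.unload = a' ∧ b.unload = b' := by
  obtain ⟨d, a, b, h, hcd, rfl, -, rfl, -, rfl⟩ := exists_admin_ite hc hu
  obtain ⟨v, hv, hA, -, huv⟩ := exists_eval hcd hd
  exact ⟨v, a, b, h.trans (hA.plug (f := .ite a b) trivial), hv, huv, rfl, rfl⟩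

/-- A reduction of the expression denoted by a closure lifts to a reduction of the closure, after
administrative reductions. -/
theorem exists_red_of_unload {δ : S.Op → List (Expr S) → Option (Expr S)}
    {δρ : S.Op → List (Clo S) → Option (Clo S)}
    (hδ : ∀ (op : S.Op) (vs : List (Clo S)), (∀ v ∈ vs, v.IsClosedValue) →
      δ op (vs.map Clo.force) = (δρ op vs).map Clo.force)
    (hclosed : ∀ (op : S.Op) (vs : List (Clo S)) (v : Clo S),
      (∀ v ∈ vs, v.IsClosedValue) → δρ op vs = some v → v.IsClosedValue)
    {e e' : Expr S} (h : JS.Red δ e e') {c : Clo S} (hc : c.Closed) (hu : c.unload = e) :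
    ∃ d d' : Clo S, Admin c d ∧ Red δρ d d' ∧ d'.unload = e' := by
  -- In this direction no assumption on values is needed: records and constants denote records and
  -- constants.
  have hrec : ∀ {o k : Clo S}, (¬ ∃ fs s, o.unload = .record fs ∧ k.unload = .const (.str s)) →
      ¬ ∃ fs s, o = .record fs ∧ k = .const (.str s) := by
    rintro o k hn ⟨fs, s, rfl, rfl⟩
    exact hn ⟨_, s, rfl, rfl⟩
  cases h with
  | letin x v e hv =>
    obtain ⟨a, e, ρ, h, hca, rfl, hρ, rfl⟩ := exists_admin_letin hc hu
    obtain ⟨v, hv, hA, -, huv⟩ := exists_eval hca hv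
    refine ⟨_, _, h.trans (hA.plug (f := .letin x (.clos e ρ)) trivial), .letin x v e ρ hv, ?_⟩
    -- The rule extends `ρ` by the value of `a`, which denotes the value that `λ_JS` substitutes.
    rw [← Clo.unloadUnder_subst hρ.2, ← hv.unload_eq_force, huv]
  | app xs e vs hvs hlen =>
    obtain ⟨f, ws, h, hf, hcf, huf, hws, hcw, rfl⟩ := exists_eval_app hc (.func xs e) hvs hu
    obtain ⟨e, ρ, rfl, rfl⟩ := exists_func_of_unload hf huf
    have hlen' : xs.length = ws.length := by simpa using hlen
    refine ⟨_, _, h, .app xs e ρ ws hws hlen', ?_⟩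
    rw [← Clo.unload_func_subst hcf.2 ws hlen', Clo.map_unload_eq_map_force hws]
  | getHit fs gs s v hr =>
    obtain ⟨o, k, h, ho, huo, hk, huk⟩ := exists_eval_get hc hr (.const _) hu
    obtain rfl := eq_const_of_unload hk huk
    obtain ⟨fs, gs, u, rfl, rfl, rfl, rfl⟩ := exists_record_append_of_unload ho huo
    exact ⟨_, _, h, .getHit fs gs s u ho, rfl⟩
  | getMiss fs s hr hs =>
    obtain ⟨o, k, h, ho, huo, hk, huk⟩ := exists_eval_get hc hr (.const _) hu
    obtain rfl := eq_const_of_unload hk huk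
    obtain ⟨fs, rfl, rfl⟩ := exists_record_of_unload ho huo
    exact ⟨_, _, h, .getMiss fs s ho (by simpa using hs), rfl⟩
  | putHit fs gs s u v hr hv =>
    obtain ⟨o, k, d, h, ho, huo, hk, huk, hd, rfl⟩ := exists_eval_put hc hr (.const _) hv hu
    obtain rfl := eq_const_of_unload hk huk
    obtain ⟨fs, gs, u, rfl, rfl, rfl, rfl⟩ := exists_record_append_of_unload ho huo
    exact ⟨_, _, h, .putHit fs gs s u d ho hd, by simp [Clo.unload, Clo.unloadFields_eq_map]⟩
  | putMiss fs s v hr hv hs =>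
    obtain ⟨o, k, d, h, ho, huo, hk, huk, hd, rfl⟩ := exists_eval_put hc hr (.const _) hv hu
    obtain rfl := eq_const_of_unload hk huk
    obtain ⟨fs, rfl, rfl⟩ := exists_record_of_unload ho huo
    exact ⟨_, _, h, .putMiss fs s d ho hd (by simpa using hs),
      by simp [Clo.unload, Clo.unloadFields_eq_map]⟩
  | delHit fs gs s u hr =>
    obtain ⟨o, k, h, ho, huo, hk, huk⟩ := exists_eval_del hc hr (.const _) hu
    obtain rfl := eq_const_of_unload hk huk
    obtain ⟨fs, gs, u, rfl, rfl, rfl, rfl⟩ := exists_record_append_of_unload ho huo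
    exact ⟨_, _, h, .delHit fs gs s u ho, by simp [Clo.unload, Clo.unloadFields_eq_map]⟩
  | delMiss fs s hr hs =>
    obtain ⟨o, k, h, ho, huo, hk, huk⟩ := exists_eval_del hc hr (.const _) hu
    obtain rfl := eq_const_of_unload hk huk
    obtain ⟨fs, rfl, rfl⟩ := exists_record_of_unload ho huo
    exact ⟨_, _, h, .delMiss fs s ho (by simpa using hs), huo⟩
  | iteTrue a b =>
    obtain ⟨d, a, b, h, hd, hud, rfl, rfl⟩ := exists_eval_ite hc (.const _) hu
    obtain rfl := eq_const_of_unload hd hud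
    exact ⟨_, _, h, .iteTrue a b, rfl⟩
  | iteFalse a b =>
    obtain ⟨d, a, b, h, hd, hud, rfl, rfl⟩ := exists_eval_ite hc (.const _) hu
    obtain rfl := eq_const_of_unload hd hud
    exact ⟨_, _, h, .iteFalse a b, rfl⟩
  | seq v e hv =>
    obtain ⟨a, b, h, hca, rfl, -, rfl⟩ := exists_admin_seq hc hu
    obtain ⟨v, hv, hA, -, -⟩ := exists_eval hca hv
    exact ⟨_, _, h.trans (hA.plug (f := .seq b) trivial), .seq v b hv, rfl⟩
  | whl a b =>
    obtain ⟨a, b, h, -, rfl, -, rfl⟩ := exists_admin_whl hc hu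
    exact ⟨_, _, h, .whl a b, rfl⟩
  | tryc v x e hv =>
    obtain ⟨a, e, ρ, h, hca, rfl, -, -⟩ := exists_admin_tryc hc hu
    obtain ⟨v, hv, hA, -, huv⟩ := exists_eval hca hv
    exact ⟨_, _, h.trans (hA.plug (f := .tryc x (.clos e ρ)) trivial), .tryc v x _ hv, huv⟩
  | tryf v e hv =>
    obtain ⟨a, b, h, hca, rfl, -, rfl⟩ := exists_admin_tryf hc hu
    obtain ⟨v, hv, hA, -, huv⟩ := exists_eval hca hv
    exact ⟨_, _, h.trans (hA.plug (f := .tryf b) trivial), .tryf v b hv, by rw [Clo.unload, huv]⟩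
  | label l v hv =>
    obtain ⟨d, h, hcd, rfl⟩ := exists_admin_label hc hu
    obtain ⟨v, hv, hA, -, huv⟩ := exists_eval hcd hv
    exact ⟨_, _, h.trans (hA.plug (f := .label l) trivial), .label l v hv, huv⟩
  | prim op vs v hvs hr =>
    obtain ⟨ws, h, hws, hcw, rfl⟩ := exists_eval_prim hc hvs hu
    have hcv : ∀ v ∈ ws, v.IsClosedValue := fun v hv => (hws v hv).isClosedValue (hcw v hv)
    -- The two interpretations agree on closed values only, hence the arguments are shown to be
    -- closed first.
    rw [Clo.map_unload_eq_map_force hws, hδ op ws hcv, Option.map_eq_some_iff] at hr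
    obtain ⟨v, hv, rfl⟩ := hr
    exact ⟨_, _, h, .prim op ws v hws hv, (hclosed op ws v hcv hv).unload_eq_force⟩
  | badPrim op vs hvs hr =>
    obtain ⟨ws, h, hws, hcw, rfl⟩ := exists_eval_prim hc hvs hu
    have hcv : ∀ v ∈ ws, v.IsClosedValue := fun v hv => (hws v hv).isClosedValue (hcw v hv)
    rw [Clo.map_unload_eq_map_force hws, hδ op ws hcv, Option.map_eq_none_iff] at hr
    exact ⟨_, _, h, .badPrim op ws hws hr, rfl⟩
  | badCall f vs hf hvs hbad =>
    obtain ⟨f, ws, h, hfv, -, rfl, hws, -, rfl⟩ := exists_eval_app hc hf hvs hu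
    refine ⟨_, _, h, .badCall f ws hfv hws ?_, rfl⟩
    rintro ⟨xs, e, ρ, rfl, hlen⟩
    exact hbad ⟨xs, _, rfl, by simpa using hlen⟩
  | badIndex o k ho hk hbad =>
    obtain ⟨o, k, h, hov, rfl, hkv, rfl⟩ := exists_eval_get hc ho hk hu
    exact ⟨_, _, h, .badIndex o k hov hkv (hrec hbad), rfl⟩
  | badUpdate o k v ho hk hv hbad =>
    obtain ⟨o, k, d, h, hov, rfl, hkv, rfl, hd, rfl⟩ := exists_eval_put hc ho hk hv hu
    exact ⟨_, _, h, .badUpdate o k d hov hkv hd (hrec hbad), rfl⟩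
  | badDelete o k ho hk hbad =>
    obtain ⟨o, k, h, hov, rfl, hkv, rfl⟩ := exists_eval_del hc ho hk hu
    exact ⟨_, _, h, .badDelete o k hov hkv (hrec hbad), rfl⟩
  | badCondition v a b hv hbad =>
    obtain ⟨d, a, b, h, hd, rfl, rfl, rfl⟩ := exists_eval_ite hc hv hu
    refine ⟨_, _, h, .badCondition d a b hd ?_, rfl⟩
    rintro ⟨t, rfl⟩
    exact hbad ⟨t, rfl⟩
  | badDeref v hv hbad =>
    obtain ⟨d, h, hd, rfl⟩ := exists_eval_deref hc hv hu
    refine ⟨_, _, h, .badDeref d hd ?_, rfl⟩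
    rintro ⟨a, rfl⟩
    exact hbad ⟨a, rfl⟩
  | badAssign u v hu' hv hbad =>
    obtain ⟨l, d, h, hl, rfl, hd, rfl⟩ := exists_eval_assign hc hu' hv hu
    refine ⟨_, _, h, .badAssign l d hl hd ?_, rfl⟩
    rintro ⟨a, rfl⟩
    exact hbad ⟨a, rfl⟩

end Rho

-- From `λ_JS` to `λρ_JS`: throws, breaks and single steps

theorem Frame.passesThrow_unload {f : Frame S (Clo S)} :
    f.unload.PassesThrow ↔ f.PassesThrow := by
  cases f <;> rfl

theorem Frame.passesBreak_unload {f : Frame S (Clo S)} :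
    f.unload.PassesBreak ↔ f.PassesBreak := by
  cases f <;> rfl

namespace Rho

/-- Exceptions leave the labels around them. -/
theorem reaches_throw_local {δρ : S.Op → List (Clo S) → Option (Clo S)} (σ : Store S (Clo S))
    {v : Clo S} (hv : v.IsValue) {M : List (Frame S (Clo S))} :
    ∀ {L : List (Frame S (Clo S))}, (∀ f ∈ L, f.Valid Clo.IsValue) →
      (∀ f ∈ M, f.Valid Clo.IsValue ∧ f.PassesThrow) →
      ∃ N : List (Frame S (Clo S)), (∀ f ∈ N, f.Valid Clo.IsValue ∧ f.IsLocal) ∧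
        Relation.ReflTransGen (Step δρ) (σ, .run (plugAll L (plugAll M (.throw v))))
          (σ, .run (plugAll L (plugAll N (.throw v)))) := by
  induction M with
  | nil => exact fun _ _ => ⟨[], by simp, .refl⟩
  | cons f M ih =>
    intro L hL hM
    obtain ⟨⟨hf, hp⟩, hM'⟩ := List.forall_mem_cons.1 hM
    -- The frames inside `f` are treated first, with `f` as part of the surrounding context, since
    -- labels are left from the inside out.
    obtain ⟨N, hN, h⟩ := ih (L := L ++ [f])
      (List.forall_mem_append.2 ⟨hL, by simpa using hf⟩) hM'
    simp only [plugAll_append, plugAll_cons, plugAll_nil] at h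
    by_cases hl : f.IsLocal
    · exact ⟨f :: N, List.forall_mem_cons.2 ⟨⟨hf, hl⟩, hN⟩, h⟩
    · cases f with
      | tryf f => exact hp.elim
      | label l =>
        -- Leaving the label also discards the local frames `N` inside it.
        exact ⟨[], by simp,
          h.tail (.throwLabel σ (evalCtx_plugAll hL) (localCtx_plugAll hN) v hv l)⟩
      | tryc x h => exact hp.elim
      | _ => exact (hl trivial).elim

/-- Breaks leave the exception handlers around them. -/
theorem reaches_break_local {δρ : S.Op → List (Clo S) → Option (Clo S)} (σ : Store S (Clo S))
    (l : S.Label) {v : Clo S} (hv : v.IsValue) {M : List (Frame S (Clo S))} :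
    ∀ {L : List (Frame S (Clo S))}, (∀ f ∈ L, f.Valid Clo.IsValue) →
      (∀ f ∈ M, f.Valid Clo.IsValue ∧ f.PassesBreak) →
      ∃ N : List (Frame S (Clo S)), (∀ f ∈ N, f.Valid Clo.IsValue ∧ f.IsLocal) ∧
        Relation.ReflTransGen (Step δρ) (σ, .run (plugAll L (plugAll M (.brk l v))))
          (σ, .run (plugAll L (plugAll N (.brk l v)))) := by
  induction M with
  | nil => exact fun _ _ => ⟨[], by simp, .refl⟩
  | cons f M ih =>
    intro L hL hM
    obtain ⟨⟨hf, hp⟩, hM'⟩ := List.forall_mem_cons.1 hM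
    obtain ⟨N, hN, h⟩ := ih (L := L ++ [f])
      (List.forall_mem_append.2 ⟨hL, by simpa using hf⟩) hM'
    simp only [plugAll_append, plugAll_cons, plugAll_nil] at h
    by_cases hl : f.IsLocal
    · exact ⟨f :: N, List.forall_mem_cons.2 ⟨⟨hf, hl⟩, hN⟩, h⟩
    · cases f with
      | tryf f => exact hp.elim
      | label l => exact hp.elim
      | tryc x c =>
        exact ⟨[], by simp,
          h.tail (.breakCatch σ (evalCtx_plugAll hL) (localCtx_plugAll hN) l v hv x c)⟩
      | _ => exact (hl trivial).elim

/-- A closure that denotes a `throw` inside a context reduces to a `throw` inside a context. -/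
theorem exists_reaches_throw {δρ : S.Op → List (Clo S) → Option (Clo S)} (σ : Store S (Clo S))
    {L M : List (Frame S (Expr S))} {v : Expr S} (hL : ∀ f ∈ L, f.Valid Expr.IsValue)
    (hM : ∀ f ∈ M, f.Valid Expr.IsValue ∧ f.PassesThrow) (hv : v.IsValue) {c : Clo S}
    (hc : c.Closed) (hu : c.unload = JS.plugAll L (JS.plugAll M (.throw v))) :
    ∃ (L' N : List (Frame S (Clo S))) (w : Clo S), (∀ f ∈ L', f.Valid Clo.IsValue) ∧
      (∀ f ∈ L', f.Closed) ∧ L'.map Frame.unload = L ∧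
      (∀ f ∈ N, f.Valid Clo.IsValue ∧ f.IsLocal) ∧ w.IsValue ∧ w.unload = v ∧
      Relation.ReflTransGen (Step δρ) (σ, .run c)
        (σ, .run (plugAll L' (plugAll N (.throw w)))) := by
  -- Both parts of the context are exposed together and separated afterwards. `L` must survive the
  -- reduction, while the labels in `M` are removed.
  obtain ⟨K, d, hK, hKu, hcd, hud, h⟩ := exists_admin_plugAll (L := L ++ M)
    (List.forall_mem_append.2 ⟨hL, fun f hf => (hM f hf).1⟩) (t := .throw v) (by rintro ⟨⟩) hc
    (by simpa using hu)
  obtain ⟨L', M', rfl, rfl, rfl⟩ := List.map_eq_append_iff.1 hKu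
  obtain ⟨w, hA, hw, rfl⟩ := exists_eval_throw hcd hv hud
  have hcK := (closed_plugAll.1 (h.closed_unload hc).1).1
  obtain ⟨hL', hM'⟩ := List.forall_mem_append.1 hK
  obtain ⟨N, hN, hloc⟩ := reaches_throw_local (δρ := δρ) σ hw (M := M') hL' fun f hf =>
    ⟨hM' f hf, Frame.passesThrow_unload.1 (hM _ (List.mem_map_of_mem hf)).2⟩
  refine ⟨L', N, w, hL', (List.forall_mem_append.1 hcK).1, rfl, hN, hw, rfl, ?_⟩
  have hadm := Admin.reaches (δρ := δρ) (h.trans (hA.plugAll hK)) σ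
  rw [plugAll_append] at hadm
  exact hadm.trans hloc

/-- A closure that denotes a `break` inside a context reduces to a `break` inside a context. -/
theorem exists_reaches_break {δρ : S.Op → List (Clo S) → Option (Clo S)} (σ : Store S (Clo S))
    {L M : List (Frame S (Expr S))} {l : S.Label} {v : Expr S}
    (hL : ∀ f ∈ L, f.Valid Expr.IsValue)
    (hM : ∀ f ∈ M, f.Valid Expr.IsValue ∧ f.PassesBreak) (hv : v.IsValue) {c : Clo S}
    (hc : c.Closed) (hu : c.unload = JS.plugAll L (JS.plugAll M (.brk l v))) :
    ∃ (L' N : List (Frame S (Clo S))) (w : Clo S), (∀ f ∈ L', f.Valid Clo.IsValue) ∧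
      L'.map Frame.unload = L ∧
      (∀ f ∈ N, f.Valid Clo.IsValue ∧ f.IsLocal) ∧ w.IsValue ∧ w.unload = v ∧
      Relation.ReflTransGen (Step δρ) (σ, .run c)
        (σ, .run (plugAll L' (plugAll N (.brk l w)))) := by
  obtain ⟨K, d, hK, hKu, hcd, hud, h⟩ := exists_admin_plugAll (L := L ++ M)
    (List.forall_mem_append.2 ⟨hL, fun f hf => (hM f hf).1⟩) (t := .brk l v) (by rintro ⟨⟩) hc
    (by simpa using hu)
  obtain ⟨L', M', rfl, rfl, rfl⟩ := List.map_eq_append_iff.1 hKu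
  obtain ⟨w, hA, hw, rfl⟩ := exists_eval_brk hcd hv hud
  obtain ⟨hL', hM'⟩ := List.forall_mem_append.1 hK
  obtain ⟨N, hN, hloc⟩ := reaches_break_local (δρ := δρ) σ l hw (M := M') hL' fun f hf =>
    ⟨hM' f hf, Frame.passesBreak_unload.1 (hM _ (List.mem_map_of_mem hf)).2⟩
  refine ⟨L', N, w, hL', rfl, hN, hw, rfl, ?_⟩
  have hadm := Admin.reaches (δρ := δρ) (h.trans (hA.plugAll hK)) σ
  rw [plugAll_append] at hadm
  exact hadm.trans hloc

/-- The frame of closures denoting a given control frame, in last position. -/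
theorem exists_concat_of_map_unload {K : List (Frame S (Clo S))} {L : List (Frame S (Expr S))}
    {f : Frame S (Expr S)} (h : K.map Frame.unload = L ++ [f]) :
    ∃ (L' : List (Frame S (Clo S))) (g : Frame S (Clo S)), K = L' ++ [g] ∧
      L'.map Frame.unload = L ∧ g.unload = f := by
  obtain ⟨L', M, rfl, rfl, h₁⟩ := List.map_eq_append_iff.1 h
  obtain ⟨g, M, rfl, rfl, h₂⟩ := List.map_eq_cons_iff.1 h₁
  obtain rfl := List.map_eq_nil_iff.1 h₂
  exact ⟨L', g, rfl, rfl, rfl⟩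

/-- A step of `λ_JS` from the state denoted by a closed state of `λρ_JS` is matched there. -/
theorem exists_reaches_of_step {δ : S.Op → List (Expr S) → Option (Expr S)}
    {δρ : S.Op → List (Clo S) → Option (Clo S)}
    (hδ : ∀ (op : S.Op) (vs : List (Clo S)), (∀ v ∈ vs, v.IsClosedValue) →
      δ op (vs.map Clo.force) = (δρ op vs).map Clo.force)
    (hclosed : ∀ (op : S.Op) (vs : List (Clo S)) (v : Clo S),
      (∀ v ∈ vs, v.IsClosedValue) → δρ op vs = some v → v.IsClosedValue)
    {s : State S (Clo S)} {t t' : State S (Expr S)} (h : JS.Step δ t t') (hs : ClosedState s)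
    (hu : unloadState s = t) :
    ∃ s', Relation.ReflTransGen (Step δρ) s s' ∧ unloadState s' = t' := by
  obtain ⟨σ, c | c⟩ := s
  swap
  -- An uncaught exception makes no step.
  · cases h <;> simp [unloadState] at hu
  obtain ⟨hσ, hc⟩ := hs
  have concat_valid : ∀ {L : List (Frame S (Expr S))} {f : Frame S (Expr S)},
      (∀ f ∈ L, f.Valid Expr.IsValue) → f.Valid Expr.IsValue →
      ∀ g ∈ L ++ [f], g.Valid Expr.IsValue :=
    fun hL hf => List.forall_mem_append.2 ⟨hL, List.forall_mem_singleton.2 hf⟩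
  cases h <;> simp only [unloadState, Prod.mk.injEq, Outcome.run.injEq] at hu <;>
    obtain ⟨rfl, hu⟩ := hu
  case ctx E hE e e' h =>
    obtain ⟨L, hL, rfl⟩ := hE.exists_frames
    obtain ⟨M, d, hM, rfl, hd, hud, h₁⟩ := exists_admin_plugAll hL h.core.1 hc hu
    obtain ⟨r, r', h₂, h₃, rfl⟩ := exists_red_of_unload hδ hclosed h hd hud
    exact ⟨_, (Admin.reaches (h₁.trans (h₂.plugAll hM)) σ).tail (.ctx σ (evalCtx_plugAll hM) h₃),
      by simp [unloadState, unload_plugAll]⟩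
  case alloc E hE v hv a ha =>
    obtain ⟨L, hL, rfl⟩ := hE.exists_frames
    obtain ⟨M, d, hM, rfl, hd, hud, h₁⟩ := exists_admin_plugAll hL (JS.core_alloc hv).1 hc hu
    obtain ⟨w, h₂, hw, rfl⟩ := exists_eval_alloc hd hv hud
    refine ⟨_, (Admin.reaches (h₁.trans (h₂.plugAll hM)) σ).tail
      (.alloc σ (evalCtx_plugAll hM) w hw a (by simpa using ha)), ?_⟩
    simp [unloadState, unload_plugAll, map_update, hw.unload_eq_force, Clo.unload]
  case deref E hE a v ha =>
    obtain ⟨L, hL, rfl⟩ := hE.exists_frames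
    obtain ⟨M, d, hM, rfl, hd, hud, h₁⟩ :=
      exists_admin_plugAll hL (JS.core_deref (.const _)).1 hc hu
    obtain ⟨w, h₂, hw, huw⟩ := exists_eval_deref hd (.const _) hud
    obtain rfl := eq_const_of_unload hw huw
    obtain ⟨v, hv, rfl⟩ := Option.map_eq_some_iff.1 ha
    refine ⟨_, (Admin.reaches (h₁.trans (h₂.plugAll hM)) σ).tail
      (.deref σ (evalCtx_plugAll hM) a v hv), ?_⟩
    simp [unloadState, unload_plugAll, (hσ a v hv).unload_eq_force]
  case derefDangling E hE a ha =>
    obtain ⟨L, hL, rfl⟩ := hE.exists_frames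
    obtain ⟨M, d, hM, rfl, hd, hud, h₁⟩ :=
      exists_admin_plugAll hL (JS.core_deref (.const _)).1 hc hu
    obtain ⟨w, h₂, hw, huw⟩ := exists_eval_deref hd (.const _) hud
    obtain rfl := eq_const_of_unload hw huw
    refine ⟨_, (Admin.reaches (h₁.trans (h₂.plugAll hM)) σ).tail
      (.derefDangling σ (evalCtx_plugAll hM) a (by simpa using ha)), ?_⟩
    simp [unloadState, unload_plugAll, raise, JS.raise, Clo.unload]
  case assign E hE a v hv =>
    obtain ⟨L, hL, rfl⟩ := hE.exists_frames
    obtain ⟨M, d, hM, rfl, hd, hud, h₁⟩ :=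
      exists_admin_plugAll hL (JS.core_assign (.const _) hv).1 hc hu
    obtain ⟨l, w, h₂, hl, hul, hw, rfl⟩ := exists_eval_assign hd (.const _) hv hud
    obtain rfl := eq_const_of_unload hl hul
    refine ⟨_, (Admin.reaches (h₁.trans (h₂.plugAll hM)) σ).tail
      (.assign σ (evalCtx_plugAll hM) a w hw), ?_⟩
    simp [unloadState, unload_plugAll, map_update, hw.unload_eq_force]
  case uncaught F hF v hv =>
    obtain ⟨M, hM, rfl⟩ := hF.exists_frames
    obtain ⟨L', N, w, -, -, hL', hN, hw, rfl, h⟩ :=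
      exists_reaches_throw (δρ := δρ) σ (L := []) (by simp) hM hv hc hu
    -- Nothing has to be kept around the exception, so only local frames remain, as the rule at top
    -- level asks.
    obtain rfl := List.map_eq_nil_iff.1 hL'
    exact ⟨_, h.tail (.uncaught σ (localCtx_plugAll hN) w hw),
      by simp [unloadState, hw.unload_eq_force]⟩
  case throwCatch E F hE hF v hv x e =>
    obtain ⟨L, hL, rfl⟩ := hE.exists_frames
    obtain ⟨M, hM, rfl⟩ := hF.exists_frames
    obtain ⟨K, N, w, hK, hcK, huK, hN, hw, rfl, h⟩ :=
      -- The catching frame belongs to the part of the context that is kept; only the frames between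
      -- it and the `throw` are cleared of labels.
      exists_reaches_throw (δρ := δρ) σ (L := L ++ [.tryc x e])
        (concat_valid (f := .tryc x e) hL trivial) hM hv hc
        (by simpa [JS.plug] using hu)
    obtain ⟨L', g, rfl, rfl, hg⟩ := exists_concat_of_map_unload huK
    cases g <;> simp only [Frame.unload, reduceCtorEq, Frame.tryc.injEq] at hg
    obtain ⟨rfl, rfl⟩ := hg
    have hcg := hcK _ (List.mem_append_right _ List.mem_cons_self)
    -- A closed handler is a pair, so its environment can be extended by the exception.
    obtain ⟨b, ρ, rfl, hρ⟩ := Clo.ClosedUnder.exists_clos hcg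
    simp only [plugAll_append, plugAll_cons, plugAll_nil, plug] at h
    refine ⟨_, h.tail (.throwCatch σ (evalCtx_plugAll (List.forall_mem_append.1 hK).1)
      (localCtx_plugAll hN) w hw _ b ρ), ?_⟩
    simp [unloadState, unload_plugAll, ← Clo.unloadUnder_subst hρ.2, hw.unload_eq_force]
  case throwFinally E F hE hF v hv e =>
    obtain ⟨L, hL, rfl⟩ := hE.exists_frames
    obtain ⟨M, hM, rfl⟩ := hF.exists_frames
    obtain ⟨K, N, w, hK, -, huK, hN, hw, rfl, h⟩ :=
      exists_reaches_throw (δρ := δρ) σ (L := L ++ [.tryf e])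
        (concat_valid (f := .tryf e) hL trivial) hM hv hc
        (by simpa [JS.plug] using hu)
    obtain ⟨L', g, rfl, rfl, hg⟩ := exists_concat_of_map_unload huK
    cases g <;> simp only [Frame.unload, reduceCtorEq, Frame.tryf.injEq] at hg
    subst hg
    simp only [plugAll_append, plugAll_cons, plugAll_nil, plug] at h
    refine ⟨_, h.tail (.throwFinally σ (evalCtx_plugAll (List.forall_mem_append.1 hK).1)
      (localCtx_plugAll hN) w hw _), ?_⟩
    simp [unloadState, unload_plugAll, Clo.unload]
  case breakFinally E G hE hG l v hv e =>
    obtain ⟨L, hL, rfl⟩ := hE.exists_frames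
    obtain ⟨M, hM, rfl⟩ := hG.exists_frames
    obtain ⟨K, N, w, hK, huK, hN, hw, rfl, h⟩ :=
      exists_reaches_break (δρ := δρ) σ (L := L ++ [.tryf e])
        (concat_valid (f := .tryf e) hL trivial) hM hv hc
        (by simpa [JS.plug] using hu)
    obtain ⟨L', g, rfl, rfl, hg⟩ := exists_concat_of_map_unload huK
    cases g <;> simp only [Frame.unload, reduceCtorEq, Frame.tryf.injEq] at hg
    subst hg
    simp only [plugAll_append, plugAll_cons, plugAll_nil, plug] at h
    refine ⟨_, h.tail (.breakFinally σ (evalCtx_plugAll (List.forall_mem_append.1 hK).1)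
      (localCtx_plugAll hN) l w hw _), ?_⟩
    simp [unloadState, unload_plugAll, Clo.unload]
  case breakLabel E G hE hG l v hv =>
    obtain ⟨L, hL, rfl⟩ := hE.exists_frames
    obtain ⟨M, hM, rfl⟩ := hG.exists_frames
    obtain ⟨K, N, w, hK, huK, hN, hw, rfl, h⟩ :=
      exists_reaches_break (δρ := δρ) σ (L := L ++ [.label l])
        (concat_valid (f := .label l) hL trivial) hM hv hc
        (by simpa [JS.plug] using hu)
    obtain ⟨L', g, rfl, rfl, hg⟩ := exists_concat_of_map_unload huK
    cases g <;> simp only [Frame.unload, reduceCtorEq, Frame.label.injEq] at hg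
    subst hg
    simp only [plugAll_append, plugAll_cons, plugAll_nil, plug] at h
    refine ⟨_, h.tail (.breakLabel σ (evalCtx_plugAll (List.forall_mem_append.1 hK).1)
      (localCtx_plugAll hN) _ w hw), ?_⟩
    simp [unloadState, unload_plugAll]
  case breakOther E G hE hG l l' hl v hv =>
    obtain ⟨L, hL, rfl⟩ := hE.exists_frames
    obtain ⟨M, hM, rfl⟩ := hG.exists_frames
    obtain ⟨K, N, w, hK, huK, hN, hw, rfl, h⟩ :=
      exists_reaches_break (δρ := δρ) σ (L := L ++ [.label l'])
        (concat_valid (f := .label l') hL trivial) hM hv hc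
        (by simpa [JS.plug] using hu)
    obtain ⟨L', g, rfl, rfl, hg⟩ := exists_concat_of_map_unload huK
    cases g <;> simp only [Frame.unload, reduceCtorEq, Frame.label.injEq] at hg
    subst hg
    simp only [plugAll_append, plugAll_cons, plugAll_nil, plug] at h
    refine ⟨_, h.tail (.breakOther σ (evalCtx_plugAll (List.forall_mem_append.1 hK).1)
      (localCtx_plugAll hN) l _ hl w hw), ?_⟩
    simp [unloadState, unload_plugAll, Clo.unload]
  case breakUnbound G hG l v hv =>
    obtain ⟨M, hM, rfl⟩ := hG.exists_frames
    obtain ⟨L', N, w, -, hL', hN, hw, rfl, h⟩ :=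
      exists_reaches_break (δρ := δρ) σ (L := []) (by simp) hM hv hc hu
    obtain rfl := List.map_eq_nil_iff.1 hL'
    exact ⟨_, h.tail (.breakUnbound σ (localCtx_plugAll hN) l w hw),
      by simp [unloadState, raise, JS.raise, Clo.unload]⟩

end Rho

-- Initial states, answers and the correspondence

theorem unloadState_inj (e : Expr S) : unloadState (Rho.inj e) = (emptyStore, .run e) := by
  simp only [unloadState, Rho.inj, Clo.unload, Clo.forceEnv]
  rw [e.subst_eq_self (assoc []) fun _ _ => rfl]
  rfl

theorem closedState_inj {e : Expr S} (he : e.Closed) : ClosedState (Rho.inj e) :=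
  ⟨nofun, fun x hx => by rw [he] at hx; exact hx.elim, by simp⟩

/-- On answers, the state denoted is obtained by forcing. -/
theorem IsAnswer.unloadState_eq {A : State S (Clo S)} (hA : IsAnswer Clo.IsValue A) :
    unloadState A = forceState A := by
  obtain ⟨σ, o⟩ := A
  obtain ⟨-, -, v, hv, h⟩ := hA
  simp only at h
  rcases h with rfl | rfl
  · simp [unloadState, forceState, hv.unload_eq_force]
  · rfl

/-- A closed state that denotes an answer reaches an answer that denotes the same. -/
theorem Rho.exists_reaches_answer {δρ : S.Op → List (Clo S) → Option (Clo S)}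
    {s : State S (Clo S)} (hs : ClosedState s) (hA : IsAnswer Expr.IsValue (unloadState s)) :
    ∃ A, IsAnswer Clo.IsValue A ∧ Relation.ReflTransGen (Rho.Step δρ) s A ∧
      unloadState s = forceState A := by
  obtain ⟨σ, c | c⟩ := s
  · obtain ⟨hfin, -, v, hv, h | h⟩ := hA
    · obtain ⟨w, hw, hA, -, huw⟩ := Rho.exists_eval (c := c) hs.2 (Outcome.run.inj h ▸ hv)
      refine ⟨(σ, .run w), ⟨by simpa [unloadState] using hfin, fun a v h => (hs.1 a v h).isValue,
        w, hw, .inl rfl⟩, hA.reaches σ, ?_⟩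
      simp [unloadState, forceState, ← huw, hw.unload_eq_force]
    · cases h
  · exact ⟨(σ, .err c), ⟨by simpa [unloadState] using hA.1, fun a v h => (hs.1 a v h).isValue,
      c, Clo.IsClosedValue.isValue hs.2, .inr rfl⟩, .refl, rfl⟩

/-- If a closed state of `λρ_JS` reaches an answer, then so does the state of `λ_JS` it denotes. -/
theorem Rho.reaches_forceState {δ : S.Op → List (Expr S) → Option (Expr S)}
    {δρ : S.Op → List (Clo S) → Option (Clo S)}
    (hδ : ∀ (op : S.Op) (vs : List (Clo S)), (∀ v ∈ vs, v.IsClosedValue) →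
      δ op (vs.map Clo.force) = (δρ op vs).map Clo.force)
    (hclosed : ∀ (op : S.Op) (vs : List (Clo S)) (v : Clo S),
      (∀ v ∈ vs, v.IsClosedValue) → δρ op vs = some v → v.IsClosedValue)
    {s A : State S (Clo S)} (hs : ClosedState s) (hA : IsAnswer Clo.IsValue A)
    (hA' : IsAnswer Expr.IsValue (forceState A)) (h : Relation.ReflTransGen (Rho.Step δρ) s A) :
    Relation.ReflTransGen (JS.Step δ) (unloadState s) (forceState A) := by
  -- The induction goes backwards from the answer, because what is carried along is that the rest of
  -- the reduction reaches it.
  induction h using Relation.ReflTransGen.head_induction_on with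
  | refl => rw [hA.unloadState_eq]
  | head h _ ih => exact h.reaches_answer hδ hclosed hA' hs (ih (h.closed hclosed hs))

end LambdaJS

/-- Correspondence of `λ_JS` and `λρ_JS`. The primitive operations are interpreted by `δ` on syntactic
values and by `δρ` on values with environments (`none`: undefined, a run-time error); they are
the same operations up to forcing of environments, and yield closed values. -/
theorem mainTheorem4 (S : LambdaJS.Domains)
    (δ : S.Op → List (LambdaJS.Expr S) → Option (LambdaJS.Expr S))
    (δρ : S.Op → List (LambdaJS.Clo S) → Option (LambdaJS.Clo S))
    (hδ : ∀ (op : S.Op) (vs : List (LambdaJS.Clo S)), (∀ v ∈ vs, v.IsClosedValue) →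
      δ op (vs.map LambdaJS.Clo.force) = (δρ op vs).map LambdaJS.Clo.force)
    (hclosed : ∀ (op : S.Op) (vs : List (LambdaJS.Clo S)) (v : LambdaJS.Clo S),
      (∀ v ∈ vs, v.IsClosedValue) → δρ op vs = some v → v.IsClosedValue)
    (e : LambdaJS.Expr S) (he : e.Closed)
    (A : LambdaJS.State S (LambdaJS.Expr S)) (hA : LambdaJS.IsAnswer LambdaJS.Expr.IsValue A) :
    Relation.ReflTransGen (LambdaJS.JS.Step δ) (LambdaJS.emptyStore, .run e) A ↔
      ∃ A' : LambdaJS.State S (LambdaJS.Clo S),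
        LambdaJS.IsAnswer LambdaJS.Clo.IsValue A' ∧
        Relation.ReflTransGen (LambdaJS.Rho.Step δρ) (LambdaJS.Rho.inj e) A' ∧
        A = LambdaJS.forceState A' := by
  have hs := LambdaJS.closedState_inj he
  constructor
  · intro h
    have key : ∃ s, Relation.ReflTransGen (LambdaJS.Rho.Step δρ) (LambdaJS.Rho.inj e) s ∧
        LambdaJS.unloadState s = A := by
      -- The simulation passes through intermediate states, which need not be answers.
      clear hA
      induction h with
      | refl => exact ⟨_, .refl, LambdaJS.unloadState_inj e⟩
      | tail _ h ih =>
        obtain ⟨s, h₁, hu⟩ := ih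
        obtain ⟨s', h₂, hu'⟩ := LambdaJS.Rho.exists_reaches_of_step hδ hclosed h
          (LambdaJS.Rho.closedState_of_reaches hclosed h₁ hs) hu
        exact ⟨s', h₁.trans h₂, hu'⟩
    obtain ⟨s, h₁, rfl⟩ := key
    -- The state reached denotes an answer without having to be one; administrative reductions
    -- complete it.
    obtain ⟨A', hA', h₂, hu⟩ := LambdaJS.Rho.exists_reaches_answer (δρ := δρ)
      (LambdaJS.Rho.closedState_of_reaches hclosed h₁ hs) hA
    exact ⟨A', hA', h₁.trans h₂, hu⟩
  · rintro ⟨A', hA', h, rfl⟩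
    rw [← LambdaJS.unloadState_inj]
    exact LambdaJS.Rho.reaches_forceState hδ hclosed hs hA' hA h
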